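/- **Setting.** All scalar products are linear in the first argument. Let $H,\widehat H$ be finite-dimensional complex Hilbert spaces, $\mathbb H=H\oplus\widehat H\oplus H$, $\widehat\nu=\dim\widehat H$, and $J\{h_0,\hat h,h_1\}=\{-h_1,i\hat h,h_0\}$ on $\mathbb H$. Let $\mathcal I=[a,b\rangle$, $-\infty<a<b\le\infty$ (the endpoint $b$, if finite, may or may not belong to $\mathcal I$), and let $B,\Delta$ be locally integrable operator functions on $\mathcal I$ with values in the linear operators on $\mathbb H$, with $B(t)=B(t)^*$ and $\Delta(t)\ge0$ a.e. Assume that the system $Jy'-By=\Delta f$ is definite: for every $\lambda\in\mathbb C$, a locally absolutely continuous $y$ with $Jy'-By=\lambda\Delta y$ and $\Delta y=0$ a.e. on $\mathcal I$ vanishes on $\mathcal I$. Let $\mathcal L^2_\Delta(\mathcal I)$ be the space of Borel functions $f:\mathcal I\to\mathbb H$ with $\int_{\mathcal I}(\Delta f,f)\,dt<\infty$, with the semi-scalar product $\int_{\mathcal I}(\Delta f,g)\,dt$, and let $L^2_\Delta(\mathcal I)$ be its quotient by the functions of zero seminorm; $\tilde f$ denotes the class of $f$. Let $t_{\max}$ be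 the set of all $\{y,f\}\in\mathcal L^2_\Delta(\mathcal I)^2$ with $y$ absolutely continuous on each segment $[a,\beta]\subset\mathcal I$ and $Jy'-By=\Delta f$ a.e., let $T_{\max}=\{\{\tilde y,\tilde f\}:\{y,f\}\in t_{\max}\}$, and put $[y,z]_b=\lim_{t\uparrow b}(Jy(t),z(t))$ for $y,z\in\operatorname{dom}t_{\max}$. Let $T_{\min}$ be the set of all $\{\tilde y,\tilde f\}$ with $\{y,f\}\in t_{\max}$, $y(a)=0$ and $[y,z]_b=0$ for all $z\in\operatorname{dom}t_{\max}$. Let $\nu_{b+}$ and $\nu_{b-}$ be the positive and negative inertia indices of the Hermitian form $-i[y,z]_b$ on $\operatorname{dom}t_{\max}$. For a closed symmetric relation $A$ let $n_\pm(A)=\dim\ker(A^*-\lambda)$, $\pm\operatorname{Im}\lambda>0$. Assume $n_-(T_{\min})\le n_+(T_{\min})$. Let $U=\begin{pmatrix}u_1&u_2&u_3\\u_4&u_5&u_6\end{pmatrix}:H\oplus\widehat H\oplus H\to\widehat H\oplus H$ be a surjective operator with $$iu_2u_2^*-u_1u_3^*+u_3u_1^*=iI_{\widehat H},\quad iu_5u_2^*-u_4u_3^*+u_6u_1^*=0,\quad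 iu_5u_5^*+u_6u_4^*-u_4u_6^*=0,$$ and for $y=\{y_0,\hat y,y_1\}$ put $\widehat\Gamma_ay=u_1y_0(a)+u_2\hat y(a)+u_3y_1(a)$ and $\Gamma_{1a}y=u_4y_0(a)+u_5\hat y(a)+u_6y_1(a)$. Let $\widetilde{\mathcal H}_b$ be a finite-dimensional Hilbert space, $\mathcal H_b\subset\widetilde{\mathcal H}_b$ a subspace, $P$ the orthogonal projection of $\widetilde{\mathcal H}_b$ onto $\mathcal H_b^\perp$, and let $\Gamma_b=(\Gamma_{0b},\widehat\Gamma_b,\Gamma_{1b}):\operatorname{dom}t_{\max}\to\widetilde{\mathcal H}_b\oplus\widehat H\oplus\mathcal H_b$ be a surjective linear map such that, for all $y,z\in\operatorname{dom}t_{\max}$, $$[y,z]_b=(\Gamma_{0b}y,\Gamma_{1b}z)-(\Gamma_{1b}y,\Gamma_{0b}z)+i(P\Gamma_{0b}y,P\Gamma_{0b}z)+i(\widehat\Gamma_by,\widehat\Gamma_bz).$$ For a closed symmetric relation $A$ in a Hilbert space, a subspace $\mathcal H_1$ of a Hilbert space $\mathcal H_0$, and linear maps $G_j:A^*\to\mathcal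 H_j$, the collection $\{\mathcal H_0\oplus\mathcal H_1,G_0,G_1\}$ is a *boundary triplet* for $A^*$ if $(G_0,G_1):A^*\to\mathcal H_0\oplus\mathcal H_1$ is surjective and $(f',g)-(f,g')=(G_1\hat f,G_0\hat g)-(G_0\hat f,G_1\hat g)+i(P_2G_0\hat f,P_2G_0\hat g)$ for all $\hat f=\{f,f'\},\hat g=\{g,g'\}\in A^*$, where $P_2$ is the orthogonal projection onto $\mathcal H_0\ominus\mathcal H_1$. If $\mathcal H_1=\mathcal H_0=:\mathcal H$, it is called an *ordinary* boundary triplet $\{\mathcal H,G_0,G_1\}$. **Proposition 3.6.** (1) The relation $$T=\{\{\tilde y,\tilde f\}:\{y,f\}\in t_{\max},\ \Gamma_{1a}y=0,\ \widehat\Gamma_ay=\widehat\Gamma_by,\ \Gamma_{0b}y=\Gamma_{1b}y=0\}$$ is a closed symmetric extension of $T_{\min}$, and its adjoint is $$T^*=\{\{\tilde y,\tilde f\}:\{y,f\}\in t_{\max},\ \Gamma_{1a}y=0,\ \widehat\Gamma_ay=\widehat\Gamma_by\}.$$ The indices $\nu_{b\pm}$ are finite, $\widehat\nu\le\nu_{b+}$,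 and the deficiency indices of $T$ are $n_+(T)=\nu_{b+}-\widehat\nu$ and $n_-(T)=\nu_{b-}$. (2) The equalities $\dot\Gamma_0\{\tilde y,\tilde f\}=\Gamma_{0b}y$ and $\dot\Gamma_1\{\tilde y,\tilde f\}=-\Gamma_{1b}y$ (for $\{y,f\}\in t_{\max}$ with $\{\tilde y,\tilde f\}\in T^*$) correctly define linear maps on $T^*$, and $\{\widetilde{\mathcal H}_b\oplus\mathcal H_b,\dot\Gamma_0,\dot\Gamma_1\}$ is a boundary triplet for $T^*$. The relation $A_0=\ker\dot\Gamma_0$ is maximal symmetric and $$A_0=\{\{\tilde y,\tilde f\}:\{y,f\}\in t_{\max},\ \Gamma_{1a}y=0,\ \widehat\Gamma_ay=\widehat\Gamma_by,\ \Gamma_{0b}y=0\}.$$ If in addition $n_+(T_{\min})=n_-(T_{\min})$, then $n_+(T)=n_-(T)=\nu_{b-}$, $\widetilde{\mathcal H}_b=\mathcal H_b$, $\{\mathcal H_b,\dot\Gamma_0,\dot\Gamma_1\}$ is an ordinary boundary triplet for $T^*$, and $A_0=A_0^*$. -/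

import Mathlib

open MeasureTheory Filter Topology
open scoped ComplexOrder

noncomputable section

/-! ### Linear relations in an inner product space

A linear relation in `E` is a subspace of `E × E`; its adjoint is `Submodule.adjoint`. Note that
Mathlib's `inner ℂ x y` is conjugate linear in `x`, so that the mathematicians' scalar product
`(x, y)`, linear in `x`, is written `inner ℂ y x`. -/

/-- A closed symmetric linear relation: `A ⊆ A*`. -/
def IsSymmetricRelation {E : Type*} [NormedAddCommGroup E] [InnerProductSpace ℂ E]
    (A : Submodule ℂ (E × E)) : Prop :=
  IsClosed (A : Set (E × E)) ∧ A ≤ A.adjoint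

/-- A symmetric linear relation without proper symmetric extensions in the same space. -/
def IsMaximalSymmetricRelation {E : Type*} [NormedAddCommGroup E] [InnerProductSpace ℂ E]
    (A : Submodule ℂ (E × E)) : Prop :=
  IsSymmetricRelation A ∧ ∀ A' : Submodule ℂ (E × E), IsSymmetricRelation A' → A ≤ A' → A' = A

/-- The defect subspace `ker (A* - l) = {f | {f, l f} ∈ A*}`. -/
def defectSubspace {E : Type*} [NormedAddCommGroup E] [InnerProductSpace ℂ E]
    (A : Submodule ℂ (E × E)) (l : ℂ) : Submodule ℂ E :=
  A.adjoint.comap (LinearMap.id.prod (l • LinearMap.id))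

/-- The dimension of the defect subspace at `l`; the deficiency indices `n₊(A)`, `n₋(A)` are its
values for `l` in the open upper, resp. lower, half-plane. -/
def defectNumber {E : Type*} [NormedAddCommGroup E] [InnerProductSpace ℂ E]
    (A : Submodule ℂ (E × E)) (l : ℂ) : ℕ∞ :=
  Cardinal.toENat (Module.rank ℂ (defectSubspace A l))

/-- `{𝓗₀ ⊕ 𝓗₁, G₀, G₁}`, with `𝓗₁` a subspace of `𝓗₀`, is a boundary triplet for `A*`: the map
`(G₀, G₁) : A* → 𝓗₀ ⊕ 𝓗₁` is surjective and the abstract Green identity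
`(f', g) - (f, g') = (G₁ f̂, G₀ ĝ) - (G₀ f̂, G₁ ĝ) + i (P₂ G₀ f̂, P₂ G₀ ĝ)` holds for all
`f̂ = {f, f'}` and `ĝ = {g, g'}` in `A*`, where `P₂` is the orthogonal projection of `𝓗₀` onto the
orthogonal complement of `𝓗₁`. -/
def IsBoundaryTriplet {E 𝓗₀ : Type*} [NormedAddCommGroup E] [InnerProductSpace ℂ E]
    [NormedAddCommGroup 𝓗₀] [InnerProductSpace ℂ 𝓗₀]
    (A : Submodule ℂ (E × E)) (𝓗₁ : Submodule ℂ 𝓗₀) [𝓗₁.HasOrthogonalProjection]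
    (G₀ : A.adjoint →ₗ[ℂ] 𝓗₀) (G₁ : A.adjoint →ₗ[ℂ] 𝓗₁) : Prop :=
  Function.Surjective (fun p : A.adjoint => (G₀ p, G₁ p)) ∧
  ∀ p q : A.adjoint,
    inner ℂ q.1.1 p.1.2 - inner ℂ q.1.2 p.1.1 =
      inner ℂ (G₀ q) (G₁ p : 𝓗₀) - inner ℂ (G₁ q : 𝓗₀) (G₀ p)
        + Complex.I * inner ℂ (𝓗₁ᗮ.starProjection (G₀ q)) (𝓗₁ᗮ.starProjection (G₀ p))

/-- `{𝓗, G₀, G₁}` is an ordinary boundary triplet for `A*`. -/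
def IsOrdinaryBoundaryTriplet {E 𝓗 : Type*} [NormedAddCommGroup E] [InnerProductSpace ℂ E]
    [NormedAddCommGroup 𝓗] [InnerProductSpace ℂ 𝓗]
    (A : Submodule ℂ (E × E)) (G₀ G₁ : A.adjoint →ₗ[ℂ] 𝓗) : Prop :=
  Function.Surjective (fun p : A.adjoint => (G₀ p, G₁ p)) ∧
  ∀ p q : A.adjoint,
    inner ℂ q.1.1 p.1.2 - inner ℂ q.1.2 p.1.1 =
      inner ℂ (G₀ q) (G₁ p) - inner ℂ (G₁ q) (G₀ p)

/-! ### Symmetric systems -/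

/-- The data of a first-order symmetric system `J y' - B y = Δ f` on an interval `I = [a, b⟩` with
`-∞ < a < b ≤ ∞` (the end `b`, if finite, may or may not belong to `I`): `J* = J⁻¹ = -J`, the
coefficients `B`, `Δ` are locally integrable on `I`, and `B = B*`, `Δ ≥ 0` a.e. on `I`. -/
structure SymmetricSystem (E : Type*) [NormedAddCommGroup E] [InnerProductSpace ℂ E] where
  a : ℝ
  b : EReal
  a_lt_b : (a : EReal) < b
  I : Set ℝ
  I_eq : I = {t : ℝ | a ≤ t ∧ (t : EReal) < b} ∨ I = {t : ℝ | a ≤ t ∧ (t : EReal) ≤ b}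
  J : E →L[ℂ] E
  J_skew : ∀ x y : E, inner ℂ (J x) y = -inner ℂ x (J y)
  J_sq : ∀ x : E, J (J x) = -x
  B : ℝ → E →L[ℂ] E
  Δ : ℝ → E →L[ℂ] E
  B_locInt : LocallyIntegrableOn B I volume
  Δ_locInt : LocallyIntegrableOn Δ I volume
  B_symm : ∀ᵐ t ∂(volume.restrict I), (B t : E →ₗ[ℂ] E).IsSymmetric
  Δ_pos : ∀ᵐ t ∂(volume.restrict I), (Δ t : E →ₗ[ℂ] E).IsPositive

namespace SymmetricSystem

/-- `y` is absolutely continuous on each segment `[a, β] ⊆ I`. -/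
def IsAC {E : Type*} [NormedAddCommGroup E] [InnerProductSpace ℂ E] (S : SymmetricSystem E)
    (y : ℝ → E) : Prop :=
  ∀ β ∈ S.I, AbsolutelyContinuousOnInterval y S.a β

/-- `y` is absolutely continuous and `J y' - B y = Δ f` a.e. on `I`. -/
def Solves {E : Type*} [NormedAddCommGroup E] [InnerProductSpace ℂ E] (S : SymmetricSystem E)
    (y f : ℝ → E) : Prop :=
  S.IsAC y ∧ ∀ᵐ t ∂(volume.restrict S.I),
    DifferentiableAt ℝ y t ∧ S.J (deriv y t) - S.B t (y t) = S.Δ t (f t)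

/-- The system is definite: if `J y' - B y = l Δ y` and `Δ y = 0` a.e. on `I`, then `y = 0`. -/
def IsDefinite {E : Type*} [NormedAddCommGroup E] [InnerProductSpace ℂ E]
    (S : SymmetricSystem E) : Prop :=
  ∀ (l : ℂ) (y : ℝ → E), S.Solves y (fun t => l • y t) →
    (∀ᵐ t ∂(volume.restrict S.I), S.Δ t (y t) = 0) → ∀ t ∈ S.I, y t = 0

theorem measurableSet_I {E : Type*} [NormedAddCommGroup E] [InnerProductSpace ℂ E]
    (S : SymmetricSystem E) : MeasurableSet S.I := by
  rcases S.I_eq with h | h <;> rw [h]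
  · exact measurableSet_Ici.inter (measurableSet_Iio.preimage measurable_coe_real_ereal)
  · exact measurableSet_Ici.inter (measurableSet_Iic.preimage measurable_coe_real_ereal)

theorem aestronglyMeasurable_form {E : Type*} [NormedAddCommGroup E] [InnerProductSpace ℂ E]
    (S : SymmetricSystem E) {f g : ℝ → E} (hf : StronglyMeasurable f)
    (hg : StronglyMeasurable g) :
    AEStronglyMeasurable (fun t => inner ℂ (f t) (S.Δ t (g t))) (volume.restrict S.I) := by
  have h := S.Δ_locInt.aestronglyMeasurable
  have h2 : AEStronglyMeasurable (fun t => S.Δ t (g t)) (volume.restrict S.I) :=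
    (isBoundedBilinearMap_apply (𝕜 := ℂ) (E := E) (F := E)).continuous.comp_aestronglyMeasurable
      (h.prodMk hg.aestronglyMeasurable)
  exact hf.aestronglyMeasurable.inner h2

/-- The semi-Hilbert space `𝓛²_Δ(I)` of Borel functions `f : I → E` with
`∫_I (Δ f, f) dt < ∞`. Functions on `I` are represented by their extensions by zero to `ℝ`. -/
def preL2Submodule {E : Type*} [NormedAddCommGroup E] [InnerProductSpace ℂ E]
    (S : SymmetricSystem E) : Submodule ℂ (ℝ → E) where
  carrier := {f | StronglyMeasurable f ∧ (∀ t ∉ S.I, f t = 0) ∧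
    IntegrableOn (fun t => inner ℂ (f t) (S.Δ t (f t))) S.I volume}
  zero_mem' := by
    refine ⟨stronglyMeasurable_zero, fun _ _ => rfl, ?_⟩
    simp
  add_mem' := by
    rintro f g ⟨hf, hf0, hfi⟩ ⟨hg, hg0, hgi⟩
    refine ⟨hf.add hg, fun t ht => by simp [hf0 t ht, hg0 t ht], ?_⟩
    refine Integrable.mono' ((hfi.norm.const_mul 2).add (hgi.norm.const_mul 2))
      (S.aestronglyMeasurable_form (hf.add hg) (hf.add hg)) ?_
    filter_upwards [S.Δ_pos] with t ht
    have key : ∀ x : E, 0 ≤ inner ℂ x (S.Δ t x) := fun x => ht.inner_nonneg_right x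
    have hn : ∀ x : E, (‖inner ℂ x (S.Δ t x)‖ : ℝ) = (inner ℂ x (S.Δ t x)).re := fun x =>
      RCLike.norm_of_nonneg' (K := ℂ) (key x) |> fun h => by
        have := congrArg Complex.re h
        simpa using this
    have h1 := (Complex.le_def.1 (key (f t - g t))).1
    simp only [Pi.add_apply, hn]
    simp only [map_sub, map_add, inner_sub_left, inner_sub_right, inner_add_left, inner_add_right,
      Complex.sub_re, Complex.add_re, Complex.zero_re] at h1 ⊢
    linarith
  smul_mem' := by
    rintro c f ⟨hf, hf0, hfi⟩
    refine ⟨hf.const_smul c, fun t ht => by simp [hf0 t ht], ?_⟩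
    have : (fun t => inner ℂ ((c • f) t) (S.Δ t ((c • f) t)))
        = fun t => (starRingEnd ℂ c * c) * inner ℂ (f t) (S.Δ t (f t)) := by
      funext t
      simp only [Pi.smul_apply, map_smul, inner_smul_left, inner_smul_right]
      ring
    rw [this]
    exact hfi.const_mul _

/-- The semi-Hilbert space `𝓛²_Δ(I)` as a type. -/
def PreL2 {E : Type*} [NormedAddCommGroup E] [InnerProductSpace ℂ E]
    (S : SymmetricSystem E) : Type _ := S.preL2Submodule

instance {E : Type*} [NormedAddCommGroup E] [InnerProductSpace ℂ E]
    (S : SymmetricSystem E) : AddCommGroup S.PreL2 :=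
  inferInstanceAs (AddCommGroup S.preL2Submodule)

instance {E : Type*} [NormedAddCommGroup E] [InnerProductSpace ℂ E]
    (S : SymmetricSystem E) : Module ℂ S.PreL2 :=
  inferInstanceAs (Module ℂ S.preL2Submodule)

/-- The function underlying an element of `𝓛²_Δ(I)`. -/
def PreL2.toFun {E : Type*} [NormedAddCommGroup E] [InnerProductSpace ℂ E]
    {S : SymmetricSystem E} : S.PreL2 →ₗ[ℂ] (ℝ → E) :=
  S.preL2Submodule.subtype

theorem PreL2.integrable {E : Type*} [NormedAddCommGroup E] [InnerProductSpace ℂ E]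
    {S : SymmetricSystem E} (f g : S.PreL2) :
    IntegrableOn (fun t => inner ℂ (f.toFun t) (S.Δ t (g.toFun t))) S.I volume := by
  have q : ∀ h : S.PreL2,
      IntegrableOn (fun t => inner ℂ (h.toFun t) (S.Δ t (h.toFun t))) S.I volume :=
    fun h => h.2.2.2
  have h := ((((q (f + g)).sub (q (f - g))).sub ((q (f + Complex.I • g)).const_mul Complex.I)).add
    ((q (f - Complex.I • g)).const_mul Complex.I)).div_const 4
  refine h.congr ?_
  filter_upwards [S.Δ_pos] with t ht
  have hs : ∀ x y : E, inner ℂ x (S.Δ t y) = inner ℂ (S.Δ t x) y := fun x y =>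
    (ht.isSymmetric x y).symm
  have hp := inner_map_polarization' (S.Δ t : E →ₗ[ℂ] E) (f.toFun t) (g.toFun t)
  simp only [ContinuousLinearMap.coe_coe] at hp
  simp only [Pi.add_apply, Pi.sub_apply, map_add, map_sub, map_smul, Pi.smul_apply] at hp ⊢
  simp only [← map_smul, ← map_add, ← map_sub, hs] at hp ⊢
  exact hp.symm

/-- The semi-scalar product `(f, g)_Δ = ∫_I (Δ f, g) dt` of `𝓛²_Δ(I)`. -/
@[reducible]
def preL2Core {E : Type*} [NormedAddCommGroup E] [InnerProductSpace ℂ E]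
    (S : SymmetricSystem E) : PreInnerProductSpace.Core ℂ S.PreL2 where
  inner f g := ∫ t in S.I, inner ℂ (f.toFun t) (S.Δ t (g.toFun t))
  conj_inner_symm f g := by
    rw [← integral_conj]
    refine integral_congr_ae ?_
    filter_upwards [S.Δ_pos] with t ht
    rw [inner_conj_symm]
    exact ht.isSymmetric _ _
  re_inner_nonneg f := by
    rw [← integral_re (PreL2.integrable f f)]
    refine integral_nonneg_of_ae ?_
    filter_upwards [S.Δ_pos] with t ht
    exact ht.re_inner_nonneg_right _
  add_left f g h := by
    rw [← integral_add (PreL2.integrable f h) (PreL2.integrable g h)]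
    simp only [map_add, Pi.add_apply, inner_add_left]
  smul_left f g c := by
    rw [← integral_const_mul]
    simp only [map_smul, Pi.smul_apply, inner_smul_left]

instance {E : Type*} [NormedAddCommGroup E] [InnerProductSpace ℂ E]
    (S : SymmetricSystem E) : SeminormedAddCommGroup S.PreL2 :=
  { @InnerProductSpace.Core.toSeminormedAddCommGroup ℂ S.PreL2 _ _ _ S.preL2Core with
    toAddCommGroup := inferInstance }

instance {E : Type*} [NormedAddCommGroup E] [InnerProductSpace ℂ E]
    (S : SymmetricSystem E) : InnerProductSpace ℂ S.PreL2 :=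
  InnerProductSpace.ofCore S.preL2Core

/-- The Hilbert space `L²_Δ(I)`, the quotient of `𝓛²_Δ(I)` by `{f | ‖f‖_Δ = 0}`. -/
abbrev L2 {E : Type*} [NormedAddCommGroup E] [InnerProductSpace ℂ E]
    (S : SymmetricSystem E) : Type _ := SeparationQuotient S.PreL2

/-- The quotient map `{y, f} ↦ {ỹ, f̃}` from `𝓛²_Δ(I) × 𝓛²_Δ(I)` to `L²_Δ(I) × L²_Δ(I)`. -/
def quot {E : Type*} [NormedAddCommGroup E] [InnerProductSpace ℂ E]
    (S : SymmetricSystem E) : S.PreL2 × S.PreL2 →ₗ[ℂ] S.L2 × S.L2 :=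
  (SeparationQuotient.mkCLM ℂ S.PreL2 : S.PreL2 →ₗ[ℂ] S.L2).prodMap
    (SeparationQuotient.mkCLM ℂ S.PreL2 : S.PreL2 →ₗ[ℂ] S.L2)

/-- The maximal relation in `𝓛²_Δ(I)`: all `{y, f}` with `y` absolutely continuous and
`J y' - B y = Δ f` a.e. on `I`. -/
def tmax {E : Type*} [NormedAddCommGroup E] [InnerProductSpace ℂ E]
    (S : SymmetricSystem E) : Submodule ℂ (S.PreL2 × S.PreL2) where
  carrier := {p | S.Solves p.1.toFun p.2.toFun}
  zero_mem' := by
    have h0 : (0 : S.PreL2).toFun = fun _ => (0 : E) := by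
      rw [map_zero]; rfl
    refine ⟨fun β _ => ?_, ?_⟩
    · simp only [Prod.fst_zero, h0]
      simpa [AbsolutelyContinuousOnInterval] using tendsto_const_nhds
    · simp [h0]
  add_mem' := by
    rintro p q ⟨hp, hp'⟩ ⟨hq, hq'⟩
    refine ⟨fun β hβ => ?_, ?_⟩
    · simpa using (hp β hβ).add (hq β hβ)
    · filter_upwards [hp', hq'] with t h1 h2
      simp only [Prod.fst_add, Prod.snd_add, map_add]
      refine ⟨h1.1.add h2.1, ?_⟩
      rw [deriv_add h1.1 h2.1]
      simp only [Pi.add_apply, map_add, ← h1.2, ← h2.2]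
      abel
  smul_mem' := by
    rintro c p ⟨hp, hp'⟩
    refine ⟨fun β hβ => ?_, ?_⟩
    · simp only [Prod.smul_fst, map_smul]
      exact (hp β hβ).const_smul c
    · filter_upwards [hp'] with t h1
      simp only [Prod.smul_fst, Prod.smul_snd, map_smul]
      refine ⟨h1.1.const_smul c, ?_⟩
      rw [deriv_const_smul c h1.1]
      simp only [Pi.smul_apply, map_smul, ← h1.2, smul_sub]

/-- `dom tmax`. -/
def domTmax {E : Type*} [NormedAddCommGroup E] [InnerProductSpace ℂ E]
    (S : SymmetricSystem E) : Submodule ℂ S.PreL2 :=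
  S.tmax.map (LinearMap.fst ℂ S.PreL2 S.PreL2)

theorem mem_domTmax {E : Type*} [NormedAddCommGroup E] [InnerProductSpace ℂ E]
    (S : SymmetricSystem E) {y f : S.PreL2} (h : (y, f) ∈ S.tmax) : y ∈ S.domTmax :=
  ⟨(y, f), h, rfl⟩

/-- The boundary form `[y, z]_b = lim_{t ↑ b} (J y(t), z(t))` on `dom tmax`. -/
def boundaryForm {E : Type*} [NormedAddCommGroup E] [InnerProductSpace ℂ E]
    (S : SymmetricSystem E) (y z : S.domTmax) : ℂ :=
  limUnder (comap (fun t : ℝ => (t : EReal)) (𝓝[<] S.b))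
    (fun t => inner ℂ (z.1.toFun t) (S.J (y.1.toFun t)))

/-- The inertia index `ν_{b+}` of the skew-Hermitian form `[y, z]_b`: the largest dimension of a
subspace on which the Hermitian form `-i [y, z]_b` is positive definite. -/
def nuBPlus {E : Type*} [NormedAddCommGroup E] [InnerProductSpace ℂ E]
    (S : SymmetricSystem E) : ℕ∞ :=
  ⨆ (W : Submodule ℂ S.domTmax)
    (_ : ∀ y ∈ W, y ≠ 0 → 0 < (-Complex.I * S.boundaryForm y y).re),
    Cardinal.toENat (Module.rank ℂ W)

/-- The inertia index `ν_{b-}` of the skew-Hermitian form `[y, z]_b`: the largest dimension of a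
subspace on which the Hermitian form `-i [y, z]_b` is negative definite. -/
def nuBMinus {E : Type*} [NormedAddCommGroup E] [InnerProductSpace ℂ E]
    (S : SymmetricSystem E) : ℕ∞ :=
  ⨆ (W : Submodule ℂ S.domTmax)
    (_ : ∀ y ∈ W, y ≠ 0 → (-Complex.I * S.boundaryForm y y).re < 0),
    Cardinal.toENat (Module.rank ℂ W)

/-- The relation in `L²_Δ(I)` of all `{ỹ, f̃}` with `{y, f} ∈ tmax` and `y ∈ D`. -/
def relationOf {E : Type*} [NormedAddCommGroup E] [InnerProductSpace ℂ E]
    (S : SymmetricSystem E) (D : Submodule ℂ S.domTmax) : Submodule ℂ (S.L2 × S.L2) :=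
  (S.tmax ⊓ (D.map S.domTmax.subtype).comap (LinearMap.fst ℂ S.PreL2 S.PreL2)).map S.quot

/-- The value `y(a)`, as a linear map on `dom tmax`. -/
def evalA {E : Type*} [NormedAddCommGroup E] [InnerProductSpace ℂ E]
    (S : SymmetricSystem E) : S.domTmax →ₗ[ℂ] E :=
  LinearMap.proj S.a ∘ₗ PreL2.toFun ∘ₗ S.domTmax.subtype

/-- `dom tmin`: all `y ∈ dom tmax` with `y(a) = 0` and `[y, z]_b = 0` for each `z ∈ dom tmax`. -/
def domTmin {E : Type*} [NormedAddCommGroup E] [InnerProductSpace ℂ E]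
    (S : SymmetricSystem E) : Submodule ℂ S.domTmax where
  carrier := {y | y.1.toFun S.a = 0 ∧ ∀ z : S.domTmax,
    Tendsto (fun t => inner ℂ (z.1.toFun t) (S.J (y.1.toFun t)))
      (comap (fun t : ℝ => (t : EReal)) (𝓝[<] S.b)) (𝓝 0)}
  zero_mem' := by
    refine ⟨by simp, fun z => ?_⟩
    simpa using tendsto_const_nhds
  add_mem' := by
    rintro y w ⟨hy, hy'⟩ ⟨hw, hw'⟩
    refine ⟨by simp [hy, hw], fun z => ?_⟩
    simpa [inner_add_right] using (hy' z).add (hw' z)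
  smul_mem' := by
    rintro c y ⟨hy, hy'⟩
    refine ⟨by simp [hy], fun z => ?_⟩
    simpa [inner_smul_right] using (hy' z).const_mul c

/-- The maximal relation `Tmax` in `L²_Δ(I)`. -/
def Tmax {E : Type*} [NormedAddCommGroup E] [InnerProductSpace ℂ E]
    (S : SymmetricSystem E) : Submodule ℂ (S.L2 × S.L2) := S.tmax.map S.quot

/-- The minimal relation `Tmin` in `L²_Δ(I)`. -/
def Tmin {E : Type*} [NormedAddCommGroup E] [InnerProductSpace ℂ E]
    (S : SymmetricSystem E) : Submodule ℂ (S.L2 × S.L2) := S.relationOf S.domTmin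

end SymmetricSystem

/-! ### The normal form of the signature operator, and the boundary operator at `a` -/

/-- `H ⊕ Ĥ ⊕ H` (orthogonal sum). -/
abbrev Tri (H K : Type*) [NormedAddCommGroup H] [InnerProductSpace ℂ H]
    [NormedAddCommGroup K] [InnerProductSpace ℂ K] : Type _ :=
  WithLp 2 (H × WithLp 2 (K × H))

/-- The operator `J {h₀, ĥ, h₁} = {-h₁, i ĥ, h₀}` in `H ⊕ Ĥ ⊕ H`. -/
def triJ (H K : Type*) [NormedAddCommGroup H] [InnerProductSpace ℂ H]
    [NormedAddCommGroup K] [InnerProductSpace ℂ K] (x : Tri H K) : Tri H K :=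
  WithLp.toLp 2 (-x.snd.snd, WithLp.toLp 2 (Complex.I • x.snd.fst, x.fst))

/-- The operator `U = (u₁ u₂ u₃; u₄ u₅ u₆) : H ⊕ Ĥ ⊕ H → Ĥ ⊕ H` with range `Ĥ ⊕ H`, satisfying
`i u₂ u₂* - u₁ u₃* + u₃ u₁* = i I`, `i u₅ u₂* - u₄ u₃* + u₆ u₁* = 0` and
`i u₅ u₅* + u₆ u₄* - u₄ u₆* = 0`. -/
structure BoundaryOperator (H K : Type*)
    [NormedAddCommGroup H] [InnerProductSpace ℂ H] [FiniteDimensional ℂ H]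
    [NormedAddCommGroup K] [InnerProductSpace ℂ K] [FiniteDimensional ℂ K] where
  u₁ : H →ₗ[ℂ] K
  u₂ : K →ₗ[ℂ] K
  u₃ : H →ₗ[ℂ] K
  u₄ : H →ₗ[ℂ] H
  u₅ : K →ₗ[ℂ] H
  u₆ : H →ₗ[ℂ] H
  surj : ∀ (k : K) (h : H), ∃ (x₀ : H) (x : K) (x₁ : H),
    u₁ x₀ + u₂ x + u₃ x₁ = k ∧ u₄ x₀ + u₅ x + u₆ x₁ = h
  rel₁ : Complex.I • (u₂ ∘ₗ u₂.adjoint) - u₁ ∘ₗ u₃.adjoint + u₃ ∘ₗ u₁.adjoint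
    = Complex.I • LinearMap.id
  rel₂ : Complex.I • (u₅ ∘ₗ u₂.adjoint) - u₄ ∘ₗ u₃.adjoint + u₆ ∘ₗ u₁.adjoint = 0
  rel₃ : Complex.I • (u₅ ∘ₗ u₅.adjoint) + u₆ ∘ₗ u₄.adjoint - u₄ ∘ₗ u₆.adjoint = 0

/-- The map `y ↦ Γ̂_a y = u₁ y₀(a) + u₂ ŷ(a) + u₃ y₁(a)` on `dom tmax`. -/
def BoundaryOperator.gammaHatA {H K : Type*}
    [NormedAddCommGroup H] [InnerProductSpace ℂ H] [FiniteDimensional ℂ H]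
    [NormedAddCommGroup K] [InnerProductSpace ℂ K] [FiniteDimensional ℂ K]
    (U : BoundaryOperator H K) (S : SymmetricSystem (Tri H K)) : S.domTmax →ₗ[ℂ] K :=
  (U.u₁ ∘ₗ WithLp.fstₗ 2 ℂ H (WithLp 2 (K × H))
    + U.u₂ ∘ₗ WithLp.fstₗ 2 ℂ K H ∘ₗ WithLp.sndₗ 2 ℂ H (WithLp 2 (K × H))
    + U.u₃ ∘ₗ WithLp.sndₗ 2 ℂ K H ∘ₗ WithLp.sndₗ 2 ℂ H (WithLp 2 (K × H))) ∘ₗ S.evalA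

/-- The map `y ↦ Γ_{1a} y = u₄ y₀(a) + u₅ ŷ(a) + u₆ y₁(a)` on `dom tmax`. -/
def BoundaryOperator.gamma1A {H K : Type*}
    [NormedAddCommGroup H] [InnerProductSpace ℂ H] [FiniteDimensional ℂ H]
    [NormedAddCommGroup K] [InnerProductSpace ℂ K] [FiniteDimensional ℂ K]
    (U : BoundaryOperator H K) (S : SymmetricSystem (Tri H K)) : S.domTmax →ₗ[ℂ] H :=
  (U.u₄ ∘ₗ WithLp.fstₗ 2 ℂ H (WithLp 2 (K × H))
    + U.u₅ ∘ₗ WithLp.fstₗ 2 ℂ K H ∘ₗ WithLp.sndₗ 2 ℂ H (WithLp 2 (K × H))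
    + U.u₆ ∘ₗ WithLp.sndₗ 2 ℂ K H ∘ₗ WithLp.sndₗ 2 ℂ H (WithLp 2 (K × H))) ∘ₗ S.evalA

end

/-! # Symmetric extensions of the minimal relation given by boundary conditions

The Lagrange identity `(f, z) - (y, g) = [y, z]_b - (J y(a), z(a))` for `{y, f}`, `{z, g}` in `tmax`
(`SymmetricSystem.tendsto_inner_J`, `SymmetricSystem.boundaryForm_eq`) shows that the boundary form
is a genuine limit and reduces symmetry, adjoints and deficiency indices of restrictions of `Tmax`
to linear algebra in the finite-dimensional space of boundary values `(y(a), Γ_b y)`, once three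
analytic facts are available.

* Every vector of boundary values is attained. The linear equation with integrable coefficients is
  solved by a contraction in a weighted space (`exists_eq_add_integral`). A definite system is
  definite on some segment `[a, β]` (`IsDefinite.exists_segment`), so the Gram operator of the
  homogeneous solutions on `[a, β]` is onto, and by variation of constants `y(a)` may be prescribed
  for functions vanishing near `b` (`IsDefinite.exists_domTmax_apply_a`).
* `(Tmin)* ⊆ Tmax` (`IsDefinite.exists_tmax_of_mem_adjoint_Tmin`): an element `{z̃, g̃}` of the
  adjoint is compared on each `[a, β]` with a solution `w` of the equation with right-hand side `g`;
  the difference is orthogonal to the orthogonal complement of the homogeneous solutions, hence is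
  one of them modulo null functions. Hence the adjoint of a relation between `Tmin` and `Tmax` is
  the relation given by the adjoint boundary conditions (`IsDefinite.adjoint_relationOf`).
* `L²_Δ(I)` is complete (`completeSpace_preL2`): `f ↦ √Δ f` is an isometry into `L²`, and its range
  is closed because the parts of `f(t)` orthogonal to `ker Δ(t)`, which depend measurably on `t` by
  the mean ergodic theorem, are controlled by `√Δ f`.

Completeness yields von Neumann's decomposition of the adjoint of a closed symmetric relation, by
which the deficiency indices are the inertia indices of the form induced by the Green identity on
the boundary values (`IsSymmetricRelation.defectNumber_eq`).

By the relations for `U`, the kernel of its second row `U₁ = (u₄ u₅ u₆)` is spanned by the ranges of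
`J Û*` and `J U₁*`, where `Û = (u₁ u₂ u₃)`, and `(J x, z) = i (Û x, Û z)` on it
(`BoundaryOperator.inner_triJ_of_one_eq_zero`). So under the conditions `Γ_{1a} y = 0`,
`Γ̂_a y = Γ̂_b y` the contributions of `a` and of `Γ̂_b` cancel, and the Green identity becomes
`(Γ_{0b} y, Γ_{1b} z) - (Γ_{1b} y, Γ_{0b} z) + i (P Γ_{0b} y, P Γ_{0b} z)`, called `tripletForm`
below. It is nondegenerate with inertia indices `dim 𝓗`, `dim 𝓗_b`, while `-i [y, z]_b` has the
inertia indices `dim 𝓗 + dim Ĥ`, `dim 𝓗_b`. The orthogonal complement of the subspace `v₀ = 0` with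
respect to `tripletForm` is `v₀ ∈ 𝓗_bᗮ`, on which the form is `i ‖v₀‖²`, so that `A₀` is maximal
symmetric. The deficiency indices of `Tmin` are `dim H + dim Ĥ + dim 𝓗` and
`dim H + dim Ĥ + dim 𝓗_b`; their equality forces `𝓗_b = 𝓗`. -/

/-! ### Absolutely continuous functions with values in a normed space -/

section AbsolutelyContinuous

open Set

/-- A function whose increments are controlled by those of two absolutely continuous functions is
absolutely continuous. -/
theorem AbsolutelyContinuousOnInterval.of_dist_le {X Y Z : Type*} [PseudoMetricSpace X]
    [PseudoMetricSpace Y] [PseudoMetricSpace Z] {f : ℝ → X} {g : ℝ → Y} {h : ℝ → Z} {a b C D : ℝ}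
    (hf : AbsolutelyContinuousOnInterval f a b) (hg : AbsolutelyContinuousOnInterval g a b)
    (H : ∀ s ∈ uIcc a b, ∀ t ∈ uIcc a b,
      dist (h s) (h t) ≤ C * dist (f s) (f t) + D * dist (g s) (g t)) :
    AbsolutelyContinuousOnInterval h a b := by
  have hlim := (Tendsto.const_mul C hf).add (Tendsto.const_mul D hg)
  simp only [mul_zero, add_zero] at hlim
  refine squeeze_zero' (Eventually.of_forall fun t => Finset.sum_nonneg fun _ _ => dist_nonneg) ?_
    hlim
  filter_upwards [mem_inf_of_right (mem_principal_self _)] with P hP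
  rw [Finset.mul_sum, Finset.mul_sum, ← Finset.sum_add_distrib]
  exact Finset.sum_le_sum fun i hi => H _ (hP.1 i hi).1 _ (hP.1 i hi).2

theorem AbsolutelyContinuousOnInterval.congr {X : Type*} [PseudoMetricSpace X] {f g : ℝ → X}
    {a b : ℝ} (hf : AbsolutelyContinuousOnInterval f a b) (h : ∀ t ∈ uIcc a b, g t = f t) :
    AbsolutelyContinuousOnInterval g a b :=
  hf.of_dist_le (C := 1) (D := 0) hf fun s hs t ht => by simp [h s hs, h t ht]

theorem AbsolutelyContinuousOnInterval.intervalIntegral {E : Type*} [NormedAddCommGroup E]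
    [NormedSpace ℝ E] {f : ℝ → E} {a b : ℝ} (hf : IntervalIntegrable f volume a b) :
    AbsolutelyContinuousOnInterval (fun t => ∫ s in a..t, f s) a b := by
  have hG := hf.norm.absolutelyContinuousOnInterval_intervalIntegral (c := a) left_mem_uIcc
  refine hG.of_dist_le (C := 1) (D := 0) hG fun s hs t ht => ?_
  have hs' : IntervalIntegrable f volume a s := hf.mono_set (uIcc_subset_uIcc_left hs)
  have ht' : IntervalIntegrable f volume a t := hf.mono_set (uIcc_subset_uIcc_left ht)
  rw [one_mul, zero_mul, add_zero, dist_eq_norm, dist_eq_norm,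
    intervalIntegral.integral_interval_sub_left hs' ht',
    intervalIntegral.integral_interval_sub_left hs'.norm ht'.norm, Real.norm_eq_abs]
  exact intervalIntegral.norm_integral_le_abs_integral_norm

/-- The fundamental theorem of calculus for absolutely continuous functions with values in a Banach
space, the derivative being assumed to exist and to be integrable. -/
theorem AbsolutelyContinuousOnInterval.integral_eq_sub {E : Type*} [NormedAddCommGroup E]
    [NormedSpace ℝ E] [CompleteSpace E] {f f' : ℝ → E} {a b : ℝ}
    (hf : AbsolutelyContinuousOnInterval f a b)
    (hd : ∀ᵐ t, t ∈ uIcc a b → HasDerivAt f (f' t) t)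
    (hi : IntervalIntegrable f' volume a b) : ∫ t in a..b, f' t = f b - f a := by
  have hc := hf.sub (AbsolutelyContinuousOnInterval.intervalIntegral hi)
  obtain ⟨C, hC⟩ := hc.const_of_ae_hasDerivAt_zero (by
    filter_upwards [hd, hi.ae_hasDerivAt_integral] with t h1 h2 ht
    simpa using (h1 ht).sub (h2 ht a left_mem_uIcc))
  have h1 := hC a left_mem_uIcc
  have h2 := hC b right_mem_uIcc
  simp only [Pi.sub_apply, intervalIntegral.integral_same, sub_zero] at h1 h2
  rw [h1, ← h2]
  abel

/-- The weight `exp (2 ∫ k)` turns integration against `k` into a strict contraction. -/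
theorem integral_mul_exp_two_integral {k : ℝ → ℝ} {a b : ℝ}
    (hk : IntervalIntegrable k volume a b) :
    ∫ t in a..b, k t * Real.exp (2 * ∫ s in a..t, k s)
      = (Real.exp (2 * ∫ s in a..b, k s) - 1) / 2 := by
  have hK := AbsolutelyContinuousOnInterval.intervalIntegral hk
  obtain ⟨M, hM⟩ := hK.exists_bound
  have hM0 : 0 ≤ M := (norm_nonneg _).trans (hM a left_mem_uIcc)
  obtain ⟨L, hL⟩ := ((Real.contDiff_exp (n := 1)).comp
    (contDiff_const.mul contDiff_id : ContDiff ℝ 1 fun x : ℝ => 2 * x)).contDiffOn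
      (s := Icc (-M) M) |>.exists_lipschitzOnWith (by decide) (convex_Icc _ _) isCompact_Icc
  have hE : AbsolutelyContinuousOnInterval (fun t => Real.exp (2 * ∫ s in a..t, k s)) a b := by
    refine hK.of_dist_le (C := L) (D := 0) hK fun s hs t ht => ?_
    have := hL.dist_le_mul _ (abs_le.1 (hM s hs)) _ (abs_le.1 (hM t ht))
    simpa using this
  have h := hE.integral_eq_sub (f' := fun t => 2 * (k t * Real.exp (2 * ∫ s in a..t, k s))) (by
      filter_upwards [hk.ae_hasDerivAt_integral] with t ht hts
      exact ((ht hts a left_mem_uIcc).const_mul 2).exp.congr_deriv (by ring))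
    ((hk.mul_continuousOn hE.continuousOn).const_mul 2)
  rw [intervalIntegral.integral_const_mul] at h
  simp only [intervalIntegral.integral_same, mul_zero, Real.exp_zero] at h
  linarith

end AbsolutelyContinuous

/-! ### Linear differential equations with integrable coefficients -/

section LinearODE

open Set

theorem MeasureTheory.IntegrableOn.clm_apply_continuousOn {E : Type*} [NormedAddCommGroup E]
    [NormedSpace ℂ E] {A : ℝ → E →L[ℂ] E} {v : ℝ → E} {a b : ℝ}
    (hA : IntegrableOn A (Icc a b)) (hv : ContinuousOn v (Icc a b)) :
    IntegrableOn (fun t => A t (v t)) (Icc a b) := by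
  obtain ⟨C, hC⟩ := isCompact_Icc.exists_bound_of_continuousOn hv
  refine Integrable.mono' (hA.norm.mul_const C) ?_ ?_
  · have happ := (isBoundedBilinearMap_apply (𝕜 := ℂ) (E := E) (F := E)).continuous
    exact happ.comp_aestronglyMeasurable
      (hA.aestronglyMeasurable.prodMk
        (hv.aestronglyMeasurable_of_isCompact isCompact_Icc measurableSet_Icc))
  · filter_upwards [ae_restrict_mem measurableSet_Icc] with t ht
    exact (ContinuousLinearMap.le_opNorm _ _).trans
      (mul_le_mul_of_nonneg_left (hC t ht) (norm_nonneg _))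

/-- Continuity on an interval with left end `a` is continuity on all its segments `[a, b]`. -/
theorem continuousOn_of_forall_Icc {X : Type*} [TopologicalSpace X] {f : ℝ → X} {I : Set ℝ} {a : ℝ}
    (hI : ∀ b ∈ I, a ≤ b ∧ Icc a b ⊆ I) (h : ∀ b ∈ I, ContinuousOn f (Icc a b)) :
    ContinuousOn f I := by
  intro t ht
  by_cases hb : ∃ b ∈ I, t < b
  · obtain ⟨b, hb, htb⟩ := hb
    refine (h b hb t ⟨(hI t ht).1, htb.le⟩).mono_of_mem_nhdsWithin ?_
    filter_upwards [self_mem_nhdsWithin, mem_nhdsWithin_of_mem_nhds (Iio_mem_nhds htb)]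
      with s hs hs'
    exact ⟨(hI s hs).1, le_of_lt hs'⟩
  · push Not at hb
    exact (h t ht t ⟨(hI t ht).1, le_rfl⟩).mono fun s hs => ⟨(hI s hs).1, hb s hs⟩

theorem MeasureTheory.IntegrableOn.intervalIntegrable_of_le {F : Type*} [NormedAddCommGroup F]
    {f : ℝ → F} {a b : ℝ} (hf : IntegrableOn f (Icc a b)) (hab : a ≤ b) :
    IntervalIntegrable f volume a b :=
  (intervalIntegrable_iff_integrableOn_Icc_of_le hab).2 hf

theorem continuousOn_primitive_of_forall_Icc {F : Type*} [NormedAddCommGroup F] [NormedSpace ℝ F]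
    {f : ℝ → F} {I : Set ℝ} {a : ℝ} (hI : ∀ b ∈ I, a ≤ b ∧ Icc a b ⊆ I)
    (hf : ∀ b ∈ I, IntegrableOn f (Icc a b)) : ContinuousOn (fun t => ∫ s in a..t, f s) I := by
  refine continuousOn_of_forall_Icc hI fun b hb => ?_
  have := intervalIntegral.continuousOn_primitive_interval (μ := volume) (f := f) (a := a) (b := b)
    (by rw [uIcc_of_le (hI b hb).1]; exact hf b hb)
  rwa [uIcc_of_le (hI b hb).1] at this

/-- Existence for the linear equation `y' = A y + g` with locally integrable coefficients on an
interval, in integrated form. With `k = ‖A‖ + ‖g‖` and the weight `w = exp (2 ∫ k)`, the equation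
for `w⁻¹ y` is a fixed point equation for a contraction of the bounded continuous functions. -/
theorem exists_eq_add_integral {E : Type*} [NormedAddCommGroup E] [NormedSpace ℂ E]
    [CompleteSpace E] {I : Set ℝ} {a : ℝ} (hI : ∀ b ∈ I, a ≤ b ∧ Icc a b ⊆ I)
    {A : ℝ → E →L[ℂ] E} {g : ℝ → E} (hA : ∀ b ∈ I, IntegrableOn A (Icc a b))
    (hg : ∀ b ∈ I, IntegrableOn g (Icc a b)) (x : E) :
    ∃ y : ℝ → E, ContinuousOn y I ∧ ∀ t ∈ I, y t = x + ∫ s in a..t, (A s (y s) + g s) := by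
  classical
  set k : ℝ → ℝ := fun s => ‖A s‖ + ‖g s‖ with hk
  set w : ℝ → ℝ := fun t => Real.exp (2 * ∫ s in a..t, k s) with hw
  have hki : ∀ b ∈ I, IntegrableOn k (Icc a b) := fun b hb => (hA b hb).norm.add (hg b hb).norm
  have hwc : ContinuousOn w I :=
    Real.continuous_exp.comp_continuousOn
      (continuousOn_const.mul (continuousOn_primitive_of_forall_Icc hI hki))
  have hw0 : ∀ t, 0 < w t := fun t => Real.exp_pos _
  have hw1 : ∀ t ∈ I, 1 ≤ w t := fun t ht => Real.one_le_exp (mul_nonneg zero_le_two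
    (intervalIntegral.integral_nonneg (hI t ht).1 fun s _ => by positivity))
  have hwk : ∀ t ∈ I, ∫ s in a..t, k s * w s ≤ w t / 2 := fun t ht => by
    rw [hw, integral_mul_exp_two_integral ((hki t ht).intervalIntegrable_of_le (hI t ht).1)]
    linarith
  have hwki : ∀ t ∈ I, IntervalIntegrable (fun s => k s * w s) volume a t := fun t ht =>
    ((hki t ht).intervalIntegrable_of_le (hI t ht).1).mul_continuousOn
      (by rw [uIcc_of_le (hI t ht).1]; exact hwc.mono (hI t ht).2)
  let ext : (BoundedContinuousFunction I E) → ℝ → E := fun u s => if h : s ∈ I then u ⟨s, h⟩ else 0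
  have ext_mem : ∀ u (s : I), ext u s = u s := fun u s => by simp [ext]
  have ext_cont : ∀ u, ContinuousOn (ext u) I := fun u => by
    rw [continuousOn_iff_continuous_domRestrict]
    exact u.continuous.congr fun s => (ext_mem u s).symm
  have hint : ∀ u, ∀ b ∈ I, IntegrableOn (fun s => A s (w s • ext u s) + g s) (Icc a b) :=
    fun u b hb => ((hA b hb).clm_apply_continuousOn
      ((hwc.smul (ext_cont u)).mono (hI b hb).2)).add (hg b hb)
  let F₀ : (BoundedContinuousFunction I E) → ℝ → E := fun u t =>
    (w t)⁻¹ • (x + ∫ s in a..t, (A s (w s • ext u s) + g s))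
  have hF₀c : ∀ u, ContinuousOn (F₀ u) I := fun u =>
    (hwc.inv₀ fun t _ => (hw0 t).ne').smul
      (continuousOn_const.add (continuousOn_primitive_of_forall_Icc hI (hint u)))
  have hF₀b : ∀ u, ∀ t : I, ‖F₀ u t‖ ≤ ‖x‖ + (‖u‖ + 1) / 2 := by
    rintro u ⟨t, ht⟩
    have h1 : ‖∫ s in a..t, (A s (w s • ext u s) + g s)‖ ≤ ∫ s in a..t, k s * w s * (‖u‖ + 1) := by
      refine intervalIntegral.norm_integral_le_of_norm_le (hI t ht).1 ?_ ((hwki t ht).mul_const _)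
      refine Eventually.of_forall fun s hs => ?_
      have hsI : s ∈ I := (hI t ht).2 ⟨hs.1.le, hs.2⟩
      have e1 : ‖ext u s‖ ≤ ‖u‖ := by
        have := u.norm_coe_le_norm ⟨s, hsI⟩
        rwa [← ext_mem u ⟨s, hsI⟩] at this
      have e2 : ‖A s (w s • ext u s)‖ ≤ ‖A s‖ * (w s * ‖u‖) := by
        refine (ContinuousLinearMap.le_opNorm _ _).trans ?_
        rw [norm_smul, Real.norm_of_nonneg (hw0 s).le]
        gcongr
      calc ‖A s (w s • ext u s) + g s‖ ≤ ‖A s‖ * (w s * ‖u‖) + ‖g s‖ * 1 := by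
            rw [mul_one]; exact (norm_add_le _ _).trans (by gcongr)
        _ ≤ ‖A s‖ * (w s * (‖u‖ + 1)) + ‖g s‖ * (w s * (‖u‖ + 1)) := by
            have h1 := hw1 s hsI
            have h2 : 1 ≤ w s * (‖u‖ + 1) := by nlinarith [norm_nonneg u]
            gcongr
            linarith
        _ = k s * w s * (‖u‖ + 1) := by rw [hk]; ring
    rw [intervalIntegral.integral_mul_const] at h1
    have h2 : ‖x + ∫ s in a..t, (A s (w s • ext u s) + g s)‖
        ≤ w t * (‖x‖ + (‖u‖ + 1) / 2) := by
      refine (norm_add_le _ _).trans ?_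
      have h3 := mul_le_mul_of_nonneg_right (hwk t ht) (by positivity : 0 ≤ ‖u‖ + 1)
      have h4 : 1 * ‖x‖ ≤ w t * ‖x‖ := by gcongr; exact hw1 t ht
      nlinarith
    rw [show F₀ u (⟨t, ht⟩ : I) = (w t)⁻¹ • (x + ∫ s in a..t, (A s (w s • ext u s) + g s)) from rfl,
      norm_smul, norm_inv, Real.norm_of_nonneg (hw0 t).le, inv_mul_le_iff₀ (hw0 t)]
    exact h2
  let F : (BoundedContinuousFunction I E) → (BoundedContinuousFunction I E) := fun u =>
    BoundedContinuousFunction.ofNormedAddCommGroup (fun t : I => F₀ u t)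
      (continuousOn_iff_continuous_domRestrict.1 (hF₀c u)) _ (hF₀b u)
  have hF : ContractingWith (1 / 2) F := by
    refine ⟨by norm_num, LipschitzWith.of_dist_le_mul fun u v => ?_⟩
    refine (BoundedContinuousFunction.dist_le (by positivity)).2 ?_
    rintro ⟨t, ht⟩
    have h0 : F u ⟨t, ht⟩ - F v ⟨t, ht⟩
        = (w t)⁻¹ • ∫ s in a..t, A s (w s • (ext u s - ext v s)) := by
      change F₀ u t - F₀ v t = _
      simp only [F₀]
      rw [← smul_sub, add_sub_add_left_eq_sub, ← intervalIntegral.integral_sub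
        ((hint u t ht).intervalIntegrable_of_le (hI t ht).1)
        ((hint v t ht).intervalIntegrable_of_le (hI t ht).1)]
      congr 2
      funext s
      rw [add_sub_add_right_eq_sub, smul_sub, map_sub]
    have h1 : ‖∫ s in a..t, A s (w s • (ext u s - ext v s))‖
        ≤ ∫ s in a..t, k s * w s * dist u v := by
      refine intervalIntegral.norm_integral_le_of_norm_le (hI t ht).1 ?_ ((hwki t ht).mul_const _)
      refine Eventually.of_forall fun s hs => ?_
      have hsI : s ∈ I := (hI t ht).2 ⟨hs.1.le, hs.2⟩
      have e1 : ‖ext u s - ext v s‖ ≤ dist u v := by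
        have := BoundedContinuousFunction.dist_coe_le_dist (f := u) (g := v) ⟨s, hsI⟩
        rwa [dist_eq_norm, ← ext_mem u ⟨s, hsI⟩, ← ext_mem v ⟨s, hsI⟩] at this
      refine (ContinuousLinearMap.le_opNorm _ _).trans ?_
      rw [norm_smul, Real.norm_of_nonneg (hw0 s).le, mul_assoc]
      have := (hw0 s).le
      gcongr
      rw [hk]
      exact le_add_of_nonneg_right (norm_nonneg _)
    rw [intervalIntegral.integral_mul_const] at h1
    rw [dist_eq_norm, h0, norm_smul, norm_inv, Real.norm_of_nonneg (hw0 t).le,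
      inv_mul_le_iff₀ (hw0 t)]
    have h3 := mul_le_mul_of_nonneg_right (hwk t ht) (dist_nonneg (x := u) (y := v))
    simp only [NNReal.coe_div, NNReal.coe_one, NNReal.coe_ofNat]
    linarith
  have hfix := hF.fixedPoint_isFixedPt
  set u := hF.fixedPoint with hu
  refine ⟨fun t => w t • ext u t, hwc.smul (ext_cont u), fun t ht => ?_⟩
  have h1 : ext u t = F₀ u t := by
    rw [ext_mem u ⟨t, ht⟩]
    exact (congrArg (fun v : BoundedContinuousFunction I E => v ⟨t, ht⟩) hfix).symm
  simp only
  rw [h1, smul_inv_smul₀ (hw0 t).ne']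

end LinearODE

/-! ### The interval and the solutions of a symmetric system -/

/-- The Cauchy–Schwarz inequality for the form of a positive operator. -/
theorem ContinuousLinearMap.norm_apply_sq_le_of_isPositive {E : Type*} [NormedAddCommGroup E]
    [InnerProductSpace ℂ E] {T : E →L[ℂ] E} (hT : (T : E →ₗ[ℂ] E).IsPositive) (x : E) :
    ‖T x‖ ^ 2 ≤ ‖T‖ * (inner ℂ x (T x)).re := by
  rcases eq_or_ne T 0 with rfl | h0
  · simp
  have hT0 : 0 < ‖T‖ := norm_pos_iff.2 h0
  have hq := hT.re_inner_nonneg_right (x - ((‖T‖⁻¹ : ℝ) : ℂ) • T x)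
  have hs : ∀ u v : E, inner ℂ (T u) v = inner ℂ u (T v) := fun u v => hT.isSymmetric u v
  simp only [ContinuousLinearMap.coe_coe, map_sub, map_smul, inner_sub_left, inner_sub_right,
    inner_smul_left, inner_smul_right, Complex.conj_ofReal, RCLike.re_eq_complex_re,
    Complex.sub_re, Complex.re_ofReal_mul] at hq
  rw [← hs x (T x), inner_self_eq_norm_sq_to_K] at hq
  have h1 : (inner ℂ (T x) (T (T x))).re ≤ ‖T‖ * ‖T x‖ ^ 2 := by
    refine (Complex.re_le_norm _).trans ((norm_inner_le_norm _ _).trans ?_)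
    have := T.le_opNorm (T x)
    nlinarith [norm_nonneg (T x)]
  have h2 : ((‖T x‖ : ℂ) ^ 2).re = ‖T x‖ ^ 2 := by
    rw [← Complex.ofReal_pow, Complex.ofReal_re]
  simp only [RCLike.ofReal_eq_complex_ofReal] at hq
  rw [h2] at hq
  have h3 : ‖T‖⁻¹ * (‖T‖⁻¹ * (inner ℂ (T x) (T (T x))).re) ≤ ‖T‖⁻¹ * ‖T x‖ ^ 2 := by
    calc _ ≤ ‖T‖⁻¹ * (‖T‖⁻¹ * (‖T‖ * ‖T x‖ ^ 2)) := by gcongr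
      _ = _ := by field_simp
  have h4 : ‖T‖⁻¹ * ‖T x‖ ^ 2 ≤ (inner ℂ x (T x)).re := by linarith
  rwa [inv_mul_le_iff₀ hT0] at h4

namespace SymmetricSystem

variable {E : Type*} [NormedAddCommGroup E] [InnerProductSpace ℂ E] (S : SymmetricSystem E)

section Interval

open Set

theorem a_mem_I : S.a ∈ S.I := by
  rcases S.I_eq with h | h <;> rw [h]
  · exact ⟨le_rfl, S.a_lt_b⟩
  · exact ⟨le_rfl, S.a_lt_b.le⟩

theorem coe_le_b {t : ℝ} (ht : t ∈ S.I) : (t : EReal) ≤ S.b := by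
  rcases S.I_eq with h | h <;> rw [h] at ht
  exacts [ht.2.le, ht.2]

theorem mem_I_of_lt {t : ℝ} (h1 : S.a ≤ t) (h2 : (t : EReal) < S.b) : t ∈ S.I := by
  rcases S.I_eq with h | h <;> rw [h]
  exacts [⟨h1, h2⟩, ⟨h1, h2.le⟩]

theorem segment {β : ℝ} (hβ : β ∈ S.I) : S.a ≤ β ∧ Icc S.a β ⊆ S.I := by
  rcases S.I_eq with h | h <;> rw [h] at hβ ⊢
  · exact ⟨hβ.1, fun t ht => ⟨ht.1, (EReal.coe_le_coe_iff.2 ht.2).trans_lt hβ.2⟩⟩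
  · exact ⟨hβ.1, fun t ht => ⟨ht.1, (EReal.coe_le_coe_iff.2 ht.2).trans hβ.2⟩⟩

/-- The interval `I` is exhausted by countably many segments `[a, β]`. -/
theorem exists_seq_segment : ∃ β : ℕ → ℝ, (∀ n, β n ∈ S.I) ∧ S.I = ⋃ n, Icc S.a (β n) := by
  by_cases hm : ∃ m ∈ S.I, ∀ t ∈ S.I, t ≤ m
  · obtain ⟨m, hm, hmax⟩ := hm
    refine ⟨fun _ => m, fun _ => hm, ?_⟩
    rw [iUnion_const]
    exact Subset.antisymm (fun t ht => ⟨(S.segment ht).1, hmax t ht⟩) (S.segment hm).2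
  · push Not at hm
    obtain ⟨u, -, hu, hlim⟩ := exists_seq_strictMono_tendsto' S.a_lt_b
    have hcoe : ∀ n, ((u n).toReal : EReal) = u n := fun n =>
      EReal.coe_toReal ((hu n).2.trans_le le_top).ne ((bot_le.trans_lt (hu n).1).ne')
    have hmem : ∀ n, (u n).toReal ∈ S.I := fun n => by
      refine S.mem_I_of_lt ?_ (by rw [hcoe]; exact (hu n).2)
      rw [← EReal.coe_le_coe_iff, hcoe]
      exact (hu n).1.le
    refine ⟨fun n => (u n).toReal, hmem, Subset.antisymm (fun t ht => ?_)
      (iUnion_subset fun n => (S.segment (hmem n)).2)⟩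
    obtain ⟨s, hs, hts⟩ := hm t ht
    have htb : (t : EReal) < S.b := (EReal.coe_lt_coe_iff.2 hts).trans_le (S.coe_le_b hs)
    obtain ⟨n, hn⟩ := (hlim.eventually (lt_mem_nhds htb)).exists
    refine mem_iUnion.2 ⟨n, (S.segment ht).1, ?_⟩
    rw [← EReal.coe_le_coe_iff, hcoe]
    exact hn.le

theorem ae_restrict_I_iff {p : ℝ → Prop} :
    (∀ᵐ t ∂(volume.restrict S.I), p t) ↔
      ∀ β ∈ S.I, ∀ᵐ t ∂(volume.restrict (Icc S.a β)), p t := by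
  refine ⟨fun h β hβ => ae_restrict_of_ae_restrict_of_subset (S.segment hβ).2 h, fun h => ?_⟩
  obtain ⟨β, hβ, hI⟩ := S.exists_seq_segment
  rw [hI, ae_restrict_iUnion_iff]
  exact fun n => h _ (hβ n)

theorem ae_lt_b : ∀ᵐ t ∂(volume.restrict S.I), S.a < t ∧ (t : EReal) < S.b := by
  rw [ae_restrict_iff' S.measurableSet_I]
  have h1 : ∀ᵐ t : ℝ, t ≠ S.a := by simp [ae_iff, measure_singleton]
  have h2 : ∀ᵐ t : ℝ, t ≠ S.b.toReal := by simp [ae_iff, measure_singleton]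
  filter_upwards [h1, h2] with t ht1 ht2 ht
  refine ⟨lt_of_le_of_ne (S.segment ht).1 (Ne.symm ht1), lt_of_le_of_ne (S.coe_le_b ht) fun h => ?_⟩
  rw [← h, EReal.toReal_coe] at ht2
  exact ht2 rfl

theorem ae_mem_nhds_I : ∀ᵐ t ∂(volume.restrict S.I), S.I ∈ 𝓝 t := by
  filter_upwards [S.ae_lt_b] with t ht
  have h2 : {s : ℝ | (s : EReal) < S.b} ∈ 𝓝 t :=
    (isOpen_Iio.preimage continuous_coe_real_ereal).mem_nhds ht.2
  filter_upwards [Ioi_mem_nhds ht.1, h2] with s hs1 hs2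
  exact S.mem_I_of_lt (le_of_lt hs1) hs2

theorem B_integrableOn {β : ℝ} (hβ : β ∈ S.I) : IntegrableOn S.B (Icc S.a β) :=
  S.B_locInt.integrableOn_compact_subset (S.segment hβ).2 isCompact_Icc

theorem Δ_integrableOn {β : ℝ} (hβ : β ∈ S.I) : IntegrableOn S.Δ (Icc S.a β) :=
  S.Δ_locInt.integrableOn_compact_subset (S.segment hβ).2 isCompact_Icc

theorem aestronglyMeasurable_Δ_apply {f : ℝ → E} (hf : StronglyMeasurable f) :
    AEStronglyMeasurable (fun t => S.Δ t (f t)) (volume.restrict S.I) :=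
  (isBoundedBilinearMap_apply (𝕜 := ℂ) (E := E) (F := E)).continuous.comp_aestronglyMeasurable
    (S.Δ_locInt.aestronglyMeasurable.prodMk hf.aestronglyMeasurable)

/-- For `f ∈ 𝓛²_Δ(I)` the function `Δ f` is locally integrable, since `2 ‖Δ f‖ ≤ ‖Δ‖ + (Δ f, f)`. -/
theorem PreL2.integrableOn_Δ {S : SymmetricSystem E} (f : S.PreL2) {β : ℝ} (hβ : β ∈ S.I) :
    IntegrableOn (fun t => S.Δ t (f.toFun t)) (Icc S.a β) := by
  have hsub := (S.segment hβ).2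
  refine Integrable.mono'
    ((S.Δ_integrableOn hβ).norm.add ((PreL2.integrable f f).mono_set hsub).norm)
    ((S.aestronglyMeasurable_Δ_apply f.2.1).mono_measure (Measure.restrict_mono hsub le_rfl)) ?_
  filter_upwards [ae_restrict_of_ae_restrict_of_subset hsub S.Δ_pos] with t ht
  have h1 := (S.Δ t).norm_apply_sq_le_of_isPositive ht (f.toFun t)
  have h2 := Complex.re_le_norm (inner ℂ (f.toFun t) (S.Δ t (f.toFun t)))
  simp only [Pi.add_apply]
  have h3 := mul_le_mul_of_nonneg_left h2 (norm_nonneg (S.Δ t))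
  nlinarith [norm_nonneg (S.Δ t), norm_nonneg (inner ℂ (f.toFun t) (S.Δ t (f.toFun t))),
    norm_nonneg (S.Δ t (f.toFun t)),
    sq_nonneg (‖S.Δ t‖ - ‖inner ℂ (f.toFun t) (S.Δ t (f.toFun t))‖)]

end Interval

section Solutions

open Set

variable {S}

theorem Solves.add {y z f g : ℝ → E} (hy : S.Solves y f) (hz : S.Solves z g) :
    S.Solves (y + z) (f + g) := by
  refine ⟨fun β hβ => (hy.1 β hβ).add (hz.1 β hβ), ?_⟩
  filter_upwards [hy.2, hz.2] with t h1 h2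
  refine ⟨h1.1.add h2.1, ?_⟩
  rw [deriv_add h1.1 h2.1]
  simp only [Pi.add_apply, map_add, ← h1.2, ← h2.2]
  abel

theorem Solves.smul {y f : ℝ → E} (c : ℂ) (hy : S.Solves y f) : S.Solves (c • y) (c • f) := by
  refine ⟨fun β hβ => (hy.1 β hβ).const_smul c, ?_⟩
  filter_upwards [hy.2] with t h1
  refine ⟨h1.1.const_smul c, ?_⟩
  rw [deriv_const_smul c h1.1]
  simp only [Pi.smul_apply, map_smul, ← h1.2, smul_sub]

theorem Solves.zero : S.Solves (0 : ℝ → E) 0 := by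
  refine ⟨fun β _ => ?_, ?_⟩
  · simpa [AbsolutelyContinuousOnInterval] using tendsto_const_nhds
  · refine Eventually.of_forall fun t => ⟨differentiableAt_const 0, ?_⟩
    have : deriv (0 : ℝ → E) t = 0 := deriv_const t 0
    simp [this]

theorem Solves.continuousOn {y f : ℝ → E} (hy : S.Solves y f) : ContinuousOn y S.I :=
  continuousOn_of_forall_Icc (fun _ => S.segment) fun β hβ => by
    have := (hy.1 β hβ).continuousOn
    rwa [uIcc_of_le (S.segment hβ).1] at this

theorem Solves.congr {y z f g : ℝ → E} (hy : S.Solves y f) (h : ∀ t ∈ S.I, z t = y t)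
    (hfg : ∀ᵐ t ∂(volume.restrict S.I), S.Δ t (f t) = S.Δ t (g t)) : S.Solves z g := by
  refine ⟨fun β hβ => (hy.1 β hβ).congr fun t ht => h t ?_, ?_⟩
  · rw [uIcc_of_le (S.segment hβ).1] at ht
    exact (S.segment hβ).2 ht
  · filter_upwards [hy.2, S.ae_mem_nhds_I, hfg] with t h1 h2 h3
    have he : z =ᶠ[𝓝 t] y := by filter_upwards [h2] with s hs using h s hs
    exact ⟨h1.1.congr_of_eventuallyEq he, by rw [he.deriv_eq, he.eq_of_nhds, h1.2, h3]⟩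

/-- The initial value problem at `a` is solvable; it is the integral equation
`y = x - ∫ J (B y + Δ f)`, since `J⁻¹ = -J`. -/
theorem exists_solves [CompleteSpace E] {f : ℝ → E}
    (hf : ∀ β ∈ S.I, IntegrableOn (fun t => S.Δ t (f t)) (Icc S.a β)) (x : E) :
    ∃ y, S.Solves y f ∧ y S.a = x := by
  have hA : ∀ β ∈ S.I, IntegrableOn (fun t => -(S.J ∘L S.B t)) (Icc S.a β) := fun β hβ =>
    (((ContinuousLinearMap.compL ℂ E E E) S.J).integrable_comp (S.B_integrableOn hβ)).neg
  have hg : ∀ β ∈ S.I, IntegrableOn (fun t => -(S.J (S.Δ t (f t)))) (Icc S.a β) := fun β hβ =>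
    (S.J.integrable_comp (hf β hβ)).neg
  obtain ⟨y, hyc, hy⟩ := exists_eq_add_integral (fun _ => S.segment) hA hg x
  set h : ℝ → E := fun s => (-(S.J ∘L S.B s)) (y s) + -(S.J (S.Δ s (f s))) with hh
  have hi : ∀ β ∈ S.I, IntervalIntegrable h volume S.a β := fun β hβ =>
    (((hA β hβ).clm_apply_continuousOn (hyc.mono (S.segment hβ).2)).add
      (hg β hβ)).intervalIntegrable_of_le (S.segment hβ).1
  refine ⟨y, ⟨fun β hβ => ?_, ?_⟩, by simpa using hy S.a S.a_mem_I⟩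
  · have hF := AbsolutelyContinuousOnInterval.intervalIntegral (hi β hβ)
    refine hF.of_dist_le (C := 1) (D := 0) hF fun s hs t ht => ?_
    rw [uIcc_of_le (S.segment hβ).1] at hs ht
    rw [hy s ((S.segment hβ).2 hs), hy t ((S.segment hβ).2 ht), dist_add_left]
    simp
  · have hd : ∀ᵐ t ∂(volume.restrict S.I),
        HasDerivAt (fun t => ∫ s in S.a..t, h s) (h t) t := by
      rw [ae_restrict_I_iff]
      intro β hβ
      rw [ae_restrict_iff' measurableSet_Icc]
      filter_upwards [(hi β hβ).ae_hasDerivAt_integral] with t ht hts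
      rw [uIcc_of_le (S.segment hβ).1] at ht
      exact ht hts S.a (left_mem_Icc.2 (S.segment hβ).1)
    filter_upwards [hd, S.ae_mem_nhds_I] with t ht hn
    have he : y =ᶠ[𝓝 t] fun t => x + ∫ s in S.a..t, h s := by
      filter_upwards [hn] with s hs using hy s hs
    have hyd := (ht.const_add x).congr_of_eventuallyEq he
    refine ⟨hyd.differentiableAt, ?_⟩
    rw [hyd.deriv, hh]
    simp [S.J_sq]

/-- The Lagrange identity on a segment. -/
theorem Solves.lagrange [CompleteSpace E] {y z f g : ℝ → E} (hy : S.Solves y f)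
    (hz : S.Solves z g)
    (hf : ∀ β ∈ S.I, IntegrableOn (fun t => S.Δ t (f t)) (Icc S.a β))
    (hg : ∀ β ∈ S.I, IntegrableOn (fun t => S.Δ t (g t)) (Icc S.a β))
    {t : ℝ} (ht : t ∈ S.I) :
    ∫ r in S.a..t, (inner ℂ (z r) (S.Δ r (f r)) - inner ℂ (S.Δ r (g r)) (y r))
      = inner ℂ (z t) (S.J (y t)) - inner ℂ (z S.a) (S.J (y S.a)) := by
  have hat := (S.segment ht).1
  have hu : uIcc S.a t = Icc S.a t := uIcc_of_le hat
  obtain ⟨C, hC⟩ := (hy.1 t ht).exists_bound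
  obtain ⟨D, hD⟩ := (hz.1 t ht).exists_bound
  have hAC : AbsolutelyContinuousOnInterval (fun t => inner ℂ (z t) (S.J (y t))) S.a t := by
    refine (hz.1 t ht).of_dist_le (C := ‖S.J‖ * C) (D := D * ‖S.J‖) (hy.1 t ht) fun r hr s hs => ?_
    have e : inner ℂ (z r) (S.J (y r)) - inner ℂ (z s) (S.J (y s))
        = inner ℂ (z r - z s) (S.J (y r)) + inner ℂ (z s) (S.J (y r - y s)) := by
      rw [map_sub, inner_sub_left, inner_sub_right]; ring
    have h1 : ‖S.J (y r)‖ ≤ ‖S.J‖ * C := (S.J.le_opNorm _).trans (by gcongr; exact hC r hr)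
    have h2 : ‖S.J (y r - y s)‖ ≤ ‖S.J‖ * ‖y r - y s‖ := S.J.le_opNorm _
    rw [dist_eq_norm, dist_eq_norm, dist_eq_norm, e]
    refine (norm_add_le _ _).trans (add_le_add ?_ ?_)
    · refine (norm_inner_le_norm _ _).trans ?_
      rw [mul_comm]
      gcongr
    · refine (norm_inner_le_norm _ _).trans ?_
      rw [mul_assoc]
      exact mul_le_mul (hD s hs) h2 (norm_nonneg _) ((norm_nonneg _).trans (hD s hs))
  refine hAC.integral_eq_sub ?_ ?_
  · have h1 := (ae_restrict_iff' S.measurableSet_I).1 hy.2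
    have h2 := (ae_restrict_iff' S.measurableSet_I).1 hz.2
    have h3 := (ae_restrict_iff' S.measurableSet_I).1 S.B_symm
    filter_upwards [h1, h2, h3] with r h1 h2 h3 hr
    have hrI : r ∈ S.I := (S.segment ht).2 (hu ▸ hr)
    obtain ⟨hyd, hye⟩ := h1 hrI
    obtain ⟨hzd, hze⟩ := h2 hrI
    have hB : inner ℂ (S.B r (z r)) (y r) = inner ℂ (z r) (S.B r (y r)) := h3 hrI (z r) (y r)
    have hJd : HasDerivAt (fun t => S.J (y t)) (S.J (deriv y r)) r :=
      (S.J.restrictScalars ℝ).hasFDerivAt.comp_hasDerivAt r hyd.hasDerivAt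
    refine (hzd.hasDerivAt.inner ℂ hJd).congr_deriv ?_
    have e1 : inner ℂ (deriv z r) (S.J (y r)) = -inner ℂ (S.J (deriv z r)) (y r) := by
      rw [S.J_skew, neg_neg]
    rw [e1, sub_eq_iff_eq_add.1 hye, sub_eq_iff_eq_add.1 hze, inner_add_left, inner_add_right, hB]
    ring
  · have hyc : ContinuousOn y (Icc S.a t) := hy.continuousOn.mono (S.segment ht).2
    have hzc : ContinuousOn z (Icc S.a t) := hz.continuousOn.mono (S.segment ht).2
    refine IntegrableOn.intervalIntegrable_of_le (Integrable.sub ?_ ?_) hat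
    · refine Integrable.mono' ((hf t ht).norm.const_mul D)
        ((hzc.aestronglyMeasurable_of_isCompact isCompact_Icc measurableSet_Icc).inner
          (hf t ht).aestronglyMeasurable) ?_
      filter_upwards [ae_restrict_mem measurableSet_Icc] with r hr
      exact (norm_inner_le_norm _ _).trans (by gcongr; exact hD r (hu ▸ hr))
    · refine Integrable.mono' ((hg t ht).norm.mul_const C)
        ((hg t ht).aestronglyMeasurable.inner
          (hyc.aestronglyMeasurable_of_isCompact isCompact_Icc measurableSet_Icc)) ?_
      filter_upwards [ae_restrict_mem measurableSet_Icc] with r hr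
      exact (norm_inner_le_norm _ _).trans (by gcongr; exact hC r (hu ▸ hr))

variable (S)

theorem integrableOn_Δ_zero (β : ℝ) (_ : β ∈ S.I) :
    IntegrableOn (fun t => S.Δ t ((0 : ℝ → E) t)) (Icc S.a β) := by
  simp

theorem exists_fundamentalSolution [CompleteSpace E] :
    ∃ Y : E →ₗ[ℂ] (ℝ → E), ∀ x, S.Solves (Y x) 0 ∧ Y x S.a = x := by
  let N : Submodule ℂ (ℝ → E) :=
    { carrier := {y | S.Solves y 0}
      zero_mem' := Solves.zero
      add_mem' := fun hy hz => by simpa using Solves.add hy hz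
      smul_mem' := fun c y hy => by simpa using Solves.smul c hy }
  let ev : N →ₗ[ℂ] E := LinearMap.proj S.a ∘ₗ N.subtype
  obtain ⟨s, hs⟩ := ev.exists_rightInverse_of_surjective (LinearMap.range_eq_top.2 fun x => by
    obtain ⟨y, hy, hyx⟩ := exists_solves (S := S) S.integrableOn_Δ_zero x
    exact ⟨⟨y, hy⟩, hyx⟩)
  exact ⟨N.subtype ∘ₗ s, fun x => ⟨(s x).2, LinearMap.congr_fun hs x⟩⟩

/-- The solutions of the homogeneous equation `J y' - B y = 0`, parametrized by `y(a)`. -/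
noncomputable def fund [CompleteSpace E] : E →ₗ[ℂ] (ℝ → E) :=
  S.exists_fundamentalSolution.choose

theorem fund_solves [CompleteSpace E] (x : E) : S.Solves (S.fund x) 0 :=
  (S.exists_fundamentalSolution.choose_spec x).1

theorem fund_apply_a [CompleteSpace E] (x : E) : S.fund x S.a = x :=
  (S.exists_fundamentalSolution.choose_spec x).2

theorem inner_fund_J_fund [CompleteSpace E] (x x' : E) {t : ℝ} (ht : t ∈ S.I) :
    inner ℂ (S.fund x' t) (S.J (S.fund x t)) = inner ℂ x' (S.J x) := by
  have h := (S.fund_solves x).lagrange (S.fund_solves x') S.integrableOn_Δ_zero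
    S.integrableOn_Δ_zero ht
  simp only [Pi.zero_apply, map_zero, inner_zero_left, inner_zero_right, sub_zero,
    intervalIntegral.integral_zero, S.fund_apply_a] at h
  exact sub_eq_zero.1 h.symm

theorem J_injective : Function.Injective S.J := fun x y h => by
  have := congrArg S.J h
  rwa [S.J_sq, S.J_sq, neg_inj] at this

theorem fund_surjective [FiniteDimensional ℂ E] [CompleteSpace E] {t : ℝ} (ht : t ∈ S.I) (x : E) :
    ∃ x₀, S.fund x₀ t = x := by
  have hinj : Function.Injective (LinearMap.proj t ∘ₗ S.fund : E →ₗ[ℂ] E) := by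
    rw [← LinearMap.ker_eq_bot, LinearMap.ker_eq_bot']
    intro z hz
    have hz' : S.fund z t = 0 := hz
    have h := S.inner_fund_J_fund z (S.J z) ht
    rw [hz', map_zero, inner_zero_right] at h
    exact S.J_injective (by rw [map_zero]; exact inner_self_eq_zero.1 h.symm)
  exact LinearMap.injective_iff_surjective.1 hinj x

/-- A vector `v` vanishes if `J v` is orthogonal to the values at some `t` of all solutions of the
homogeneous equation. -/
theorem eq_zero_of_inner_fund [FiniteDimensional ℂ E] [CompleteSpace E] {t : ℝ} (ht : t ∈ S.I)
    {v : E} (h : ∀ x, inner ℂ (S.fund x t) (S.J v) = 0) : v = 0 := by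
  obtain ⟨x, hx⟩ := S.fund_surjective ht (S.J v)
  have := h x
  rw [hx, inner_self_eq_zero] at this
  exact S.J_injective (by rw [this, map_zero])

/-- Variation of constants in weak form: the pairing of a solution with the solutions of the
homogeneous equation. -/
theorem Solves.inner_fund [CompleteSpace E] {S : SymmetricSystem E} {y f : ℝ → E}
    (hy : S.Solves y f)
    (hf : ∀ β ∈ S.I, IntegrableOn (fun t => S.Δ t (f t)) (Icc S.a β))
    {t : ℝ} (ht : t ∈ S.I) (x : E) :
    inner ℂ (S.fund x t) (S.J (y t)) = inner ℂ x (S.J (y S.a))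
      + ∫ r in S.a..t, inner ℂ (S.fund x r) (S.Δ r (f r)) := by
  have h := hy.lagrange (S.fund_solves x) hf S.integrableOn_Δ_zero ht
  simp only [Pi.zero_apply, map_zero, inner_zero_left, sub_zero, S.fund_apply_a] at h
  rw [h]
  ring

end Solutions

end SymmetricSystem

/-! ### The semi-Hilbert space of a symmetric system -/

theorem ContinuousOn.stronglyMeasurable_indicator {E : Type*} [NormedAddCommGroup E]
    [NormedSpace ℂ E] [FiniteDimensional ℂ E] {X : Type*} [TopologicalSpace X] [MeasurableSpace X]
    [OpensMeasurableSpace X] {y : X → E} {s : Set X} (hy : ContinuousOn y s)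
    (hs : MeasurableSet s) : StronglyMeasurable (s.indicator y) := by
  classical
  have := FiniteDimensional.proper ℂ E
  borelize E
  have h := hy.measurable_piecewise (g := fun _ => (0 : E)) continuousOn_const hs
  exact (Set.piecewise_eq_indicator (s := s) (f := y) ▸ h).stronglyMeasurable

namespace SymmetricSystem

variable {E : Type*} [NormedAddCommGroup E] [InnerProductSpace ℂ E] {S : SymmetricSystem E}

section Space

open Set

theorem PreL2.inner_def (f g : S.PreL2) :
    inner ℂ f g = ∫ t in S.I, inner ℂ (f.toFun t) (S.Δ t (g.toFun t)) := rfl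

theorem PreL2.toFun_injective : Function.Injective (PreL2.toFun : S.PreL2 →ₗ[ℂ] (ℝ → E)) :=
  Subtype.val_injective

theorem PreL2.apply_of_notMem (f : S.PreL2) {t : ℝ} (ht : t ∉ S.I) : f.toFun t = 0 := f.2.2.1 t ht

theorem PreL2.stronglyMeasurable (f : S.PreL2) : StronglyMeasurable f.toFun := f.2.1

theorem PreL2.norm_eq_zero_iff (f : S.PreL2) :
    ‖f‖ = 0 ↔ ∀ᵐ t ∂(volume.restrict S.I), S.Δ t (f.toFun t) = 0 := by
  have hn : ‖f‖ ^ 2 = ∫ t in S.I, (inner ℂ (f.toFun t) (S.Δ t (f.toFun t))).re := by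
    rw [← inner_self_eq_norm_sq (𝕜 := ℂ), PreL2.inner_def]
    exact (integral_re (PreL2.integrable f f)).symm
  have hpos : ∀ᵐ t ∂(volume.restrict S.I),
      0 ≤ (inner ℂ (f.toFun t) (S.Δ t (f.toFun t))).re := by
    filter_upwards [S.Δ_pos] with t ht using ht.re_inner_nonneg_right _
  rw [← sq_eq_zero_iff, hn, integral_eq_zero_iff_of_nonneg_ae hpos (PreL2.integrable f f).re]
  refine ⟨fun h => ?_, fun h => ?_⟩
  · filter_upwards [S.Δ_pos, h] with t ht h0
    have h1 := (S.Δ t).norm_apply_sq_le_of_isPositive ht (f.toFun t)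
    rw [Pi.zero_apply] at h0
    rw [h0, mul_zero] at h1
    exact norm_eq_zero.1 (by nlinarith [norm_nonneg (S.Δ t (f.toFun t))])
  · filter_upwards [h] with t h0
    simp [h0]

theorem mk_eq_mk_iff {f g : S.PreL2} :
    SeparationQuotient.mk f = SeparationQuotient.mk g ↔
      ∀ᵐ t ∂(volume.restrict S.I), S.Δ t (f.toFun t) = S.Δ t (g.toFun t) := by
  rw [SeparationQuotient.mk_eq_mk, Metric.inseparable_iff, dist_eq_norm, PreL2.norm_eq_zero_iff]
  simp only [map_sub, Pi.sub_apply, sub_eq_zero]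

theorem PreL2.inner_eq_setIntegral {f g : S.PreL2} {β : ℝ} (hβ : β ∈ S.I)
    (h : ∀ t ∉ Icc S.a β, f.toFun t = 0 ∨ g.toFun t = 0) :
    inner ℂ f g = ∫ t in S.a..β, inner ℂ (f.toFun t) (S.Δ t (g.toFun t)) := by
  rw [intervalIntegral.integral_of_le (S.segment hβ).1, ← integral_Icc_eq_integral_Ioc,
    PreL2.inner_def]
  refine setIntegral_eq_of_subset_of_forall_sdiff_eq_zero S.measurableSet_I (S.segment hβ).2 ?_
  rintro t ⟨-, ht⟩
  rcases h t ht with h0 | h0 <;> simp [h0]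

theorem exists_preL2_of_continuousOn [FiniteDimensional ℂ E] {y : ℝ → E} {β : ℝ} (hβ : β ∈ S.I)
    (hy : ContinuousOn y (Icc S.a β)) : ∃ u : S.PreL2, u.toFun = (Icc S.a β).indicator y := by
  have hm := hy.stronglyMeasurable_indicator measurableSet_Icc
  obtain ⟨C, hC⟩ := isCompact_Icc.exists_bound_of_continuousOn hy
  have hi : IntegrableOn (fun t => inner ℂ ((Icc S.a β).indicator y t)
      (S.Δ t ((Icc S.a β).indicator y t))) (Icc S.a β) := by
    refine Integrable.mono' (((S.Δ_integrableOn hβ).norm.mul_const (C * C)))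
      ((S.aestronglyMeasurable_form hm hm).mono_measure
        (Measure.restrict_mono (S.segment hβ).2 le_rfl)) ?_
    filter_upwards [ae_restrict_mem measurableSet_Icc] with t ht
    rw [indicator_of_mem ht]
    have h0 := hC t ht
    calc _ ≤ ‖y t‖ * (‖S.Δ t‖ * ‖y t‖) := (norm_inner_le_norm _ _).trans
          (by gcongr; exact (S.Δ t).le_opNorm _)
      _ ≤ C * (‖S.Δ t‖ * C) := by
          have := norm_nonneg (y t)
          gcongr
          linarith
      _ = _ := by ring
  refine ⟨⟨(Icc S.a β).indicator y, hm, fun t ht => indicator_of_notMem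
    (fun h => ht ((S.segment hβ).2 h)) _, ?_⟩, rfl⟩
  refine hi.of_forall_sdiff_eq_zero S.measurableSet_I ?_
  rintro t ⟨-, ht⟩
  simp [indicator_of_notMem ht]

theorem PreL2.exists_cut (f : S.PreL2) (β : ℝ) :
    ∃ u : S.PreL2, u.toFun = (Icc S.a β).indicator f.toFun := by
  have hm := f.stronglyMeasurable.indicator (measurableSet_Icc (a := S.a) (b := β))
  refine ⟨⟨(Icc S.a β).indicator f.toFun, hm, fun t ht => ?_, ?_⟩, rfl⟩
  · by_cases h : t ∈ Icc S.a β
    · rw [indicator_of_mem h, f.apply_of_notMem ht]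
    · rw [indicator_of_notMem h]
  · refine (IntegrableOn.indicator (PreL2.integrable f f)
      (measurableSet_Icc (a := S.a) (b := β))).congr (Eventually.of_forall fun t => ?_)
    by_cases h : t ∈ Icc S.a β <;> simp [h]

variable (S)

theorem exists_fundCut [FiniteDimensional ℂ E] [CompleteSpace E] {β : ℝ} (hβ : β ∈ S.I) :
    ∃ L : E →ₗ[ℂ] S.PreL2, ∀ x, (L x).toFun = (Icc S.a β).indicator (S.fund x) := by
  choose u hu using fun x => exists_preL2_of_continuousOn hβ
    ((S.fund_solves x).continuousOn.mono (S.segment hβ).2)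
  refine ⟨⟨⟨u, fun x x' => PreL2.toFun_injective ?_⟩, fun c x => PreL2.toFun_injective ?_⟩, hu⟩
  · rw [map_add, hu, hu, hu, map_add, indicator_add']
  · rw [map_smul, hu, hu, map_smul]
    exact indicator_const_smul _ c _

/-- The solutions of the homogeneous equation, cut off to the segment `[a, β]`, as elements of
`𝓛²_Δ(I)`. -/
noncomputable def fundCut [FiniteDimensional ℂ E] [CompleteSpace E] {β : ℝ} (hβ : β ∈ S.I) :
    E →ₗ[ℂ] S.PreL2 :=
  (S.exists_fundCut hβ).choose

theorem fundCut_toFun [FiniteDimensional ℂ E] [CompleteSpace E] {β : ℝ} (hβ : β ∈ S.I) (x : E) :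
    (S.fundCut hβ x).toFun = (Icc S.a β).indicator (S.fund x) :=
  (S.exists_fundCut hβ).choose_spec x

end Space

/-! ### The boundary form at the end `b` -/

section BoundaryForm

open Set

variable (S)

/-- The filter of the limit `t ↑ b`. -/
noncomputable def atB : Filter ℝ := comap (fun t : ℝ => (t : EReal)) (𝓝[<] S.b)

theorem eventually_atB_of_lt {c : EReal} (hc : c < S.b) :
    ∀ᶠ t : ℝ in S.atB, c < t ∧ (t : EReal) < S.b :=
  Eventually.comap (p := fun e : EReal => c < e ∧ e < S.b) (Ioo_mem_nhdsLT hc) _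

theorem eventually_atB_mem : ∀ᶠ t in S.atB, t ∈ S.I := by
  filter_upwards [S.eventually_atB_of_lt S.a_lt_b] with t ht
  exact S.mem_I_of_lt (EReal.coe_lt_coe_iff.1 ht.1).le ht.2

instance atB_neBot : S.atB.NeBot := by
  refine comap_neBot fun s hs => ?_
  obtain ⟨c, hc, hcs⟩ := (mem_nhdsLT_iff_exists_Ioo_subset' S.a_lt_b).1 hs
  obtain ⟨r, hr1, hr2⟩ := EReal.lt_iff_exists_real_btwn.1 (show c < S.b from hc)
  exact ⟨r, hcs ⟨hr1, hr2⟩⟩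

instance atB_isCountablyGenerated : S.atB.IsCountablyGenerated := by
  unfold atB
  infer_instance

variable {S}

/-- The Lagrange identity on `I`; in particular the boundary form is a genuine limit. -/
theorem tendsto_inner_J [CompleteSpace E] {y f z g : S.PreL2} (hy : (y, f) ∈ S.tmax)
    (hz : (z, g) ∈ S.tmax) :
    Tendsto (fun t => inner ℂ (z.toFun t) (S.J (y.toFun t))) S.atB
      (𝓝 (inner ℂ z f - inner ℂ g y + inner ℂ (z.toFun S.a) (S.J (y.toFun S.a)))) := by
  have hy' : S.Solves y.toFun f.toFun := hy
  have hz' : S.Solves z.toFun g.toFun := hz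
  set F : ℝ → ℂ := fun r => inner ℂ (z.toFun r) (S.Δ r (f.toFun r))
    - inner ℂ (g.toFun r) (S.Δ r (y.toFun r)) with hF
  have hFi : IntegrableOn F S.I := (PreL2.integrable z f).sub (PreL2.integrable g y)
  have hcover : AECover (volume.restrict S.I) S.atB fun t => Icc S.a t := by
    refine ⟨?_, fun _ => measurableSet_Icc⟩
    filter_upwards [S.ae_lt_b] with r hr
    filter_upwards [S.eventually_atB_of_lt hr.2] with t ht
    exact ⟨hr.1.le, (EReal.coe_lt_coe_iff.1 ht.1).le⟩
  have hlim := hcover.integral_tendsto_of_countably_generated hFi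
  have hval : ∫ r in S.I, F r = inner ℂ z f - inner ℂ g y := by
    rw [PreL2.inner_def, PreL2.inner_def,
      ← integral_sub (PreL2.integrable z f) (PreL2.integrable g y)]
  rw [hval] at hlim
  refine (hlim.add_const (inner ℂ (z.toFun S.a) (S.J (y.toFun S.a)))).congr' ?_
  filter_upwards [S.eventually_atB_mem] with t ht
  have hl := hy'.lagrange hz' (fun β hβ => f.integrableOn_Δ hβ) (fun β hβ => g.integrableOn_Δ hβ) ht
  rw [eq_comm, ← sub_eq_iff_eq_add, ← hl, intervalIntegral.integral_of_le (S.segment ht).1,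
    ← integral_Icc_eq_integral_Ioc, Measure.restrict_restrict measurableSet_Icc,
    inter_eq_left.2 (S.segment ht).2]
  refine integral_congr_ae ?_
  filter_upwards [ae_restrict_of_ae_restrict_of_subset (S.segment ht).2 S.Δ_pos] with r hr
  have hs : inner ℂ (S.Δ r (g.toFun r)) (y.toFun r) = inner ℂ (g.toFun r) (S.Δ r (y.toFun r)) :=
    hr.isSymmetric _ _
  simp only [hF, hs]

theorem boundaryForm_eq [CompleteSpace E] {y f z g : S.PreL2} (hy : (y, f) ∈ S.tmax)
    (hz : (z, g) ∈ S.tmax) :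
    S.boundaryForm ⟨y, S.mem_domTmax hy⟩ ⟨z, S.mem_domTmax hz⟩
      = inner ℂ z f - inner ℂ g y + inner ℂ (z.toFun S.a) (S.J (y.toFun S.a)) :=
  (tendsto_inner_J hy hz).limUnder_eq

theorem tendsto_boundaryForm [CompleteSpace E] (y z : S.domTmax) :
    Tendsto (fun t => inner ℂ (z.1.toFun t) (S.J (y.1.toFun t))) S.atB
      (𝓝 (S.boundaryForm y z)) := by
  obtain ⟨y, ⟨⟨y', f⟩, hy, rfl⟩⟩ := y
  obtain ⟨z, ⟨⟨z', g⟩, hz, rfl⟩⟩ := z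
  have := tendsto_inner_J hy hz
  rwa [← boundaryForm_eq hy hz] at this

theorem mem_domTmin_iff [CompleteSpace E] {y : S.domTmax} :
    y ∈ S.domTmin ↔ y.1.toFun S.a = 0 ∧ ∀ z, S.boundaryForm y z = 0 := by
  refine and_congr_right fun _ => forall_congr' fun z => ⟨fun h => ?_, fun h => ?_⟩
  · exact tendsto_nhds_unique (tendsto_boundaryForm y z) h
  · have := tendsto_boundaryForm y z
    rwa [h] at this

/-- The boundary form vanishes on functions that vanish near `b`, and also on functions that vanish
at `b` in case that `b` belongs to `I`. -/
theorem boundaryForm_eq_zero [CompleteSpace E] {y : S.domTmax} {β : ℝ} (hβ : β ∈ S.I)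
    (h : ∀ t ∈ S.I, β ≤ t → y.1.toFun t = 0) (z : S.domTmax) : S.boundaryForm y z = 0 := by
  refine tendsto_nhds_unique (tendsto_boundaryForm y z) ?_
  rcases (S.coe_le_b hβ).lt_or_eq with hlt | heq
  · refine tendsto_const_nhds.congr' ?_
    filter_upwards [S.eventually_atB_mem, S.eventually_atB_of_lt hlt] with t h1 h2
    rw [h t h1 (EReal.coe_lt_coe_iff.1 h2.1).le, map_zero, inner_zero_right]
  · have hle : S.atB ≤ 𝓝[S.I] β := by
      refine le_inf ?_ (le_principal_iff.2 S.eventually_atB_mem)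
      rw [EReal.isEmbedding_coe.nhds_eq_comap, heq]
      exact comap_mono nhdsWithin_le_nhds
    obtain ⟨y, ⟨⟨y', f⟩, hy, rfl⟩⟩ := y
    obtain ⟨z, ⟨⟨z', g⟩, hz, rfl⟩⟩ := z
    have hyc := (Solves.continuousOn (show S.Solves y'.toFun f.toFun from hy)) β hβ
    have hzc := (Solves.continuousOn (show S.Solves z'.toFun g.toFun from hz)) β hβ
    have hlim := (hzc.inner (𝕜 := ℂ)
      (S.J.continuous.continuousAt.comp_continuousWithinAt hyc)).mono_left hle
    have h0 : y'.toFun β = 0 := h β hβ le_rfl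
    simp only [Function.comp_apply, h0, map_zero, inner_zero_right] at hlim
    exact hlim

end BoundaryForm

theorem mem_relationOf {D : Submodule ℂ S.domTmax} {p : S.L2 × S.L2} :
    p ∈ S.relationOf D ↔
      ∃ (y f : S.PreL2) (h : (y, f) ∈ S.tmax), ⟨y, S.mem_domTmax h⟩ ∈ D ∧ S.quot (y, f) = p := by
  constructor
  · rintro ⟨⟨y, f⟩, ⟨h, ⟨⟨y', hy'⟩, hyD, rfl⟩⟩, rfl⟩
    exact ⟨y', f, h, hyD, rfl⟩
  · rintro ⟨y, f, h, hD, rfl⟩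
    exact ⟨(y, f), ⟨h, ⟨_, hD, rfl⟩⟩, rfl⟩

end SymmetricSystem

/-! ### Gram operators -/

/-- The Riesz representation of the functionals `x ↦ (v, L x)` on a finite-dimensional space. -/
theorem LinearMap.exists_inner_eq_inner_apply {E F : Type*} [NormedAddCommGroup E]
    [InnerProductSpace ℂ E] [FiniteDimensional ℂ E] [CompleteSpace E]
    [SeminormedAddCommGroup F] [InnerProductSpace ℂ F]
    (L : E →ₗ[ℂ] F) (v : F) : ∃ e, ∀ x, inner ℂ (L x) v = inner ℂ x e := by
  let φ : E →L[ℂ] ℂ := LinearMap.toContinuousLinearMap (innerₛₗ ℂ v ∘ₗ L)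
  refine ⟨(InnerProductSpace.toDual ℂ E).symm φ, fun x => ?_⟩
  rw [← inner_conj_symm, ← inner_conj_symm x, InnerProductSpace.toDual_symm_apply]
  rfl

/-- The Gram operator of a linear map that is injective modulo null vectors is onto. -/
theorem LinearMap.exists_inner_apply_eq_inner {E F : Type*} [NormedAddCommGroup E]
    [InnerProductSpace ℂ E] [FiniteDimensional ℂ E] [CompleteSpace E]
    [SeminormedAddCommGroup F] [InnerProductSpace ℂ F]
    (L : E →ₗ[ℂ] F) (hL : ∀ x, ‖L x‖ = 0 → x = 0) (e : E) :
    ∃ x₀, ∀ x, inner ℂ (L x) (L x₀) = inner ℂ x e := by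
  let R : Submodule ℂ E :=
    { carrier := {e | ∃ x₀, ∀ x, inner ℂ (L x) (L x₀) = inner ℂ x e}
      zero_mem' := ⟨0, fun x => by simp⟩
      add_mem' := by
        rintro e e' ⟨x₀, h⟩ ⟨x₁, h'⟩
        exact ⟨x₀ + x₁, fun x => by rw [map_add, inner_add_right, inner_add_right, h, h']⟩
      smul_mem' := by
        rintro c e ⟨x₀, h⟩
        exact ⟨c • x₀, fun x => by rw [map_smul, inner_smul_right, inner_smul_right, h]⟩ }
  have hR : R = ⊤ := by
    rw [← Submodule.orthogonal_eq_bot_iff, Submodule.eq_bot_iff]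
    intro u hu
    obtain ⟨e, he⟩ := L.exists_inner_eq_inner_apply (L u)
    have h0 := (Submodule.mem_orthogonal' R u).1 hu e ⟨u, he⟩
    rw [← he, inner_self_eq_norm_sq_to_K] at h0
    exact hL u (by simpa using h0)
  exact (hR ▸ Submodule.mem_top : e ∈ R)

namespace SymmetricSystem

variable {E : Type*} [NormedAddCommGroup E] [InnerProductSpace ℂ E] [FiniteDimensional ℂ E]
  [CompleteSpace E] {S : SymmetricSystem E}

/-! ### Definiteness on a compact segment -/

section Compact

open Set

/-- A definite system is definite on some segment `[a, β] ⊆ I`, since the spaces of solutions of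
the homogeneous equation that are null on `[a, β]` decrease with `β`. -/
theorem IsDefinite.exists_segment (hdef : S.IsDefinite) :
    ∃ β ∈ S.I, ∀ x, (∀ᵐ t ∂(volume.restrict (Icc S.a β)), S.Δ t (S.fund x t) = 0) → x = 0 := by
  let N : ℝ → Submodule ℂ E := fun β =>
    { carrier := {x | ∀ᵐ t ∂(volume.restrict (Icc S.a β)), S.Δ t (S.fund x t) = 0}
      zero_mem' := by simp
      add_mem' := by
        intro x x' hx hx'
        rw [mem_ofPred_eq] at hx hx' ⊢
        filter_upwards [hx, hx'] with t h1 h2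
        simp [h1, h2]
      smul_mem' := by
        intro c x hx
        rw [mem_ofPred_eq] at hx ⊢
        filter_upwards [hx] with t h1
        simp [h1] }
  have hmono : ∀ β γ, β ≤ γ → N γ ≤ N β := fun β γ h x hx =>
    ae_restrict_of_ae_restrict_of_subset (Icc_subset_Icc_right h) hx
  obtain ⟨_, ⟨β, hβ, rfl⟩, hmin⟩ := (wellFounded_lt (α := Submodule ℂ E)).has_min (N '' S.I)
    ⟨_, mem_image_of_mem _ S.a_mem_I⟩
  refine ⟨β, hβ, fun x hx => ?_⟩
  have hall : ∀ γ ∈ S.I, ∀ᵐ t ∂(volume.restrict (Icc S.a γ)), S.Δ t (S.fund x t) = 0 := by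
    intro γ hγ
    have hm : max β γ ∈ S.I := by rcases max_choice β γ with h | h <;> rwa [h]
    have h1 : N (max β γ) = N β := by
      by_contra hne
      exact hmin _ (mem_image_of_mem _ hm) (lt_of_le_of_ne (hmono _ _ (le_max_left _ _)) hne)
    have hxm : x ∈ N (max β γ) := by rw [h1]; exact hx
    exact hmono γ _ (le_max_right _ _) hxm
  have h0 := hdef 0 (S.fund x) ((S.fund_solves x).congr (fun _ _ => rfl)
    (Eventually.of_forall fun t => by simp)) (S.ae_restrict_I_iff.2 hall) S.a S.a_mem_I
  rwa [S.fund_apply_a] at h0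

theorem eq_zero_of_norm_fundCut {β γ : ℝ} (hγ : γ ∈ S.I) (hβγ : β ≤ γ)
    (hdef : ∀ x, (∀ᵐ t ∂(volume.restrict (Icc S.a β)), S.Δ t (S.fund x t) = 0) → x = 0)
    (x : E) (hx : ‖S.fundCut hγ x‖ = 0) : x = 0 := by
  refine hdef x ?_
  have h := ae_restrict_of_ae_restrict_of_subset
    ((Icc_subset_Icc_right hβγ).trans (S.segment hγ).2) ((PreL2.norm_eq_zero_iff _).1 hx)
  filter_upwards [h, ae_restrict_mem measurableSet_Icc] with t ht htm
  have htγ : t ∈ Icc S.a γ := ⟨htm.1, htm.2.trans hβγ⟩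
  rwa [fundCut_toFun, indicator_of_mem htγ] at ht

/-- For `f` supported in `[a, β]`, the solution with `y(a) = x` vanishes to the right of `β`
provided that the pairings of `f` with the solutions of the homogeneous equation match `x`. -/
theorem exists_mem_tmax_of_support {β : ℝ} (hβ : β ∈ S.I) (f : S.PreL2)
    (hf : ∀ t ∉ Icc S.a β, f.toFun t = 0) (x : E)
    (hx : ∀ x', inner ℂ x' (S.J x) + inner ℂ (S.fundCut hβ x') f = 0) :
    ∃ y : S.PreL2, (y, f) ∈ S.tmax ∧ y.toFun S.a = x ∧ ∀ t, β ≤ t → y.toFun t = 0 := by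
  obtain ⟨w, hw, hwa⟩ := exists_solves (S := S) (fun β hβ => f.integrableOn_Δ hβ) x
  have hw0 : ∀ t ∈ S.I, β ≤ t → w t = 0 := by
    intro t ht hβt
    refine S.eq_zero_of_inner_fund ht fun x' => ?_
    rw [hw.inner_fund (fun β hβ => f.integrableOn_Δ hβ) ht, hwa, ← hx x',
      PreL2.inner_eq_setIntegral ht (fun r hr => Or.inr (hf r fun h => hr ⟨h.1, h.2.trans hβt⟩))]
    congr 1
    refine intervalIntegral.integral_congr fun r _ => ?_
    by_cases hr : r ∈ Icc S.a β
    · simp only [fundCut_toFun, indicator_of_mem hr]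
    · simp only [hf r hr, map_zero, inner_zero_right]
  obtain ⟨y, hy⟩ := exists_preL2_of_continuousOn hβ (hw.continuousOn.mono (S.segment hβ).2)
  have hyw : ∀ t ∈ S.I, y.toFun t = w t := by
    intro t ht
    rw [hy]
    by_cases h : t ∈ Icc S.a β
    · rw [indicator_of_mem h]
    · rw [indicator_of_notMem h, hw0 t ht]
      by_contra hlt
      exact h ⟨(S.segment ht).1, (not_le.1 hlt).le⟩
  refine ⟨y, hw.congr hyw (Eventually.of_forall fun _ => rfl), by rw [hyw _ S.a_mem_I, hwa],
    fun t ht => ?_⟩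
  by_cases htI : t ∈ S.I
  · rw [hyw t htI, hw0 t htI ht]
  · exact y.apply_of_notMem htI

/-- The value `y(a)` of a function `y ∈ dom tmax` that is null near `b` may be prescribed. -/
theorem IsDefinite.exists_domTmax_apply_a (hdef : S.IsDefinite) (x : E) :
    ∃ y : S.domTmax, y.1.toFun S.a = x ∧ ∀ z, S.boundaryForm y z = 0 := by
  obtain ⟨β, hβ, hβdef⟩ := hdef.exists_segment
  obtain ⟨x₀, hx₀⟩ := (S.fundCut hβ).exists_inner_apply_eq_inner
    (eq_zero_of_norm_fundCut hβ le_rfl hβdef) (-S.J x)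
  obtain ⟨y, hy, hya, hy0⟩ := exists_mem_tmax_of_support hβ (S.fundCut hβ x₀)
    (fun t ht => by rw [fundCut_toFun, indicator_of_notMem ht]) x
    (fun x' => by rw [hx₀, inner_neg_right, add_neg_cancel])
  exact ⟨⟨y, S.mem_domTmax hy⟩, hya, boundaryForm_eq_zero hβ fun t _ ht => hy0 t ht⟩

end Compact

/-! ### The adjoint of the minimal relation -/

section AdjointMinimal

open Set

/-- If `{z̃, g̃} ∈ (Tmin)*`, then on each large segment `[a, β]` the function `z` agrees modulo null
functions with a solution of the equation with right-hand side `g`: the difference of `z` and any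
solution `w` is orthogonal to all `f` on `[a, β]` which are orthogonal to the solutions of the
homogeneous equation. -/
theorem exists_ae_eq_of_mem_adjoint_Tmin {β : ℝ} (hβ : β ∈ S.I)
    (hβdef : ∀ x, ‖S.fundCut hβ x‖ = 0 → x = 0) {z g : S.PreL2}
    (hzg : S.quot (z, g) ∈ S.Tmin.adjoint) {w : ℝ → E} (hw : S.Solves w g.toFun) :
    ∃ x, ∀ᵐ t ∂(volume.restrict (Icc S.a β)),
      S.Δ t (z.toFun t) = S.Δ t (w t + S.fund x t) := by
  set L := S.fundCut hβ with hL
  obtain ⟨zc, hzc⟩ := z.exists_cut β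
  obtain ⟨wc, hwc⟩ := exists_preL2_of_continuousOn hβ (hw.continuousOn.mono (S.segment hβ).2)
  obtain ⟨e, he⟩ := L.exists_inner_eq_inner_apply (zc - wc)
  obtain ⟨x₀, hx₀⟩ := L.exists_inner_apply_eq_inner hβdef e
  set f : S.PreL2 := zc - wc - L x₀ with hf
  have hLf : ∀ x, inner ℂ (L x) f = 0 := fun x => by
    rw [hf, inner_sub_right, he, hx₀, sub_self]
  have hftoFun : ∀ t, f.toFun t = (Icc S.a β).indicator (z.toFun - w - S.fund x₀) t := by
    intro t
    rw [hf, map_sub, map_sub, hzc, hwc, fundCut_toFun, ← indicator_sub', ← indicator_sub']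
  have hf0 : ∀ t ∉ Icc S.a β, f.toFun t = 0 := fun t ht => by
    rw [hftoFun, indicator_of_notMem ht]
  obtain ⟨y, hy, hya, hy0⟩ := exists_mem_tmax_of_support hβ f hf0 0 (fun x' => by
    rw [map_zero, inner_zero_right, zero_add]
    exact hLf x')
  have hmin : S.quot (y, f) ∈ S.Tmin := mem_relationOf.2 ⟨y, f, hy, mem_domTmin_iff.2
    ⟨hya, boundaryForm_eq_zero hβ fun t _ ht => hy0 t ht⟩, rfl⟩
  have hadj : inner ℂ f z = inner ℂ y g := by
    have h := (Submodule.mem_adjoint_iff _ _).1 hzg _ _ hmin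
    exact sub_eq_zero.1 h
  have hyβ : ∀ t ∉ Icc S.a β, y.toFun t = 0 := by
    intro t ht
    by_cases h : t ∈ S.I
    · refine hy0 t ?_
      by_contra hlt
      exact ht ⟨(S.segment h).1, (not_le.1 hlt).le⟩
    · exact y.apply_of_notMem h
  have hlag := hw.lagrange (show S.Solves y.toFun f.toFun from hy)
    (fun β hβ => g.integrableOn_Δ hβ) (fun β hβ => f.integrableOn_Δ hβ) hβ
  rw [hy0 β le_rfl, hya, inner_zero_left, inner_zero_left, sub_zero] at hlag
  have hwcint : inner ℂ f wc = inner ℂ y g := by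
    rw [PreL2.inner_eq_setIntegral hβ (fun t ht => Or.inl (hf0 t ht)),
      PreL2.inner_eq_setIntegral hβ (fun t ht => Or.inl (hyβ t ht)), eq_comm, ← sub_eq_zero,
      ← intervalIntegral.integral_sub, ← hlag]
    · refine intervalIntegral.integral_congr_ae ?_
      have h := (ae_restrict_iff' S.measurableSet_I).1 S.Δ_pos
      filter_upwards [h] with t ht htm
      rw [uIoc_of_le (S.segment hβ).1] at htm
      have htI : t ∈ Icc S.a β := ⟨htm.1.le, htm.2⟩
      have hs : inner ℂ (S.Δ t (f.toFun t)) (w t) = inner ℂ (f.toFun t) (S.Δ t (w t)) :=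
        (ht ((S.segment hβ).2 htI)).isSymmetric _ _
      rw [hwc, indicator_of_mem htI, hs]
    · exact ((PreL2.integrable y g).mono_set (S.segment hβ).2).intervalIntegrable_of_le
        (S.segment hβ).1
    · exact ((PreL2.integrable f wc).mono_set (S.segment hβ).2).intervalIntegrable_of_le
        (S.segment hβ).1
  have hzcint : inner ℂ f zc = inner ℂ f z := by
    rw [PreL2.inner_eq_setIntegral hβ (fun t ht => Or.inl (hf0 t ht)),
      PreL2.inner_eq_setIntegral hβ (fun t ht => Or.inl (hf0 t ht))]
    refine intervalIntegral.integral_congr fun t ht => ?_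
    rw [uIcc_of_le (S.segment hβ).1] at ht
    simp only [hzc, indicator_of_mem ht]
  have hff : inner ℂ f f = 0 := by
    have h1 : inner ℂ f (L x₀) = 0 := by rw [← inner_conj_symm, hLf, map_zero]
    conv_lhs => rw [hf, inner_sub_right, inner_sub_right, ← hf]
    rw [hzcint, hwcint, hadj, h1, sub_self, sub_zero]
  have hfn : ‖f‖ = 0 := by
    rw [inner_self_eq_norm_sq_to_K] at hff
    simpa using hff
  refine ⟨x₀, ?_⟩
  filter_upwards [ae_restrict_of_ae_restrict_of_subset (S.segment hβ).2
    ((PreL2.norm_eq_zero_iff f).1 hfn), ae_restrict_mem measurableSet_Icc] with t ht htm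
  rw [hftoFun, indicator_of_mem htm, Pi.sub_apply, Pi.sub_apply, sub_sub, map_sub,
    sub_eq_zero] at ht
  exact ht

/-- `(Tmin)* ⊆ Tmax`. -/
theorem IsDefinite.exists_tmax_of_mem_adjoint_Tmin (hdef : S.IsDefinite) {p : S.L2 × S.L2}
    (hp : p ∈ S.Tmin.adjoint) : ∃ q ∈ S.tmax, S.quot q = p := by
  obtain ⟨p₁, p₂⟩ := p
  obtain ⟨z, rfl⟩ := SeparationQuotient.surjective_mk p₁
  obtain ⟨g, rfl⟩ := SeparationQuotient.surjective_mk p₂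
  obtain ⟨w, hw, -⟩ := exists_solves (S := S) (fun β hβ => g.integrableOn_Δ hβ) 0
  obtain ⟨β₀, hβ₀, hβdef⟩ := hdef.exists_segment
  have key : ∀ β (hβ : β ∈ S.I), β₀ ≤ β → ∃ x, ∀ᵐ t ∂(volume.restrict (Icc S.a β)),
      S.Δ t (z.toFun t) = S.Δ t (w t + S.fund x t) := fun β hβ hle =>
    exists_ae_eq_of_mem_adjoint_Tmin hβ (eq_zero_of_norm_fundCut hβ hle hβdef) hp hw
  obtain ⟨x₀, hx₀⟩ := key β₀ hβ₀ le_rfl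
  -- by definiteness on `[a, β₀]`, the initial value `x₀` serves for all segments
  have hall : ∀ᵐ t ∂(volume.restrict S.I), S.Δ t (z.toFun t) = S.Δ t (w t + S.fund x₀ t) := by
    rw [S.ae_restrict_I_iff]
    intro β hβ
    rcases le_total β β₀ with hle | hle
    · exact ae_restrict_of_ae_restrict_of_subset (Icc_subset_Icc_right hle) hx₀
    · obtain ⟨x, hx⟩ := key β hβ hle
      have hxx : x - x₀ = 0 := by
        refine hβdef _ ?_
        filter_upwards [ae_restrict_of_ae_restrict_of_subset (Icc_subset_Icc_right hle) hx,
          hx₀] with t h1 h2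
        rw [h1, map_add, map_add, add_right_inj] at h2
        rw [map_sub, Pi.sub_apply, map_sub, h2, sub_self]
      rwa [sub_eq_zero.1 hxx] at hx
  have hsol : S.Solves (w + S.fund x₀) g.toFun := by
    simpa using hw.add (S.fund_solves x₀)
  set v : ℝ → E := S.I.indicator (w + S.fund x₀) with hv
  have hvI : ∀ t ∈ S.I, v t = w t + S.fund x₀ t := fun t ht => by rw [hv, indicator_of_mem ht]; rfl
  have hvm : StronglyMeasurable v :=
    hsol.continuousOn.stronglyMeasurable_indicator S.measurableSet_I
  have hΔ : ∀ᵐ t ∂(volume.restrict S.I), S.Δ t (z.toFun t) = S.Δ t (v t) := by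
    filter_upwards [hall, ae_restrict_mem S.measurableSet_I] with t h1 h2
    rw [h1, hvI t h2]
  let u : S.PreL2 := ⟨v, hvm, fun t ht => indicator_of_notMem ht _, by
    refine (PreL2.integrable z z).congr ?_
    filter_upwards [hΔ, S.Δ_pos] with t h1 h2
    have hs : ∀ a b : E, inner ℂ (S.Δ t a) b = inner ℂ a (S.Δ t b) := h2.isSymmetric
    rw [← h1, ← hs (v t), ← h1, hs]⟩
  refine ⟨(u, g), hsol.congr hvI (Eventually.of_forall fun _ => rfl), ?_⟩
  refine Prod.ext (mk_eq_mk_iff.2 ?_) rfl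
  filter_upwards [hΔ] with t ht using ht.symm

end AdjointMinimal

end SymmetricSystem

/-! ### Completeness of the space `L²_Δ(I)` -/

section Operator

variable {E : Type*} [NormedAddCommGroup E] [InnerProductSpace ℂ E]

/-- A contraction whose fixed points are the null vectors of `T`, when `T` is positive. -/
noncomputable def ContinuousLinearMap.nullContraction (T : E →L[ℂ] E) : E →L[ℂ] E :=
  1 - (((1 + ‖T‖)⁻¹ : ℝ) : ℂ) • T

/-- The null space of `T`, as the space of fixed points of `T.nullContraction`. -/
noncomputable abbrev ContinuousLinearMap.nullSpace (T : E →L[ℂ] E) : Submodule ℂ E :=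
  T.nullContraction.eqLocus (1 : E →L[ℂ] E)

theorem ContinuousLinearMap.mem_nullSpace {T : E →L[ℂ] E} {x : E} : x ∈ T.nullSpace ↔ T x = 0 := by
  have h : (((1 + ‖T‖)⁻¹ : ℝ) : ℂ) ≠ 0 := by
    have : 0 < 1 + ‖T‖ := by positivity
    exact_mod_cast (inv_pos.2 this).ne'
  simp only [ContinuousLinearMap.nullSpace, LinearMap.mem_eqLocus,
    ContinuousLinearMap.nullContraction]
  change x - (((1 + ‖T‖)⁻¹ : ℝ) : ℂ) • T x = x ↔ T x = 0
  rw [sub_eq_self, smul_eq_zero, or_iff_right h]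

theorem ContinuousLinearMap.norm_nullContraction_le {T : E →L[ℂ] E}
    (hT : (T : E →ₗ[ℂ] E).IsPositive) : ‖T.nullContraction‖ ≤ 1 := by
  refine ContinuousLinearMap.opNorm_le_bound _ zero_le_one fun x => ?_
  set c : ℝ := (1 + ‖T‖)⁻¹ with hc
  have h0 : 0 < 1 + ‖T‖ := by positivity
  have hc0 : 0 ≤ c := (inv_pos.2 h0).le
  have hcT : c * ‖T‖ ≤ 1 := by
    rw [hc, inv_mul_le_iff₀ h0]
    linarith
  have hq := hT.re_inner_nonneg_right x
  have h1 := T.norm_apply_sq_le_of_isPositive hT x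
  have h2 : ‖x - (c : ℂ) • T x‖ ^ 2
      = ‖x‖ ^ 2 - 2 * (c * (inner ℂ x (T x)).re) + (c * ‖T x‖) ^ 2 := by
    rw [norm_sub_sq (𝕜 := ℂ), inner_smul_right, norm_smul, Complex.norm_real,
      Real.norm_of_nonneg hc0, RCLike.re_eq_complex_re, Complex.re_ofReal_mul]
  have hq' : 0 ≤ (inner ℂ x (T x)).re := hq
  have h3 : (c * ‖T x‖) ^ 2 ≤ c * (inner ℂ x (T x)).re := by
    calc (c * ‖T x‖) ^ 2 = c * (c * ‖T x‖ ^ 2) := by ring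
      _ ≤ c * (c * (‖T‖ * (inner ℂ x (T x)).re)) := by gcongr
      _ = c * (c * ‖T‖ * (inner ℂ x (T x)).re) := by ring
      _ ≤ c * (1 * (inner ℂ x (T x)).re) := by gcongr
      _ = _ := by ring
  have h4 : 0 ≤ c * (inner ℂ x (T x)).re := mul_nonneg hc0 hq'
  rw [one_mul]
  refine le_of_sq_le_sq ?_ (norm_nonneg _)
  change ‖x - (c : ℂ) • T x‖ ^ 2 ≤ _
  rw [h2]
  linarith

variable [CompleteSpace E]

theorem ContinuousLinearMap.sqrt_apply_sqrt_apply {T : E →L[ℂ] E}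
    (hT : (T : E →ₗ[ℂ] E).IsPositive) (x : E) : CFC.sqrt T (CFC.sqrt T x) = T x := by
  have h0 : 0 ≤ T := (ContinuousLinearMap.nonneg_iff_isPositive T).2
    ((ContinuousLinearMap.isPositive_toLinearMap_iff T).1 hT)
  exact congrArg (fun A : E →L[ℂ] E => A x) (CFC.sqrt_mul_sqrt_self T h0)

theorem ContinuousLinearMap.inner_sqrt_apply (T : E →L[ℂ] E) (x y : E) :
    inner ℂ (CFC.sqrt T x) y = inner ℂ x (CFC.sqrt T y) :=
  ((ContinuousLinearMap.nonneg_iff_isPositive _).1 (CFC.sqrt_nonneg T)).isSymmetric x y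

theorem ContinuousLinearMap.inner_sqrt_sqrt {T : E →L[ℂ] E}
    (hT : (T : E →ₗ[ℂ] E).IsPositive) (x : E) :
    inner ℂ (CFC.sqrt T x) (CFC.sqrt T x) = inner ℂ x (T x) := by
  rw [T.inner_sqrt_apply, T.sqrt_apply_sqrt_apply hT]

theorem ContinuousLinearMap.sqrt_apply_eq_zero_iff {T : E →L[ℂ] E}
    (hT : (T : E →ₗ[ℂ] E).IsPositive) {x : E} : CFC.sqrt T x = 0 ↔ T x = 0 := by
  refine ⟨fun h => ?_, fun h => ?_⟩
  · rw [← T.sqrt_apply_sqrt_apply hT, h, map_zero]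
  · rw [← inner_self_eq_zero (𝕜 := ℂ), T.inner_sqrt_sqrt hT, h, inner_zero_right]

variable [FiniteDimensional ℂ E]

/-- Modulo null vectors, the values of the square root control the vector; so if `√T xₙ` converges,
then so do the parts of the `xₙ` orthogonal to the null space. -/
theorem ContinuousLinearMap.exists_tendsto_sub_starProjection {T : E →L[ℂ] E}
    (hT : (T : E →ₗ[ℂ] E).IsPositive) {u : ℕ → E} {g : E}
    (hu : Tendsto (fun n => CFC.sqrt T (u n)) atTop (𝓝 g)) :
    ∃ v, Tendsto (fun n => u n - T.nullSpace.starProjection (u n)) atTop (𝓝 v) ∧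
      CFC.sqrt T v = g := by
  set P := T.nullSpace.starProjection with hP
  let R : T.nullSpaceᗮ →ₗ[ℂ] E := ((CFC.sqrt T : E →L[ℂ] E) : E →ₗ[ℂ] E) ∘ₗ T.nullSpaceᗮ.subtype
  obtain ⟨K, -, hK⟩ := R.exists_antilipschitzWith (by
    rw [LinearMap.ker_eq_bot']
    rintro ⟨x, hx⟩ h
    have hx' : x ∈ T.nullSpace :=
      ContinuousLinearMap.mem_nullSpace.2 ((T.sqrt_apply_eq_zero_iff hT).1 h)
    exact Subtype.ext (inner_self_eq_zero.1 ((Submodule.mem_orthogonal _ _).1 hx x hx')))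
  have hmem : ∀ x, x - P x ∈ T.nullSpaceᗮ := fun x =>
    Submodule.sub_starProjection_mem_orthogonal x
  have hR : ∀ x, R ⟨x - P x, hmem x⟩ = CFC.sqrt T x := fun x => by
    have h0 : CFC.sqrt T (P x) = 0 := (T.sqrt_apply_eq_zero_iff hT).2
      (ContinuousLinearMap.mem_nullSpace.1 (Submodule.starProjection_apply_mem _ x))
    change CFC.sqrt T (x - P x) = _
    rw [map_sub, h0, sub_zero]
  have hc : CauchySeq fun n => u n - P (u n) := by
    rw [Metric.cauchySeq_iff']
    intro ε hε
    obtain ⟨N, hN⟩ := Metric.cauchySeq_iff'.1 hu.cauchySeq (ε / (K + 1)) (by positivity)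
    refine ⟨N, fun n hn => ?_⟩
    have h1 := hK.le_mul_dist ⟨u n - P (u n), hmem _⟩ ⟨u N - P (u N), hmem _⟩
    rw [hR, hR, Subtype.dist_eq] at h1
    have h2 := hN n hn
    rw [lt_div_iff₀ (by positivity)] at h2
    have h3 : 0 ≤ dist (CFC.sqrt T (u n)) (CFC.sqrt T (u N)) := dist_nonneg
    refine h1.trans_lt ?_
    nlinarith [K.coe_nonneg]
  obtain ⟨v, hv⟩ := cauchySeq_tendsto_of_complete hc
  refine ⟨v, hv, tendsto_nhds_unique (((CFC.sqrt T).continuous.tendsto v).comp hv) ?_⟩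
  exact hu.congr fun n => (hR (u n)).symm

end Operator

namespace SymmetricSystem

/-- The projection onto the null space of `Δ(t)` depends measurably on `t`, since it is a limit of
Birkhoff averages by the mean ergodic theorem. -/
theorem aestronglyMeasurable_starProjection_nullSpace {E : Type*} [NormedAddCommGroup E]
    [InnerProductSpace ℂ E] [CompleteSpace E] (S : SymmetricSystem E) {f : ℝ → E}
    (hf : StronglyMeasurable f) :
    AEStronglyMeasurable (fun t => (S.Δ t).nullSpace.starProjection (f t))
      (volume.restrict S.I) := by
  have happ : Continuous fun p : (E →L[ℂ] E) × E => p.1 p.2 :=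
    (isBoundedBilinearMap_apply (𝕜 := ℂ) (E := E) (F := E)).continuous
  have hC : Continuous (ContinuousLinearMap.nullContraction : (E →L[ℂ] E) → E →L[ℂ] E) := by
    unfold ContinuousLinearMap.nullContraction
    have hs : Continuous fun T : E →L[ℂ] E => (((1 + ‖T‖)⁻¹ : ℝ) : ℂ) :=
      Complex.continuous_ofReal.comp
        ((continuous_const.add continuous_norm).inv₀
          fun T => (by positivity : (0 : ℝ) < 1 + ‖T‖).ne')
    refine continuous_const.sub
      (?_ : Continuous fun T : E →L[ℂ] E => (((1 + ‖T‖)⁻¹ : ℝ) : ℂ) • T)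
    exact hs.smul continuous_id
  have hiter : ∀ n : ℕ, AEStronglyMeasurable
      (fun t => ((S.Δ t).nullContraction)^[n] (f t)) (volume.restrict S.I) := by
    intro n
    induction n with
    | zero => exact hf.aestronglyMeasurable
    | succ n ih =>
      simp only [Function.iterate_succ_apply']
      exact happ.comp_aestronglyMeasurable
        ((hC.comp_aestronglyMeasurable S.Δ_locInt.aestronglyMeasurable).prodMk ih)
  refine aestronglyMeasurable_of_tendsto_ae atTop
    (f := fun n t => birkhoffAverage ℂ (S.Δ t).nullContraction _root_.id n (f t)) (fun n => ?_) ?_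
  · simp only [birkhoffAverage, birkhoffSum, id]
    exact AEStronglyMeasurable.const_smul
      (Finset.aestronglyMeasurable_fun_sum _ fun i _ => hiter i) _
  · filter_upwards [S.Δ_pos] with t ht
    exact ContinuousLinearMap.tendsto_birkhoffAverage_orthogonalProjection _
      (ContinuousLinearMap.norm_nullContraction_le ht) (f t)

theorem norm_sqrt_sq {E : Type*} [NormedAddCommGroup E] [InnerProductSpace ℂ E] [CompleteSpace E]
    (S : SymmetricSystem E) : ∀ᵐ t ∂(volume.restrict S.I), ∀ x : E,
    inner ℂ x (S.Δ t x) = ((‖CFC.sqrt (S.Δ t) x‖ ^ 2 : ℝ) : ℂ) := by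
  filter_upwards [S.Δ_pos] with t ht x
  rw [← ContinuousLinearMap.inner_sqrt_sqrt ht, inner_self_eq_norm_sq_to_K]
  simp

variable {E : Type*} [NormedAddCommGroup E] [InnerProductSpace ℂ E] [FiniteDimensional ℂ E]
  [CompleteSpace E] (S : SymmetricSystem E)

section Completeness

theorem aestronglyMeasurable_sqrt_Δ :
    AEStronglyMeasurable (fun t => CFC.sqrt (S.Δ t)) (volume.restrict S.I) := by
  have : FiniteDimensional ℂ (E →L[ℂ] E) := inferInstance
  have := FiniteDimensional.proper ℂ (E →L[ℂ] E)
  borelize (E →L[ℂ] E)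
  have hcl : IsClosed {a : E →L[ℂ] E | 0 ≤ a} := isClosed_Ici
  have hm := (CFC.continuousOn_sqrt (A := E →L[ℂ] E)).stronglyMeasurable_indicator
    hcl.measurableSet
  refine (hm.aestronglyMeasurable.comp_aemeasurable
    S.Δ_locInt.aestronglyMeasurable.aemeasurable).congr ?_
  filter_upwards [S.Δ_pos] with t ht
  have h0 : 0 ≤ S.Δ t := (ContinuousLinearMap.nonneg_iff_isPositive _).2
    ((ContinuousLinearMap.isPositive_toLinearMap_iff _).1 ht)
  exact Set.indicator_of_mem (s := {a : E →L[ℂ] E | 0 ≤ a}) h0 _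

theorem aestronglyMeasurable_sqrt_apply {f : ℝ → E} (hf : StronglyMeasurable f) :
    AEStronglyMeasurable (fun t => CFC.sqrt (S.Δ t) (f t)) (volume.restrict S.I) :=
  (isBoundedBilinearMap_apply (𝕜 := ℂ) (E := E) (F := E)).continuous.comp_aestronglyMeasurable
    (S.aestronglyMeasurable_sqrt_Δ.prodMk hf.aestronglyMeasurable)

theorem PreL2.memLp_sqrt {S : SymmetricSystem E} (f : S.PreL2) :
    MemLp (fun t => CFC.sqrt (S.Δ t) (f.toFun t)) 2 (volume.restrict S.I) := by
  rw [memLp_two_iff_integrable_sq_norm (S.aestronglyMeasurable_sqrt_apply f.stronglyMeasurable)]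
  refine (PreL2.integrable f f).re.congr ?_
  filter_upwards [S.norm_sqrt_sq] with t ht
  rw [ht, RCLike.re_eq_complex_re, Complex.ofReal_re]

/-- The isometry `f ↦ √Δ f` of `𝓛²_Δ(I)` into the space of square integrable functions. -/
noncomputable def sqrtMap : S.PreL2 →ₗ[ℂ] Lp E 2 (volume.restrict S.I) where
  toFun f := f.memLp_sqrt.toLp
  map_add' f g := by
    rw [← MemLp.toLp_add]
    congr 1
    funext t
    simp
  map_smul' c f := by
    rw [RingHom.id_apply, ← MemLp.toLp_const_smul]
    congr 1
    funext t
    simp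

theorem coeFn_sqrtMap (f : S.PreL2) :
    S.sqrtMap f =ᵐ[volume.restrict S.I] fun t => CFC.sqrt (S.Δ t) (f.toFun t) :=
  f.memLp_sqrt.coeFn_toLp

theorem isometry_sqrtMap : Isometry S.sqrtMap := by
  refine AddMonoidHomClass.isometry_of_norm _ fun f => ?_
  have h : inner ℂ (S.sqrtMap f) (S.sqrtMap f) = inner ℂ f f := by
    rw [L2.inner_def, PreL2.inner_def]
    refine integral_congr_ae ?_
    filter_upwards [S.coeFn_sqrtMap f, S.Δ_pos] with t h1 h2
    rw [h1, ContinuousLinearMap.inner_sqrt_sqrt h2]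
  rw [inner_self_eq_norm_sq_to_K, inner_self_eq_norm_sq_to_K] at h
  have h' : ‖S.sqrtMap f‖ ^ 2 = ‖f‖ ^ 2 := by exact_mod_cast h
  exact (sq_eq_sq₀ (norm_nonneg _) (norm_nonneg _)).1 h'

instance completeSpace_preL2 : CompleteSpace S.PreL2 := by
  refine Metric.complete_of_cauchySeq_tendsto fun u hu => ?_
  obtain ⟨g, hg⟩ := cauchySeq_tendsto_of_complete
    (S.isometry_sqrtMap.uniformContinuous.comp_cauchySeq hu)
  obtain ⟨ns, -, hns⟩ := (tendstoInMeasure_of_tendsto_Lp hg).exists_seq_tendsto_ae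
  have hlim : ∀ᵐ t ∂(volume.restrict S.I), ∃ v, Tendsto (fun n => (u (ns n)).toFun t -
      (S.Δ t).nullSpace.starProjection ((u (ns n)).toFun t)) atTop (𝓝 v) ∧
        CFC.sqrt (S.Δ t) v = g t := by
    have hco : ∀ᵐ t ∂(volume.restrict S.I), ∀ n,
        S.sqrtMap (u (ns n)) t = CFC.sqrt (S.Δ t) ((u (ns n)).toFun t) :=
      ae_all_iff.2 fun n => S.coeFn_sqrtMap _
    filter_upwards [hns, hco, S.Δ_pos] with t h1 h2 h3
    refine ContinuousLinearMap.exists_tendsto_sub_starProjection h3 (h1.congr fun n => ?_)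
    exact h2 n
  obtain ⟨f, hfm, hf⟩ := exists_stronglyMeasurable_limit_of_tendsto_ae
    (fun n => ((u (ns n)).stronglyMeasurable.aestronglyMeasurable).sub
      (S.aestronglyMeasurable_starProjection_nullSpace (u (ns n)).stronglyMeasurable))
    (hlim.mono fun t ht => ⟨ht.choose, ht.choose_spec.1⟩)
  have hfg : ∀ᵐ t ∂(volume.restrict S.I), CFC.sqrt (S.Δ t) (S.I.indicator f t) = g t := by
    filter_upwards [hf, hlim, ae_restrict_mem S.measurableSet_I] with t h1 ⟨v, h2, h3⟩ h4
    rw [Set.indicator_of_mem h4, ← h3, tendsto_nhds_unique h1 h2]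
  let w : S.PreL2 := ⟨S.I.indicator f, hfm.indicator S.measurableSet_I,
    fun t ht => Set.indicator_of_notMem ht _, by
      have h := (Lp.memLp g).integrable_norm_pow (by norm_num : (2 : ℕ) ≠ 0)
      refine (h.ofReal (𝕜 := ℂ)).congr ?_
      filter_upwards [hfg, S.norm_sqrt_sq] with t h1 h2
      rw [h2, h1]
      rfl⟩
  have hwg : S.sqrtMap w = g := by
    refine Lp.ext ?_
    filter_upwards [S.coeFn_sqrtMap w, hfg] with t h1 h2
    rw [h1]
    exact h2
  refine ⟨w, ?_⟩
  rw [tendsto_iff_dist_tendsto_zero]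
  refine (tendsto_iff_dist_tendsto_zero.1 hg).congr fun n => ?_
  rw [← hwg]
  exact S.isometry_sqrtMap.dist_eq _ _

end Completeness

end SymmetricSystem

/-! ### Signatures of Hermitian forms -/

section Signature

variable {V W : Type*} [AddCommGroup V] [Module ℂ V] [AddCommGroup W] [Module ℂ W]

/-- The function `q` (the quadratic form of a nondegenerate Hermitian form, in the applications) is
positive on an `m`-dimensional and negative on an `n`-dimensional subspace, except at zero, where
`m + n` is the dimension of the space. -/
def HasSignature (q : V → ℝ) (m n : ℕ) : Prop :=
  q 0 = 0 ∧ Module.finrank ℂ V = m + n ∧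
    (∃ P : Submodule ℂ V, Module.finrank ℂ P = m ∧ ∀ v ∈ P, v ≠ 0 → 0 < q v) ∧
    ∃ N : Submodule ℂ V, Module.finrank ℂ N = n ∧ ∀ v ∈ N, v ≠ 0 → q v < 0

theorem HasSignature.neg {q : V → ℝ} {m n : ℕ} (h : HasSignature q m n) :
    HasSignature (fun v => -q v) n m := by
  obtain ⟨h0, hV, ⟨P, hP, hPq⟩, N, hN, hNq⟩ := h
  exact ⟨by simp [h0], by rw [hV, add_comm], ⟨N, hN, fun v hv hv0 => neg_pos.2 (hNq v hv hv0)⟩,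
    P, hP, fun v hv hv0 => neg_lt_zero.2 (hPq v hv hv0)⟩

theorem HasSignature.of_linearMap {A B : Type*} [AddCommGroup A] [Module ℂ A] [AddCommGroup B]
    [Module ℂ B] {q : V → ℝ} (h0 : q 0 = 0)
    (hV : Module.finrank ℂ V = Module.finrank ℂ A + Module.finrank ℂ B)
    (f : A →ₗ[ℂ] V) (hf : ∀ a, a ≠ 0 → 0 < q (f a)) (g : B →ₗ[ℂ] V)
    (hg : ∀ b, b ≠ 0 → q (g b) < 0) :
    HasSignature q (Module.finrank ℂ A) (Module.finrank ℂ B) := by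
  have hfi : Function.Injective f := (injective_iff_map_eq_zero f).2 fun a ha => by
    by_contra hne
    have := hf a hne
    rw [ha, h0] at this
    exact lt_irrefl _ this
  have hgi : Function.Injective g := (injective_iff_map_eq_zero g).2 fun b hb => by
    by_contra hne
    have := hg b hne
    rw [hb, h0] at this
    exact lt_irrefl _ this
  refine ⟨h0, hV, ⟨LinearMap.range f, LinearMap.finrank_range_of_inj hfi, ?_⟩,
    LinearMap.range g, LinearMap.finrank_range_of_inj hgi, ?_⟩
  · rintro _ ⟨a, rfl⟩ ha
    exact hf a fun h => ha (by rw [h, map_zero])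
  · rintro _ ⟨b, rfl⟩ hb
    exact hg b fun h => hb (by rw [h, map_zero])

theorem HasSignature.prod [FiniteDimensional ℂ V] [FiniteDimensional ℂ W] {q : V → ℝ}
    {q' : W → ℝ} {m n m' n' : ℕ} (h : HasSignature q m n) (h' : HasSignature q' m' n') :
    HasSignature (fun v : V × W => q v.1 + q' v.2) (m + m') (n + n') := by
  obtain ⟨h0, hV, ⟨P, rfl, hPq⟩, N, rfl, hNq⟩ := h
  obtain ⟨h0', hV', ⟨P', rfl, hPq'⟩, N', rfl, hNq'⟩ := h'
  rw [← Module.finrank_prod, ← Module.finrank_prod]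
  refine HasSignature.of_linearMap (by simp [h0, h0']) ?_ (P.subtype.prodMap P'.subtype) ?_
    (N.subtype.prodMap N'.subtype) ?_
  · rw [Module.finrank_prod, Module.finrank_prod, Module.finrank_prod, hV, hV']
    ring
  · rintro ⟨a, b⟩ hab
    change 0 < q a + q' b
    by_cases ha : a = 0
    · have hb : b ≠ 0 := fun hb => hab (Prod.ext ha hb)
      rw [ha, Submodule.coe_zero, h0, zero_add]
      exact hPq' _ b.2 (by simpa using hb)
    · refine add_pos_of_pos_of_nonneg (hPq _ a.2 (by simpa using ha)) ?_
      by_cases hb : b = 0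
      · rw [hb, Submodule.coe_zero, h0']
      · exact (hPq' _ b.2 (by simpa using hb)).le
  · rintro ⟨a, b⟩ hab
    change q a + q' b < 0
    by_cases ha : a = 0
    · have hb : b ≠ 0 := fun hb => hab (Prod.ext ha hb)
      rw [ha, Submodule.coe_zero, h0, zero_add]
      exact hNq' _ b.2 (by simpa using hb)
    · refine add_neg_of_neg_of_nonpos (hNq _ a.2 (by simpa using ha)) ?_
      by_cases hb : b = 0
      · rw [hb, Submodule.coe_zero, h0']
      · exact (hNq' _ b.2 (by simpa using hb)).le

theorem HasSignature.finrank_le [FiniteDimensional ℂ V] {q : V → ℝ} {m n : ℕ}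
    (h : HasSignature q m n) (f : W →ₗ[ℂ] V) (hf : ∀ w, w ≠ 0 → 0 < q (f w)) :
    FiniteDimensional ℂ W ∧ Module.finrank ℂ W ≤ m := by
  obtain ⟨h0, hV, -, N, rfl, hNq⟩ := h
  have hfi : Function.Injective f := (injective_iff_map_eq_zero f).2 fun a ha => by
    by_contra hne
    have := hf a hne
    rw [ha, h0] at this
    exact lt_irrefl _ this
  refine ⟨FiniteDimensional.of_injective f hfi, ?_⟩
  have hd : Disjoint (LinearMap.range f) N := by
    rw [Submodule.disjoint_def]
    rintro _ ⟨w, rfl⟩ hw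
    by_contra hne
    exact lt_asymm (hf w fun h => hne (by rw [h, map_zero])) (hNq _ hw hne)
  have := Submodule.finrank_add_finrank_le_of_disjoint hd
  rw [LinearMap.finrank_range_of_inj hfi, hV] at this
  omega

theorem toENat_rank_eq_finrank [FiniteDimensional ℂ V] :
    Cardinal.toENat (Module.rank ℂ V) = (Module.finrank ℂ V : ℕ∞) := by
  rw [← Module.finrank_eq_rank, Cardinal.toENat_nat]

/-- The positive index of inertia of a form that is pulled back along a surjective linear map. -/
theorem HasSignature.iSup_rank_eq [FiniteDimensional ℂ V] {q : V → ℝ} {m n : ℕ}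
    (h : HasSignature q m n) {G : W →ₗ[ℂ] V} (hG : Function.Surjective G) {F : W → ℝ}
    (hF : ∀ w, F w = q (G w)) :
    ⨆ (M : Submodule ℂ W) (_ : ∀ w ∈ M, w ≠ 0 → 0 < F w), Cardinal.toENat (Module.rank ℂ M)
      = (m : ℕ∞) := by
  refine le_antisymm (iSup₂_le fun M hM => ?_) ?_
  · obtain ⟨hfin, hle⟩ := h.finrank_le (G ∘ₗ M.subtype) (fun w hw => by
      rw [LinearMap.comp_apply, Submodule.subtype_apply, ← hF]
      exact hM w w.2 (by simpa using hw))
    rw [toENat_rank_eq_finrank]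
    exact_mod_cast hle
  · obtain ⟨-, -, ⟨P, rfl, hP⟩, -⟩ := h
    obtain ⟨s, hs⟩ := G.exists_rightInverse_of_surjective (LinearMap.range_eq_top.2 hG)
    have hs' : ∀ v, G (s v) = v := LinearMap.congr_fun hs
    have hsi : Function.Injective (s ∘ₗ P.subtype) := fun a b hab => by
      have := congrArg G hab
      simpa [hs'] using this
    refine le_trans (le_of_eq ?_) (le_iSup₂ (f := fun (M : Submodule ℂ W)
      (_ : ∀ w ∈ M, w ≠ 0 → 0 < F w) => Cardinal.toENat (Module.rank ℂ M))
      (LinearMap.range (s ∘ₗ P.subtype)) ?_)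
    · rw [toENat_rank_eq_finrank, LinearMap.finrank_range_of_inj hsi]
    · rintro _ ⟨p, rfl⟩ hp
      rw [hF, LinearMap.comp_apply, hs']
      exact hP _ p.2 fun h => hp (by rw [LinearMap.comp_apply, h, map_zero])

end Signature

/-! ### Deficiency indices of symmetric relations -/

section Relation

variable {H : Type*} [NormedAddCommGroup H] [InnerProductSpace ℂ H]

theorem Submodule.isClosed_adjoint (A : Submodule ℂ (H × H)) :
    IsClosed (A.adjoint : Set (H × H)) := by
  have : (A.adjoint : Set (H × H))
      = ⋂ p ∈ A, {x : H × H | inner ℂ p.2 x.1 - inner ℂ p.1 x.2 = 0} := by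
    ext x
    simp only [SetLike.mem_coe, Submodule.mem_adjoint_iff, Set.mem_iInter, Prod.forall]
    rfl
  rw [this]
  refine isClosed_biInter fun p _ => isClosed_eq ?_ continuous_const
  fun_prop

theorem Submodule.adjoint_antitone {A B : Submodule ℂ (H × H)} (h : A ≤ B) :
    B.adjoint ≤ A.adjoint := fun x hx => by
  rw [Submodule.mem_adjoint_iff] at hx ⊢
  exact fun a b hab => hx a b (h hab)

theorem mem_defectSubspace {A : Submodule ℂ (H × H)} {l : ℂ} {f : H} :
    f ∈ defectSubspace A l ↔ (f, l • f) ∈ A.adjoint := Iff.rfl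

/-- Von Neumann's decomposition `A* = A + {{g, l g} | g ∈ ker (A* - l)} +
{{h, l̄ h} | h ∈ ker (A* - l̄)}` for a closed symmetric relation `A` in a Hilbert space. -/
theorem IsSymmetricRelation.exists_eq_add_add [CompleteSpace H] {A : Submodule ℂ (H × H)}
    (hA : IsSymmetricRelation A) {l : ℂ} (hl : l.im ≠ 0) {p : H × H} (hp : p ∈ A.adjoint) :
    ∃ a ∈ A, ∃ g ∈ defectSubspace A l, ∃ h ∈ defectSubspace A (starRingEnd ℂ l),
      p = a + (g, l • g) + (h, starRingEnd ℂ l • h) := by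
  set m : ℂ := starRingEnd ℂ l with hm
  -- the range of `A - l̄` is closed, since `A - l̄` is bounded below
  let φ : A →L[ℂ] H := (ContinuousLinearMap.snd ℂ H H - m • ContinuousLinearMap.fst ℂ H H) ∘L
    A.subtypeL
  have hφ : ∀ a : A, φ a = a.1.2 - m • a.1.1 := fun a => rfl
  have hAc : CompleteSpace A := hA.1.completeSpace_coe
  have hbound : ∀ a : A, ‖a‖ ≤ (((1 + ‖m‖) / |l.im| + 1 : ℝ).toNNReal) * ‖φ a‖ := by
    intro a
    have hl0 : 0 < |l.im| := abs_pos.2 hl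
    have hreal : (inner ℂ a.1.1 a.1.2).im = 0 := by
      have h := (Submodule.mem_adjoint_iff _ _).1 (hA.2 a.2) a.1.1 a.1.2 a.2
      have h' : starRingEnd ℂ (inner ℂ a.1.1 a.1.2) = inner ℂ a.1.1 a.1.2 := by
        rw [inner_conj_symm]; exact sub_eq_zero.1 h
      exact Complex.conj_eq_iff_im.1 h'
    have h1 : |l.im| * ‖a.1.1‖ ^ 2 ≤ ‖a.1.1‖ * ‖φ a‖ := by
      have h2 : (inner ℂ a.1.1 (φ a)).im = l.im * ‖a.1.1‖ ^ 2 := by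
        rw [hφ, inner_sub_right, inner_smul_right, inner_self_eq_norm_sq_to_K, Complex.sub_im,
          hreal, hm]
        simp only [Complex.coe_algebraMap, ← Complex.ofReal_pow, Complex.mul_im, Complex.conj_re,
          Complex.conj_im, Complex.ofReal_re, Complex.ofReal_im]
        ring
      calc |l.im| * ‖a.1.1‖ ^ 2 = |(inner ℂ a.1.1 (φ a)).im| := by
            rw [h2, abs_mul, abs_of_nonneg (sq_nonneg ‖a.1.1‖)]
        _ ≤ _ := (Complex.abs_im_le_norm _).trans (norm_inner_le_norm _ _)
    have h3 : ‖a.1.1‖ ≤ ‖φ a‖ / |l.im| := by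
      rw [le_div_iff₀ hl0]
      rcases (norm_nonneg a.1.1).eq_or_lt with h0 | h0
      · rw [← h0, zero_mul]; exact norm_nonneg _
      · nlinarith
    have h4 : ‖a.1.2‖ ≤ ‖φ a‖ + ‖m‖ * ‖a.1.1‖ := by
      have : a.1.2 = φ a + m • a.1.1 := by rw [hφ, sub_add_cancel]
      calc ‖a.1.2‖ = ‖φ a + m • a.1.1‖ := by rw [← this]
        _ ≤ _ := (norm_add_le _ _).trans (by rw [norm_smul])
    have h5 : (((1 + ‖m‖) / |l.im| + 1 : ℝ)) * ‖φ a‖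
        = ‖φ a‖ / |l.im| + ‖m‖ * (‖φ a‖ / |l.im|) + ‖φ a‖ := by
      field_simp
    rw [Real.coe_toNNReal _ (by positivity), h5]
    have h6 : ‖m‖ * ‖a.1.1‖ ≤ ‖m‖ * (‖φ a‖ / |l.im|) := by gcongr
    have h7 : 0 ≤ ‖m‖ * (‖φ a‖ / |l.im|) := by positivity
    have h8 : 0 ≤ ‖φ a‖ / |l.im| := by positivity
    have h9 := norm_nonneg (φ a)
    exact max_le (show ‖a.1.1‖ ≤ _ by linarith) (show ‖a.1.2‖ ≤ _ by linarith)
  have hcl : IsClosed (LinearMap.range (φ : A →ₗ[ℂ] H) : Set H) :=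
    (φ.antilipschitz_of_bound hbound).isClosed_range φ.uniformContinuous
  have hRc : CompleteSpace (LinearMap.range (φ : A →ₗ[ℂ] H)) := hcl.completeSpace_coe
  set R := LinearMap.range (φ : A →ₗ[ℂ] H) with hR
  obtain ⟨a, ha⟩ : R.starProjection (p.2 - m • p.1) ∈ R := Submodule.starProjection_apply_mem _ _
  set n := (p.2 - m • p.1) - R.starProjection (p.2 - m • p.1) with hn
  have hnR : n ∈ Rᗮ := Submodule.sub_starProjection_mem_orthogonal _
  have hnd : n ∈ defectSubspace A l := by
    rw [mem_defectSubspace, Submodule.mem_adjoint_iff]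
    intro x x' hx
    have h := (Submodule.mem_orthogonal _ _).1 hnR (φ ⟨(x, x'), hx⟩) ⟨_, rfl⟩
    rw [hφ, inner_sub_left, inner_smul_left, hm, Complex.conj_conj] at h
    simpa [inner_smul_right] using h
  have hlm : l - m ≠ 0 := fun h => hl (by
    have := Complex.conj_eq_iff_im.1 (sub_eq_zero.1 h).symm
    exact this)
  have hg : (l - m)⁻¹ • n ∈ defectSubspace A l := Submodule.smul_mem _ _ hnd
  set g := (l - m)⁻¹ • n with hgdef
  have hq : p - a.1 - (g, l • g) ∈ A.adjoint :=
    sub_mem (sub_mem hp (hA.2 a.2)) (mem_defectSubspace.1 hg)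
  have hq2 : (p - a.1 - (g, l • g)).2 = m • (p - a.1 - (g, l • g)).1 := by
    have e1 : a.1.2 - m • a.1.1 = R.starProjection (p.2 - m • p.1) := ha
    have e2 : (l - m) • g = n := smul_inv_smul₀ hlm n
    rw [← sub_eq_zero]
    simp only [Prod.snd_sub, Prod.fst_sub]
    have e3 : p.2 - a.1.2 - l • g - m • (p.1 - a.1.1 - g)
        = (p.2 - m • p.1) - (a.1.2 - m • a.1.1) - (l - m) • g := by
      simp only [smul_sub, sub_smul]
      abel
    rw [e3, e1, e2, hn, sub_self]
  refine ⟨a.1, a.2, g, hg, (p - a.1 - (g, l • g)).1, ?_, ?_⟩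
  · rw [mem_defectSubspace, ← hq2]
    exact hq
  · have : ((p - a.1 - (g, l • g)).1, m • (p - a.1 - (g, l • g)).1) = p - a.1 - (g, l • g) :=
      Prod.ext rfl hq2.symm
    rw [this]
    abel

/-- The embedding `f ↦ {f, l f}` of the defect subspace into the adjoint relation. -/
noncomputable def defectEmbedding (A : Submodule ℂ (H × H)) (l : ℂ) :
    defectSubspace A l →ₗ[ℂ] A.adjoint :=
  LinearMap.codRestrict A.adjoint ((LinearMap.id.prod (l • LinearMap.id)) ∘ₗ
    (defectSubspace A l).subtype) fun f => f.2

/-- The deficiency indices of `A` are the indices of inertia of the form `-i ((f', g) - (f, g'))` on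
`A* / A`, represented on a finite-dimensional space `V` of boundary values: the form is positive
on `ker (A* - l)` for `Im l > 0` and negative for `Im l < 0`, and these subspaces span `A* / A`. -/
theorem IsSymmetricRelation.defectNumber_eq [CompleteSpace H] {A : Submodule ℂ (H × H)}
    (hA : IsSymmetricRelation A) {V : Type*} [AddCommGroup V] [Module ℂ V] [FiniteDimensional ℂ V]
    {q : V → ℝ} {m n : ℕ} (hq : HasSignature q m n) (G : A.adjoint →ₗ[ℂ] V)
    (hG : Function.Surjective G) (hGA : ∀ p : A.adjoint, p.1 ∈ A → G p = 0)
    (hGq : ∀ p : A.adjoint,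
      (-Complex.I * (inner ℂ p.1.1 p.1.2 - inner ℂ p.1.2 p.1.1)).re = q (G p)) {l : ℂ} :
    (0 < l.im → defectNumber A l = m) ∧ (l.im < 0 → defectNumber A l = n) := by
  have hform : ∀ (l : ℂ) (f : defectSubspace A l),
      q (G (defectEmbedding A l f)) = 2 * l.im * ‖f‖ ^ 2 := by
    intro l f
    rw [← hGq]
    change (-Complex.I * (inner ℂ f.1 (l • f.1) - inner ℂ (l • f.1) f.1)).re = _
    rw [inner_smul_left, inner_smul_right, inner_self_eq_norm_sq_to_K]
    simp only [Complex.coe_algebraMap, ← Complex.ofReal_pow, Complex.mul_re, Complex.mul_im,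
      Complex.sub_re, Complex.sub_im, Complex.neg_re, Complex.neg_im, Complex.I_re, Complex.I_im,
      Complex.conj_re, Complex.conj_im, Complex.ofReal_re, Complex.ofReal_im, Submodule.coe_norm]
    ring
  have hpos : ∀ l : ℂ, 0 < l.im → FiniteDimensional ℂ (defectSubspace A l) ∧
      Module.finrank ℂ (defectSubspace A l) ≤ m := fun l hl =>
    hq.finrank_le (G ∘ₗ defectEmbedding A l) fun f hf => by
      rw [LinearMap.comp_apply, hform]
      have : 0 < ‖f‖ := norm_pos_iff.2 hf
      positivity
  have hneg : ∀ l : ℂ, l.im < 0 → FiniteDimensional ℂ (defectSubspace A l) ∧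
      Module.finrank ℂ (defectSubspace A l) ≤ n := fun l hl =>
    hq.neg.finrank_le (G ∘ₗ defectEmbedding A l) fun f hf => by
      rw [LinearMap.comp_apply, hform]
      have h1 : 0 < ‖f‖ ^ 2 := pow_pos (norm_pos_iff.2 hf) 2
      nlinarith
  have key : ∀ l : ℂ, 0 < l.im → defectNumber A l = m ∧
      defectNumber A (starRingEnd ℂ l) = n := by
    intro l hl
    have hl' : (starRingEnd ℂ l).im < 0 := by rw [Complex.conj_im]; linarith
    obtain ⟨hf1, hle1⟩ := hpos l hl
    obtain ⟨hf2, hle2⟩ := hneg _ hl'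
    let Φ : (defectSubspace A l × defectSubspace A (starRingEnd ℂ l)) →ₗ[ℂ] V :=
      (G ∘ₗ defectEmbedding A l).coprod (G ∘ₗ defectEmbedding A (starRingEnd ℂ l))
    have hΦ : Function.Surjective Φ := by
      intro v
      obtain ⟨p, rfl⟩ := hG v
      obtain ⟨a, ha, g, hg, h, hh, hp⟩ := hA.exists_eq_add_add hl.ne' p.2
      refine ⟨(⟨g, hg⟩, ⟨h, hh⟩), ?_⟩
      have hp' : p = ⟨a, hA.2 ha⟩ + defectEmbedding A l ⟨g, hg⟩
          + defectEmbedding A (starRingEnd ℂ l) ⟨h, hh⟩ := Subtype.ext hp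
      rw [hp', map_add, map_add, hGA ⟨a, hA.2 ha⟩ ha, zero_add]
      rfl
    have hle := LinearMap.finrank_le_finrank_of_surjective hΦ
    rw [Module.finrank_prod, hq.2.1] at hle
    unfold defectNumber
    rw [toENat_rank_eq_finrank, toENat_rank_eq_finrank]
    constructor <;> congr 1 <;> omega
  refine ⟨fun hl => (key l hl).1, fun hl => ?_⟩
  have := (key (starRingEnd ℂ l) (by rw [Complex.conj_im]; linarith)).2
  rwa [Complex.conj_conj] at this

end Relation

/-! ### The form of a boundary triplet -/

section TripletForm

variable {𝓗 : Type*} [NormedAddCommGroup 𝓗] [InnerProductSpace ℂ 𝓗] [FiniteDimensional ℂ 𝓗]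
  (Hb : Submodule ℂ 𝓗)

/-- The skew-Hermitian form `(v₀, w₁) - (v₁, w₀) + i (P v₀, P w₀)` on `𝓗 ⊕ 𝓗_b`, where `P` is the
projection onto the orthogonal complement of `𝓗_b`. -/
noncomputable def tripletForm (v w : 𝓗 × Hb) : ℂ :=
  inner ℂ (w.2 : 𝓗) v.1 - inner ℂ w.1 (v.2 : 𝓗)
    + Complex.I * inner ℂ (Hbᗮ.starProjection w.1) (Hbᗮ.starProjection v.1)

variable {Hb}

theorem tripletForm_swap (v w : 𝓗 × Hb) :
    tripletForm Hb w v = -starRingEnd ℂ (tripletForm Hb v w) := by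
  simp only [tripletForm, map_add, map_sub, map_mul, inner_conj_symm, Complex.conj_I]
  ring

theorem starProjection_orthogonal_coe (b : Hb) : Hbᗮ.starProjection (b : 𝓗) = 0 :=
  Submodule.starProjection_orthogonal_apply_eq_zero b.2

theorem eq_zero_of_tripletForm {v : 𝓗 × Hb} (h : ∀ w, tripletForm Hb v w = 0) : v = 0 := by
  have h1 : v.1 ∈ Hbᗮ := (Submodule.mem_orthogonal _ _).2 fun b hb => by
    have := h (0, ⟨b, hb⟩)
    simpa [tripletForm] using this
  have h2 : Hbᗮ.starProjection v.1 = v.1 := Submodule.starProjection_eq_self_iff.2 h1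
  have h3 : v.1 = 0 := by
    have := h (v.1, 0)
    have h4 : inner ℂ v.1 (v.2 : 𝓗) = 0 := (Submodule.mem_orthogonal' _ _).1 h1 _ v.2.2
    simpa [tripletForm, h2, h4] using this
  have h4 : (v.2 : 𝓗) = 0 := by
    have := h ((v.2 : 𝓗), 0)
    simpa [tripletForm, h3] using this
  exact Prod.ext h3 (Subtype.ext h4)

/-- The orthogonal complement with respect to `tripletForm` of the subspace `v₀ = 0` is given by
`w₀ ∈ 𝓗_bᗮ`, and conversely (`mem_ker_fst_iff_tripletForm`); they coincide only if `𝓗_b = 𝓗`. -/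
theorem mem_orthogonal_iff_tripletForm (w : 𝓗 × Hb) :
    (w.1 ∈ Hbᗮ) ↔ ∀ v ∈ LinearMap.ker (LinearMap.fst ℂ 𝓗 Hb), tripletForm Hb v w = 0 := by
  rw [Submodule.mem_orthogonal']
  constructor
  · rintro h ⟨v₀, v₁⟩ (rfl : v₀ = 0)
    have := h v₁ v₁.2
    simp [tripletForm, this]
  · intro h b hb
    simpa [tripletForm] using h (0, ⟨b, hb⟩) rfl

theorem mem_ker_fst_iff_tripletForm (w : 𝓗 × Hb) :
    (w ∈ LinearMap.ker (LinearMap.fst ℂ 𝓗 Hb)) ↔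
      ∀ v ∈ Hbᗮ.comap (LinearMap.fst ℂ 𝓗 Hb), tripletForm Hb v w = 0 := by
  constructor
  · rintro (h : w.1 = 0) v (hv : v.1 ∈ Hbᗮ)
    have := (Submodule.mem_orthogonal _ _).1 hv _ w.2.2
    simp [tripletForm, h, this]
  · intro h
    change w.1 = 0
    have h1 : w.1 ∈ Hbᗮ := (Submodule.mem_orthogonal' _ _).2 fun b hb => by
      have := h (0, ⟨b, hb⟩) (zero_mem Hbᗮ)
      simpa [tripletForm] using this
    have h2 : Hbᗮ.starProjection w.1 = w.1 := Submodule.starProjection_eq_self_iff.2 h1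
    have h3 := h (w.1, 0) h1
    have h4 : inner ℂ (w.2 : 𝓗) w.1 = 0 := (Submodule.mem_orthogonal _ _).1 h1 _ w.2.2
    simpa [tripletForm, h2, h4] using h3

/-- The form is positive on the vectors `(a, -i Q a)`, with `Q` the projection onto `𝓗_b`, and
negative on the vectors `(b, i b)`. -/
theorem hasSignature_tripletForm :
    HasSignature (fun v : 𝓗 × Hb => (tripletForm Hb v v).im) (Module.finrank ℂ 𝓗)
      (Module.finrank ℂ Hb) := by
  refine HasSignature.of_linearMap (by simp [tripletForm]) Module.finrank_prod
    (LinearMap.id.prod (-Complex.I • (Hb.orthogonalProjectionOnto : 𝓗 →ₗ[ℂ] Hb))) (fun a ha => ?_)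
    (Hb.subtype.prod (Complex.I • LinearMap.id)) fun b hb => ?_
  · set Q : Hb := Hb.orthogonalProjectionOnto a with hQ
    set P : 𝓗 := Hbᗮ.starProjection a with hP
    have hsum : (Q : 𝓗) + P = a := Hb.starProjection_add_starProjection_orthogonal a
    have hPm : P ∈ Hbᗮ := Submodule.starProjection_apply_mem _ _
    have hQP : inner ℂ (Q : 𝓗) P = 0 := (Submodule.mem_orthogonal _ _).1 hPm _ Q.2
    have hQa : inner ℂ (Q : 𝓗) a = (‖Q‖ ^ 2 : ℝ) := by
      rw [← hsum, inner_add_right, hQP, add_zero, inner_self_eq_norm_sq_to_K]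
      simp
    have haQ : inner ℂ a (Q : 𝓗) = (‖Q‖ ^ 2 : ℝ) := by
      rw [← inner_conj_symm, hQa, Complex.conj_ofReal]
    have hval : (tripletForm Hb (a, -Complex.I • Q) (a, -Complex.I • Q)).im
        = 2 * ‖Q‖ ^ 2 + ‖P‖ ^ 2 := by
      simp only [tripletForm, Submodule.coe_smul, inner_smul_left, inner_smul_right, hQa, haQ,
        ← hP, inner_self_eq_norm_sq_to_K]
      simp [← Complex.ofReal_pow]
      ring
    change 0 < (tripletForm Hb (a, -Complex.I • Q) (a, -Complex.I • Q)).im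
    rw [hval]
    by_contra hle
    have h1 : ‖Q‖ = 0 := by nlinarith [sq_nonneg ‖Q‖, sq_nonneg ‖P‖]
    have h2 : ‖P‖ = 0 := by nlinarith [sq_nonneg ‖Q‖, sq_nonneg ‖P‖]
    refine ha ?_
    rw [← hsum, norm_eq_zero.1 h1, norm_eq_zero.1 h2, Submodule.coe_zero, add_zero]
  · have hval : (tripletForm Hb ((b : 𝓗), Complex.I • b) ((b : 𝓗), Complex.I • b)).im
        = -(2 * ‖b‖ ^ 2) := by
      simp only [tripletForm, Submodule.coe_smul, inner_smul_left, inner_smul_right,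
        starProjection_orthogonal_coe, inner_self_eq_norm_sq_to_K]
      simp [← Complex.ofReal_pow]
      ring
    change (tripletForm Hb ((b : 𝓗), Complex.I • b) ((b : 𝓗), Complex.I • b)).im < 0
    rw [hval]
    have : 0 < ‖b‖ := norm_pos_iff.2 hb
    nlinarith

theorem hasSignature_norm_sq {K : Type*} [NormedAddCommGroup K] [InnerProductSpace ℂ K] :
    HasSignature (fun k : K => ‖k‖ ^ 2) (Module.finrank ℂ K) 0 := by
  have h := HasSignature.of_linearMap (q := fun k : K => ‖k‖ ^ 2) (B := (⊥ : Submodule ℂ K))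
    (by simp) (by rw [finrank_bot, add_zero]) LinearMap.id (fun a ha => by
      have : 0 < ‖a‖ := norm_pos_iff.2 ha
      simpa using by positivity) 0 (fun b hb => (hb (Subsingleton.elim _ _)).elim)
  rwa [finrank_bot] at h

end TripletForm

/-! ### The boundary operator at the end `a` -/

theorem inner_triJ_swap {H K : Type*} [NormedAddCommGroup H] [InnerProductSpace ℂ H]
    [NormedAddCommGroup K] [InnerProductSpace ℂ K] (x z : Tri H K) :
    inner ℂ z (triJ H K x) = -inner ℂ (triJ H K z) x := by
  simp only [WithLp.prod_inner_apply]
  change inner ℂ z.fst (-x.snd.snd) + (inner ℂ z.snd.fst (Complex.I • x.snd.fst)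
    + inner ℂ z.snd.snd x.fst) = -(inner ℂ (-z.snd.snd) x.fst
    + (inner ℂ (Complex.I • z.snd.fst) x.snd.fst + inner ℂ z.fst x.snd.snd))
  simp only [inner_neg_left, inner_neg_right, inner_smul_left, inner_smul_right, Complex.conj_I]
  ring

namespace BoundaryOperator

variable {H K : Type*}
  [NormedAddCommGroup H] [InnerProductSpace ℂ H] [FiniteDimensional ℂ H]
  [NormedAddCommGroup K] [InnerProductSpace ℂ K] [FiniteDimensional ℂ K]
  (U : BoundaryOperator H K)

/-- The first row `Û = (u₁ u₂ u₃)` of `U`. -/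
noncomputable def hat : Tri H K →ₗ[ℂ] K :=
  U.u₁ ∘ₗ WithLp.fstₗ 2 ℂ H (WithLp 2 (K × H))
    + U.u₂ ∘ₗ WithLp.fstₗ 2 ℂ K H ∘ₗ WithLp.sndₗ 2 ℂ H (WithLp 2 (K × H))
    + U.u₃ ∘ₗ WithLp.sndₗ 2 ℂ K H ∘ₗ WithLp.sndₗ 2 ℂ H (WithLp 2 (K × H))

/-- The second row `U₁ = (u₄ u₅ u₆)` of `U`. -/
noncomputable def one : Tri H K →ₗ[ℂ] H :=
  U.u₄ ∘ₗ WithLp.fstₗ 2 ℂ H (WithLp 2 (K × H))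
    + U.u₅ ∘ₗ WithLp.fstₗ 2 ℂ K H ∘ₗ WithLp.sndₗ 2 ℂ H (WithLp 2 (K × H))
    + U.u₆ ∘ₗ WithLp.sndₗ 2 ℂ K H ∘ₗ WithLp.sndₗ 2 ℂ H (WithLp 2 (K × H))

theorem hat_apply (x : Tri H K) : U.hat x = U.u₁ x.fst + U.u₂ x.snd.fst + U.u₃ x.snd.snd := rfl

theorem one_apply (x : Tri H K) : U.one x = U.u₄ x.fst + U.u₅ x.snd.fst + U.u₆ x.snd.snd := rfl

/-- The vector `J Û* k`. -/
noncomputable def hatLift (k : K) : Tri H K :=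
  WithLp.toLp 2 (-U.u₃.adjoint k, WithLp.toLp 2 (Complex.I • U.u₂.adjoint k, U.u₁.adjoint k))

/-- The vector `J U₁* h`. -/
noncomputable def oneLift : H →ₗ[ℂ] Tri H K where
  toFun h :=
    WithLp.toLp 2 (-U.u₆.adjoint h, WithLp.toLp 2 (Complex.I • U.u₅.adjoint h, U.u₄.adjoint h))
  map_add' h h' := by
    simp only [map_add, neg_add, smul_add]
    rfl
  map_smul' c h := by
    simp only [map_smul, ← smul_neg, smul_comm Complex.I c]
    rfl

theorem hat_hatLift (k : K) : U.hat (U.hatLift k) = Complex.I • k := by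
  have h := LinearMap.congr_fun U.rel₁ k
  simp only [LinearMap.add_apply, LinearMap.sub_apply, LinearMap.smul_apply, LinearMap.comp_apply,
    LinearMap.id_apply] at h
  rw [← h, hat_apply]
  change U.u₁ (-U.u₃.adjoint k) + U.u₂ (Complex.I • U.u₂.adjoint k) + U.u₃ (U.u₁.adjoint k) = _
  rw [map_neg, map_smul]
  abel

theorem one_hatLift (k : K) : U.one (U.hatLift k) = 0 := by
  have h := LinearMap.congr_fun U.rel₂ k
  simp only [LinearMap.add_apply, LinearMap.sub_apply, LinearMap.smul_apply, LinearMap.comp_apply,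
    LinearMap.zero_apply] at h
  rw [← h, one_apply]
  change U.u₄ (-U.u₃.adjoint k) + U.u₅ (Complex.I • U.u₂.adjoint k) + U.u₆ (U.u₁.adjoint k) = _
  rw [map_neg, map_smul]
  abel

theorem one_oneLift (h : H) : U.one (U.oneLift h) = 0 := by
  have h' := LinearMap.congr_fun U.rel₃ h
  simp only [LinearMap.add_apply, LinearMap.sub_apply, LinearMap.smul_apply, LinearMap.comp_apply,
    LinearMap.zero_apply] at h'
  rw [← h', one_apply]
  change U.u₄ (-U.u₆.adjoint h) + U.u₅ (Complex.I • U.u₅.adjoint h) + U.u₆ (U.u₄.adjoint h) = _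
  rw [map_neg, map_smul]
  abel

theorem inner_triJ_hatLift (z : Tri H K) (k : K) :
    inner ℂ z (triJ H K (U.hatLift k)) = -inner ℂ (U.hat z) k := by
  rw [hat_apply, inner_add_left, inner_add_left, ← LinearMap.adjoint_inner_right,
    ← LinearMap.adjoint_inner_right, ← LinearMap.adjoint_inner_right, WithLp.prod_inner_apply,
    WithLp.prod_inner_apply]
  change inner ℂ z.fst (-U.u₁.adjoint k) + (inner ℂ z.snd.fst
    (Complex.I • Complex.I • U.u₂.adjoint k) + inner ℂ z.snd.snd (-U.u₃.adjoint k)) = _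
  rw [smul_smul, Complex.I_mul_I, neg_one_smul, inner_neg_right, inner_neg_right, inner_neg_right]
  ring

theorem inner_triJ_oneLift (z : Tri H K) (h : H) :
    inner ℂ z (triJ H K (U.oneLift h)) = -inner ℂ (U.one z) h := by
  rw [one_apply, inner_add_left, inner_add_left, ← LinearMap.adjoint_inner_right,
    ← LinearMap.adjoint_inner_right, ← LinearMap.adjoint_inner_right, WithLp.prod_inner_apply,
    WithLp.prod_inner_apply]
  change inner ℂ z.fst (-U.u₄.adjoint h) + (inner ℂ z.snd.fst
    (Complex.I • Complex.I • U.u₅.adjoint h) + inner ℂ z.snd.snd (-U.u₆.adjoint h)) = _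
  rw [smul_smul, Complex.I_mul_I, neg_one_smul, inner_neg_right, inner_neg_right, inner_neg_right]
  ring

theorem hat_oneLift (h : H) : U.hat (U.oneLift h) = 0 := by
  refine ext_inner_right ℂ fun k => ?_
  have h1 : starRingEnd ℂ (inner ℂ (U.oneLift h) (triJ H K (U.hatLift k)))
      = -inner ℂ (U.hatLift k) (triJ H K (U.oneLift h)) := by
    rw [inner_conj_symm, inner_triJ_swap _ (U.hatLift k), neg_neg]
  rw [inner_triJ_hatLift, inner_triJ_oneLift, one_hatLift, inner_zero_left, neg_zero, neg_zero,
    map_neg, neg_eq_zero, map_eq_zero] at h1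
  rw [h1, inner_zero_left]

theorem finrank_tri :
    Module.finrank ℂ (Tri H K)
      = Module.finrank ℂ H + (Module.finrank ℂ H + Module.finrank ℂ K) := by
  rw [(WithLp.linearEquiv 2 ℂ (H × WithLp 2 (K × H))).finrank_eq, Module.finrank_prod,
    (WithLp.linearEquiv 2 ℂ (K × H)).finrank_eq, Module.finrank_prod]
  ring

/-- The common null space of the rows of `U` is the range of `J U₁*`, by a dimension count. -/
theorem exists_oneLift_eq {x : Tri H K} (h : U.hat x = 0) (h1 : U.one x = 0) :
    ∃ e, U.oneLift e = x := by
  let Φ : Tri H K →ₗ[ℂ] K × H := U.hat.prod U.one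
  have hΦ : Function.Surjective Φ := by
    rintro ⟨k, e⟩
    obtain ⟨x₀, x, x₁, h1, h2⟩ := U.surj k e
    exact ⟨WithLp.toLp 2 (x₀, WithLp.toLp 2 (x, x₁)), Prod.ext h1 h2⟩
  have hdim : Module.finrank ℂ (LinearMap.ker Φ) = Module.finrank ℂ H := by
    have := Φ.finrank_range_add_finrank_ker
    rw [LinearMap.range_eq_top.2 hΦ, finrank_top, Module.finrank_prod, finrank_tri] at this
    omega
  have hinj : Function.Injective U.oneLift := (injective_iff_map_eq_zero _).2 fun e he => by
    obtain ⟨x₀, x, x₁, -, h2⟩ := U.surj 0 e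
    have h3 := U.inner_triJ_oneLift (WithLp.toLp 2 (x₀, WithLp.toLp 2 (x, x₁))) e
    have h4 : triJ H K (0 : Tri H K) = 0 := by
      refine (WithLp.ofLp_injective 2) (Prod.ext ?_ ((WithLp.ofLp_injective 2) (Prod.ext ?_ ?_)))
      · exact neg_zero
      · exact smul_zero _
      · rfl
    have h5 : U.one (WithLp.toLp 2 (x₀, WithLp.toLp 2 (x, x₁))) = e := h2
    rw [he, h4, inner_zero_right, h5] at h3
    exact inner_self_eq_zero.1 (neg_eq_zero.1 h3.symm)
  have hle : LinearMap.range U.oneLift ≤ LinearMap.ker Φ := by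
    rintro _ ⟨e, rfl⟩
    exact Prod.ext (U.hat_oneLift e) (U.one_oneLift e)
  have heq := Submodule.eq_of_le_of_finrank_eq hle
    (by rw [LinearMap.finrank_range_of_inj hinj, hdim])
  have hx : x ∈ LinearMap.ker Φ := Prod.ext h h1
  rw [← heq] at hx
  exact hx

/-- On the null space of `U₁`, the form `(J x, z)` is `i (Û x, Û z)`. -/
theorem inner_triJ_of_one_eq_zero {x z : Tri H K} (hx : U.one x = 0) (hz : U.one z = 0) :
    inner ℂ z (triJ H K x) = Complex.I * inner ℂ (U.hat z) (U.hat x) := by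
  obtain ⟨e, he⟩ := U.exists_oneLift_eq (x := x - U.hatLift (-Complex.I • U.hat x))
    (by rw [map_sub, hat_hatLift, smul_smul]; simp) (by rw [map_sub, one_hatLift, hx, sub_zero])
  have hxe : x = U.oneLift e + U.hatLift (-Complex.I • U.hat x) := by rw [he, sub_add_cancel]
  have hadd : ∀ u v : Tri H K, inner ℂ z (triJ H K (u + v))
      = inner ℂ z (triJ H K u) + inner ℂ z (triJ H K v) := fun u v => by
    rw [inner_triJ_swap, inner_triJ_swap, inner_triJ_swap, inner_add_right]
    ring
  conv_lhs => rw [hxe]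
  rw [hadd, inner_triJ_oneLift, inner_triJ_hatLift, hz, inner_zero_left, inner_smul_right]
  ring

/-- The form `i (J x, x)` is positive on the vectors `{h, 0, i h}` and negative on
`{h, k, -i h}`. -/
theorem hasSignature_triJ :
    HasSignature (fun x : Tri H K => -(inner ℂ x (triJ H K x)).im) (Module.finrank ℂ H)
      (Module.finrank ℂ H + Module.finrank ℂ K) := by
  have hval : ∀ (c : ℝ) (h : H) (k : K),
      (inner ℂ (WithLp.toLp 2 (h, WithLp.toLp 2 (k, (c * Complex.I) • h)) : Tri H K)
        (triJ H K (WithLp.toLp 2 (h, WithLp.toLp 2 (k, (c * Complex.I) • h))))).im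
      = -2 * c * ‖h‖ ^ 2 + ‖k‖ ^ 2 := by
    intro c h k
    rw [WithLp.prod_inner_apply, WithLp.prod_inner_apply]
    change (inner ℂ h (-((c * Complex.I) • h)) + (inner ℂ k (Complex.I • k)
      + inner ℂ ((c * Complex.I) • h) h)).im = _
    simp only [inner_neg_right, inner_smul_left, inner_smul_right, inner_self_eq_norm_sq_to_K]
    simp [← Complex.ofReal_pow]
    ring
  have h0 : (inner ℂ (0 : Tri H K) (triJ H K (0 : Tri H K))).im = 0 := by
    rw [inner_zero_left, Complex.zero_im]
  rw [← Module.finrank_prod]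
  let F : ℝ → (H × K) →ₗ[ℂ] Tri H K := fun c =>
    (WithLp.linearEquiv 2 ℂ (H × WithLp 2 (K × H))).symm.toLinearMap ∘ₗ
      (LinearMap.fst ℂ H K).prod ((WithLp.linearEquiv 2 ℂ (K × H)).symm.toLinearMap ∘ₗ
        (LinearMap.snd ℂ H K).prod ((c * Complex.I) • LinearMap.fst ℂ H K))
  have hF : ∀ c p, F c p = WithLp.toLp 2 (p.1, WithLp.toLp 2 (p.2, (c * Complex.I) • p.1)) :=
    fun _ _ => rfl
  refine HasSignature.of_linearMap (by rw [h0, neg_zero])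
    (by rw [finrank_tri, Module.finrank_prod]) (F 1 ∘ₗ LinearMap.inl ℂ H K) (fun h hh => ?_)
    (F (-1)) fun p hp => ?_
  · have : 0 < ‖h‖ := norm_pos_iff.2 hh
    rw [LinearMap.comp_apply, hF, hval]
    simp only [LinearMap.inl_apply, norm_zero]
    nlinarith
  · rw [hF, hval]
    by_contra hle
    have h1 : ‖p.1‖ = 0 := by nlinarith [sq_nonneg ‖p.1‖, sq_nonneg ‖p.2‖]
    have h2 : ‖p.2‖ = 0 := by nlinarith [sq_nonneg ‖p.1‖, sq_nonneg ‖p.2‖]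
    exact hp (Prod.ext (norm_eq_zero.1 h1) (norm_eq_zero.1 h2))

end BoundaryOperator

/-! ### Relations given by boundary conditions -/

namespace SymmetricSystem

section Representatives

variable {E : Type*} [NormedAddCommGroup E] [InnerProductSpace ℂ E] {S : SymmetricSystem E}

/-- For a definite system, the class `{ỹ, f̃}` of an element of `tmax` determines `y`. -/
theorem IsDefinite.eq_of_quot_eq (hdef : S.IsDefinite) {y f y' f' : S.PreL2}
    (h : (y, f) ∈ S.tmax) (h' : (y', f') ∈ S.tmax) (e : S.quot (y, f) = S.quot (y', f')) :
    y = y' := by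
  obtain ⟨e1, e2⟩ := Prod.ext_iff.1 e
  have h1 : ∀ᵐ t ∂(volume.restrict S.I), S.Δ t (y.toFun t) = S.Δ t (y'.toFun t) :=
    mk_eq_mk_iff.1 e1
  have h2 : ∀ᵐ t ∂(volume.restrict S.I), S.Δ t (f.toFun t) = S.Δ t (f'.toFun t) :=
    mk_eq_mk_iff.1 e2
  have hm := S.tmax.sub_mem h h'
  rw [Prod.mk_sub_mk] at hm
  have hs : S.Solves (y - y').toFun (f - f').toFun := hm
  have h0 := hdef 0 (y - y').toFun (hs.congr (fun _ _ => rfl) (by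
      filter_upwards [h2] with t ht
      rw [map_sub, Pi.sub_apply, map_sub, ht, sub_self, zero_smul, map_zero])) (by
      filter_upwards [h1] with t ht
      rw [map_sub, Pi.sub_apply, map_sub, ht, sub_self])
  refine sub_eq_zero.1 (PreL2.toFun_injective ?_)
  funext t
  rw [map_zero]
  by_cases ht : t ∈ S.I
  · exact h0 t ht
  · exact PreL2.apply_of_notMem _ ht

/-- The linear map `{ỹ, f̃} ↦ y` on a restriction of the maximal relation. -/
theorem IsDefinite.exists_representative (hdef : S.IsDefinite) {R : Submodule ℂ (S.L2 × S.L2)}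
    (hR : ∀ p ∈ R, ∃ q ∈ S.tmax, S.quot q = p) :
    ∃ r : R →ₗ[ℂ] S.domTmax, ∀ (y f : S.PreL2) (h : (y, f) ∈ S.tmax) (hm : S.quot (y, f) ∈ R),
      r ⟨S.quot (y, f), hm⟩ = ⟨y, S.mem_domTmax h⟩ := by
  choose q hq hqp using fun p : R => hR p p.2
  have huniq : ∀ (p : R) (y f : S.PreL2), (y, f) ∈ S.tmax → S.quot (y, f) = p → (q p).1 = y :=
    fun p y f h e => hdef.eq_of_quot_eq (hq p) h ((hqp p).trans e.symm)
  refine ⟨⟨⟨fun p => ⟨(q p).1, S.mem_domTmax (hq p)⟩, fun p p' => Subtype.ext ?_⟩,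
    fun c p => Subtype.ext ?_⟩, fun y f h hm => Subtype.ext (huniq _ _ _ h rfl)⟩
  · refine huniq (p + p') (q p + q p').1 (q p + q p').2 (add_mem (hq p) (hq p')) ?_
    rw [Prod.mk.eta, map_add, hqp, hqp]
    rfl
  · refine huniq (c • p) (c • q p).1 (c • q p).2 (Submodule.smul_mem _ c (hq p)) ?_
    rw [Prod.mk.eta, map_smul, hqp]
    rfl

theorem relationOf_mono {D D' : Submodule ℂ S.domTmax} (h : D ≤ D') :
    S.relationOf D ≤ S.relationOf D' := fun p hp => by
  rw [mem_relationOf] at hp ⊢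
  obtain ⟨y, f, hyf, hD, e⟩ := hp
  exact ⟨y, f, hyf, h hD, e⟩

theorem exists_tmax_of_mem_relationOf {D : Submodule ℂ S.domTmax} (p : S.L2 × S.L2)
    (hp : p ∈ S.relationOf D) : ∃ q ∈ S.tmax, S.quot q = p := by
  obtain ⟨y, f, hyf, -, e⟩ := mem_relationOf.1 hp
  exact ⟨(y, f), hyf, e⟩

/-- The Green identity in `L²_Δ(I)`. -/
theorem inner_quot_sub_inner_quot [CompleteSpace E] {y f z g : S.PreL2} (hy : (y, f) ∈ S.tmax)
    (hz : (z, g) ∈ S.tmax) :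
    inner ℂ (S.quot (z, g)).1 (S.quot (y, f)).2 - inner ℂ (S.quot (z, g)).2 (S.quot (y, f)).1
      = S.boundaryForm ⟨y, S.mem_domTmax hy⟩ ⟨z, S.mem_domTmax hz⟩
        - inner ℂ (z.toFun S.a) (S.J (y.toFun S.a)) := by
  rw [boundaryForm_eq hy hz, add_sub_cancel_right]
  rfl

/-- The adjoint of a relation between `Tmin` and `Tmax` is given by the adjoint boundary
conditions. -/
theorem IsDefinite.adjoint_relationOf [FiniteDimensional ℂ E] [CompleteSpace E]
    (hdef : S.IsDefinite) {D D' : Submodule ℂ S.domTmax} (hD : S.domTmin ≤ D)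
    (h : ∀ z, z ∈ D' ↔
      ∀ y ∈ D, S.boundaryForm y z = inner ℂ (z.1.toFun S.a) (S.J (y.1.toFun S.a))) :
    (S.relationOf D).adjoint = S.relationOf D' := by
  have key : ∀ {y f z g : S.PreL2} (hy : (y, f) ∈ S.tmax) (hz : (z, g) ∈ S.tmax),
      inner ℂ (S.quot (y, f)).2 (S.quot (z, g)).1 - inner ℂ (S.quot (y, f)).1 (S.quot (z, g)).2 = 0
        ↔ S.boundaryForm ⟨y, S.mem_domTmax hy⟩ ⟨z, S.mem_domTmax hz⟩
          = inner ℂ (z.toFun S.a) (S.J (y.toFun S.a)) := by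
    intro y f z g hy hz
    have h1 := inner_quot_sub_inner_quot hy hz
    rw [← sub_eq_zero (b := inner ℂ (z.toFun S.a) (S.J (y.toFun S.a))), ← h1,
      ← map_eq_zero (starRingEnd ℂ), map_sub, inner_conj_symm, inner_conj_symm]
  ext p
  constructor
  · intro hp
    obtain ⟨⟨z, g⟩, hz, rfl⟩ := hdef.exists_tmax_of_mem_adjoint_Tmin
      (Submodule.adjoint_antitone (relationOf_mono hD) hp)
    refine mem_relationOf.2 ⟨z, g, hz, (h _).2 ?_, rfl⟩
    rintro ⟨y, ⟨⟨y', f⟩, hy, rfl⟩⟩ hyD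
    exact (key hy hz).1 ((Submodule.mem_adjoint_iff _ _).1 hp _ _
      (mem_relationOf.2 ⟨y', f, hy, hyD, rfl⟩))
  · intro hp
    obtain ⟨z, g, hz, hzD, rfl⟩ := mem_relationOf.1 hp
    rw [Submodule.mem_adjoint_iff]
    intro a b hab
    obtain ⟨y, f, hy, hyD, e⟩ := mem_relationOf.1 hab
    have := (key hy hz).2 ((h _).1 hzD _ hyD)
    rwa [e] at this

theorem relationOf_top : S.relationOf ⊤ = S.Tmax := by
  ext p
  rw [mem_relationOf]
  constructor
  · rintro ⟨y, f, h, -, e⟩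
    exact ⟨(y, f), h, e⟩
  · rintro ⟨⟨y, f⟩, h, e⟩
    exact ⟨y, f, h, Submodule.mem_top, e⟩

theorem IsDefinite.adjoint_Tmin [FiniteDimensional ℂ E] [CompleteSpace E] (hdef : S.IsDefinite) :
    S.Tmin.adjoint = S.Tmax := by
  rw [← relationOf_top]
  refine hdef.adjoint_relationOf le_rfl fun z => ⟨fun _ y hy => ?_, fun _ => Submodule.mem_top⟩
  obtain ⟨h1, h2⟩ := SymmetricSystem.mem_domTmin_iff.1 hy
  rw [h1, h2, map_zero, inner_zero_right]

end Representatives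

/-! ### Boundary maps representing the boundary form at `b` -/

section BoundaryMaps

variable {H K 𝓗 : Type*}
  [NormedAddCommGroup H] [InnerProductSpace ℂ H] [FiniteDimensional ℂ H]
  [NormedAddCommGroup K] [InnerProductSpace ℂ K] [FiniteDimensional ℂ K]
  [NormedAddCommGroup 𝓗] [InnerProductSpace ℂ 𝓗] [FiniteDimensional ℂ 𝓗]
  {S : SymmetricSystem (Tri H K)} {Hb : Submodule ℂ 𝓗}

/-- The map `(Γ, Γ̂) : dom tmax → (𝓗 ⊕ 𝓗_b) ⊕ Ĥ` is surjective and represents the form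
`[y, z]_b`. -/
structure IsBoundaryMap (S : SymmetricSystem (Tri H K)) (Γ : S.domTmax →ₗ[ℂ] 𝓗 × Hb)
    (Γh : S.domTmax →ₗ[ℂ] K) : Prop where
  surj : ∀ v k, ∃ y, Γ y = v ∧ Γh y = k
  form : ∀ y z : S.domTmax, S.boundaryForm y z
    = tripletForm Hb (Γ y) (Γ z) + Complex.I * inner ℂ (Γh z) (Γh y)

variable {Γ : S.domTmax →ₗ[ℂ] 𝓗 × Hb} {Γh : S.domTmax →ₗ[ℂ] K}

theorem IsBoundaryMap.boundaryForm_eq_zero_iff (hΓ : IsBoundaryMap S Γ Γh) {y : S.domTmax} :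
    (∀ z, S.boundaryForm y z = 0) ↔ Γ y = 0 ∧ Γh y = 0 := by
  constructor
  · intro h
    constructor
    · refine eq_zero_of_tripletForm fun w => ?_
      obtain ⟨z, hz, hz'⟩ := hΓ.surj w 0
      have := h z
      rwa [hΓ.form, hz, hz', inner_zero_left, mul_zero, add_zero] at this
    · obtain ⟨z, hz, hz'⟩ := hΓ.surj 0 (Γh y)
      have := h z
      rw [hΓ.form, hz, hz'] at this
      simpa [tripletForm] using this
  · rintro ⟨h1, h2⟩ z
    rw [hΓ.form, h1, h2]
    simp [tripletForm]

/-- The boundary conditions `Γ_{1a} y = 0`, `Γ̂_a y = Γ̂_b y`, `{Γ_{0b} y, Γ_{1b} y} ∈ L`. -/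
noncomputable def boundaryDomain (U : BoundaryOperator H K) (S : SymmetricSystem (Tri H K))
    (Γ : S.domTmax →ₗ[ℂ] 𝓗 × Hb) (Γh : S.domTmax →ₗ[ℂ] K) (L : Submodule ℂ (𝓗 × Hb)) :
    Submodule ℂ S.domTmax :=
  LinearMap.ker (U.gamma1A S) ⊓ LinearMap.ker (U.gammaHatA S - Γh) ⊓ L.comap Γ

theorem mem_boundaryDomain {U : BoundaryOperator H K} {L : Submodule ℂ (𝓗 × Hb)} {y : S.domTmax} :
    y ∈ boundaryDomain U S Γ Γh L ↔
      U.one (y.1.toFun S.a) = 0 ∧ U.hat (y.1.toFun S.a) = Γh y ∧ Γ y ∈ L := by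
  simp only [boundaryDomain, Submodule.mem_inf, LinearMap.mem_ker, Submodule.mem_comap,
    LinearMap.sub_apply, sub_eq_zero, and_assoc]
  rfl

/-- On functions satisfying the conditions at `a`, the boundary form reduces to `tripletForm`. -/
theorem IsBoundaryMap.boundaryForm_sub (hΓ : IsBoundaryMap S Γ Γh) (hJ : ∀ x, S.J x = triJ H K x)
    {U : BoundaryOperator H K} {L L' : Submodule ℂ (𝓗 × Hb)} {y z : S.domTmax}
    (hy : y ∈ boundaryDomain U S Γ Γh L) (hz : z ∈ boundaryDomain U S Γ Γh L') :
    S.boundaryForm y z - inner ℂ (z.1.toFun S.a) (S.J (y.1.toFun S.a))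
      = tripletForm Hb (Γ y) (Γ z) := by
  rw [mem_boundaryDomain] at hy hz
  rw [hΓ.form, hJ, U.inner_triJ_of_one_eq_zero hy.1 hz.1, hy.2.1, hz.2.1, add_sub_cancel_right]

/-- The indices of inertia of the boundary form at `b`. -/
theorem IsBoundaryMap.hasSignature :
    HasSignature (fun v : (𝓗 × Hb) × K => (tripletForm Hb v.1 v.1).im + ‖v.2‖ ^ 2)
      (Module.finrank ℂ 𝓗 + Module.finrank ℂ K) (Module.finrank ℂ Hb) :=
  hasSignature_tripletForm.prod hasSignature_norm_sq

theorem IsBoundaryMap.re_boundaryForm (hΓ : IsBoundaryMap S Γ Γh) (y : S.domTmax) :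
    (-Complex.I * S.boundaryForm y y).re = (tripletForm Hb (Γ y) (Γ y)).im + ‖Γh y‖ ^ 2 := by
  rw [hΓ.form, inner_self_eq_norm_sq_to_K]
  simp [← Complex.ofReal_pow]

theorem IsBoundaryMap.surjective_prod (hΓ : IsBoundaryMap S Γ Γh) :
    Function.Surjective (Γ.prod Γh) := fun p => by
  obtain ⟨y, h1, h2⟩ := hΓ.surj p.1 p.2
  exact ⟨y, Prod.ext h1 h2⟩

theorem IsBoundaryMap.nuBPlus_eq (hΓ : IsBoundaryMap S Γ Γh) :
    S.nuBPlus = ((Module.finrank ℂ 𝓗 + Module.finrank ℂ K : ℕ) : ℕ∞) :=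
  IsBoundaryMap.hasSignature.iSup_rank_eq hΓ.surjective_prod fun y => hΓ.re_boundaryForm y

theorem IsBoundaryMap.nuBMinus_eq (hΓ : IsBoundaryMap S Γ Γh) :
    S.nuBMinus = (Module.finrank ℂ Hb : ℕ∞) := by
  rw [← (IsBoundaryMap.hasSignature (K := K) (Hb := Hb)).neg.iSup_rank_eq hΓ.surjective_prod
    (F := fun y => -(-Complex.I * S.boundaryForm y y).re)
    fun y => congrArg Neg.neg (hΓ.re_boundaryForm y)]
  simp only [neg_pos]
  rfl

variable [CompleteSpace (Tri H K)]

theorem IsBoundaryMap.mem_domTmin_iff (hΓ : IsBoundaryMap S Γ Γh) {y : S.domTmax} :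
    y ∈ S.domTmin ↔ y.1.toFun S.a = 0 ∧ Γ y = 0 ∧ Γh y = 0 := by
  rw [SymmetricSystem.mem_domTmin_iff, hΓ.boundaryForm_eq_zero_iff]

/-- For a definite system the boundary values at `a` and at `b` are independent. -/
theorem IsBoundaryMap.exists_domTmax (hΓ : IsBoundaryMap S Γ Γh) (hdef : S.IsDefinite) (x : Tri H K)
    (v : 𝓗 × Hb) (k : K) : ∃ y : S.domTmax, y.1.toFun S.a = x ∧ Γ y = v ∧ Γh y = k := by
  obtain ⟨y, hy, hy'⟩ := hΓ.surj v k
  obtain ⟨w, hw, hwb⟩ := hdef.exists_domTmax_apply_a (x - y.1.toFun S.a)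
  obtain ⟨h1, h2⟩ := hΓ.boundaryForm_eq_zero_iff.1 hwb
  refine ⟨w + y, ?_, by rw [map_add, h1, hy, zero_add], by rw [map_add, h2, hy', zero_add]⟩
  rw [Submodule.coe_add, map_add, Pi.add_apply, hw, sub_add_cancel]

theorem IsBoundaryMap.domTmin_le (hΓ : IsBoundaryMap S Γ Γh) (U : BoundaryOperator H K)
    (L : Submodule ℂ (𝓗 × Hb)) : S.domTmin ≤ boundaryDomain U S Γ Γh L := fun y hy => by
  obtain ⟨h1, h2, h3⟩ := hΓ.mem_domTmin_iff.1 hy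
  rw [mem_boundaryDomain, h1, h2, h3, map_zero, map_zero]
  exact ⟨rfl, rfl, zero_mem _⟩

theorem IsBoundaryMap.adjoint_relationOf (hΓ : IsBoundaryMap S Γ Γh)
    (hJ : ∀ x, S.J x = triJ H K x) (hdef : S.IsDefinite) (U : BoundaryOperator H K)
    {L L' : Submodule ℂ (𝓗 × Hb)} (hL : ∀ w, w ∈ L' ↔ ∀ v ∈ L, tripletForm Hb v w = 0) :
    (S.relationOf (boundaryDomain U S Γ Γh L)).adjoint
      = S.relationOf (boundaryDomain U S Γ Γh L') := by
  refine hdef.adjoint_relationOf (hΓ.domTmin_le U L) fun z => ⟨fun hz y hy => ?_, fun hz => ?_⟩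
  · rw [← sub_eq_zero, hΓ.boundaryForm_sub hJ hy hz]
    exact (hL _).1 (mem_boundaryDomain.1 hz).2.2 _ (mem_boundaryDomain.1 hy).2.2
  · rw [mem_boundaryDomain]
    refine ⟨?_, ?_, (hL _).2 fun v hv => ?_⟩
    · obtain ⟨y, hya, hyv, hyk⟩ := hΓ.exists_domTmax hdef
        (U.oneLift (U.one (z.1.toFun S.a))) 0 0
      have h := hz y (mem_boundaryDomain.2 ⟨by rw [hya, U.one_oneLift],
        by rw [hya, U.hat_oneLift, hyk], by rw [hyv]; exact zero_mem _⟩)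
      rw [hΓ.form, hyv, hyk, hya, hJ, U.inner_triJ_oneLift] at h
      simpa [tripletForm] using h
    · refine ext_inner_right ℂ fun k => ?_
      obtain ⟨y, hya, hyv, hyk⟩ := hΓ.exists_domTmax hdef (U.hatLift k) 0 (Complex.I • k)
      have h := hz y (mem_boundaryDomain.2 ⟨by rw [hya, U.one_hatLift],
        by rw [hya, U.hat_hatLift, hyk], by rw [hyv]; exact zero_mem _⟩)
      rw [hΓ.form, hyv, hyk, hya, hJ, U.inner_triJ_hatLift, inner_smul_right, ← mul_assoc,
        Complex.I_mul_I] at h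
      have h' : -inner ℂ (Γh z) k = -inner ℂ (U.hat (z.1.toFun S.a)) k := by
        simpa [tripletForm] using h
      exact (neg_inj.1 h').symm
    · obtain ⟨y, hya, hyv, hyk⟩ := hΓ.exists_domTmax hdef 0 v 0
      have h := hz y (mem_boundaryDomain.2 ⟨by rw [hya, map_zero],
        by rw [hya, hyk, map_zero], by rw [hyv]; exact hv⟩)
      rwa [hΓ.form, hyv, hyk, hya, map_zero, inner_zero_right, inner_zero_right, mul_zero,
        add_zero] at h

end BoundaryMaps

end SymmetricSystem

/-! ### The boundary triplet and the deficiency indices -/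

namespace SymmetricSystem

variable {H K 𝓗 : Type*}
  [NormedAddCommGroup H] [InnerProductSpace ℂ H] [FiniteDimensional ℂ H]
  [NormedAddCommGroup K] [InnerProductSpace ℂ K] [FiniteDimensional ℂ K]
  [NormedAddCommGroup 𝓗] [InnerProductSpace ℂ 𝓗] [FiniteDimensional ℂ 𝓗]
  {S : SymmetricSystem (Tri H K)} {Hb : Submodule ℂ 𝓗} {Γ : S.domTmax →ₗ[ℂ] 𝓗 × Hb}
  {Γh : S.domTmax →ₗ[ℂ] K} [CompleteSpace (Tri H K)]

/-- The boundary map `Γ` induces a map on the relation `R` given by `Γ_{1a} y = 0`,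
`Γ̂_a y = Γ̂_b y` alone, which turns the Green identity into `tripletForm`. -/
theorem IsBoundaryMap.exists_boundaryValue (hΓ : IsBoundaryMap S Γ Γh)
    (hJ : ∀ x, S.J x = triJ H K x) (hdef : S.IsDefinite) (U : BoundaryOperator H K)
    {R : Submodule ℂ (S.L2 × S.L2)} (hR : R = S.relationOf (boundaryDomain U S Γ Γh ⊤)) :
    ∃ G : R →ₗ[ℂ] 𝓗 × Hb,
      (∀ (y f : S.PreL2) (h : (y, f) ∈ S.tmax) (hm : S.quot (y, f) ∈ R),
        G ⟨S.quot (y, f), hm⟩ = Γ ⟨y, S.mem_domTmax h⟩) ∧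
      Function.Surjective G ∧
      (∀ p q : R, inner ℂ q.1.1 p.1.2 - inner ℂ q.1.2 p.1.1 = tripletForm Hb (G p) (G q)) ∧
      ∀ (L : Submodule ℂ (𝓗 × Hb)) (p : R),
        p.1 ∈ S.relationOf (boundaryDomain U S Γ Γh L) ↔ G p ∈ L := by
  subst hR
  obtain ⟨r, hr⟩ := hdef.exists_representative exists_tmax_of_mem_relationOf
    (R := S.relationOf (boundaryDomain U S Γ Γh ⊤))
  refine ⟨Γ ∘ₗ r, fun y f h hm => congrArg Γ (hr y f h hm), fun v => ?_, ?_, fun L => ?_⟩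
  · obtain ⟨⟨y, ⟨⟨y', f⟩, h, rfl⟩⟩, hya, hyv, hyk⟩ := hΓ.exists_domTmax hdef 0 v 0
    refine ⟨⟨S.quot (y', f), mem_relationOf.2 ⟨y', f, h, mem_boundaryDomain.2
      ⟨(congrArg U.one hya).trans (map_zero _), ((congrArg U.hat hya).trans (map_zero _)).trans
        hyk.symm, Submodule.mem_top⟩, rfl⟩⟩, ?_⟩
    rw [← hyv]
    exact congrArg Γ (hr y' f h _)
  · rintro ⟨p, hp⟩ ⟨q, hq⟩
    obtain ⟨y, f, hy, hyD, rfl⟩ := mem_relationOf.1 hp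
    obtain ⟨z, g, hz, hzD, rfl⟩ := mem_relationOf.1 hq
    rw [LinearMap.comp_apply, LinearMap.comp_apply, hr y f hy hp, hr z g hz hq,
      ← hΓ.boundaryForm_sub hJ hyD hzD]
    exact inner_quot_sub_inner_quot hy hz
  · rintro ⟨p, hp⟩
    obtain ⟨y, f, hy, hyD, rfl⟩ := mem_relationOf.1 hp
    rw [LinearMap.comp_apply, hr y f hy hp]
    rw [mem_boundaryDomain] at hyD
    constructor
    · intro hp'
      obtain ⟨y', f', h', hD, e⟩ := mem_relationOf.1 hp'
      obtain rfl := hdef.eq_of_quot_eq h' hy e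
      exact (mem_boundaryDomain.1 hD).2.2
    · exact fun hL => mem_relationOf.2 ⟨y, f, hy, mem_boundaryDomain.2 ⟨hyD.1, hyD.2.1, hL⟩, rfl⟩

theorem IsBoundaryMap.isSymmetricRelation_Tmin (hΓ : IsBoundaryMap S Γ Γh)
    (hdef : S.IsDefinite) : IsSymmetricRelation S.Tmin := by
  have hadj : S.Tmin = S.Tmax.adjoint := by
    rw [← relationOf_top]
    refine (hdef.adjoint_relationOf le_top fun z => ⟨fun hz y _ => ?_, fun hz => ?_⟩).symm
    · obtain ⟨h1, h2, h3⟩ := hΓ.mem_domTmin_iff.1 hz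
      rw [hΓ.form, h1, h2, h3]
      simp [tripletForm]
    · have hza : z.1.toFun S.a = 0 := by
        refine ext_inner_right ℂ fun x => ?_
        obtain ⟨y, hya, hyv, hyk⟩ := hΓ.exists_domTmax hdef (-S.J x) 0 0
        have h := hz y Submodule.mem_top
        rw [hΓ.form, hyv, hyk, hya, map_neg, S.J_sq, neg_neg] at h
        rw [← h]
        simp [tripletForm]
      have hz' : ∀ y, S.boundaryForm y z = 0 := fun y => by
        rw [hz y Submodule.mem_top, hza, inner_zero_left]
      refine hΓ.mem_domTmin_iff.2 ⟨hza, eq_zero_of_tripletForm fun v => ?_, ?_⟩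
      · obtain ⟨y, hyv, hyk⟩ := hΓ.surj v 0
        have h := hz' y
        rw [hΓ.form, hyv, hyk, inner_zero_right, mul_zero, add_zero] at h
        rw [tripletForm_swap, h, map_zero, neg_zero]
      · obtain ⟨y, hyv, hyk⟩ := hΓ.surj 0 (Γh z)
        have h := hz' y
        rw [hΓ.form, hyv, hyk] at h
        simpa [tripletForm] using h
  refine ⟨hadj ▸ Submodule.isClosed_adjoint _, ?_⟩
  rw [hdef.adjoint_Tmin, ← relationOf_top]
  exact relationOf_mono le_top

/-- The deficiency indices of `Tmin` are the indices of inertia of `-i ([y, z]_b - (J y(a), z(a)))`,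
since the boundary values at `a` and `b` are independent. -/
theorem IsBoundaryMap.defectNumber_Tmin (hΓ : IsBoundaryMap S Γ Γh)
    (hJ : ∀ x, S.J x = triJ H K x) (hdef : S.IsDefinite) {l : ℂ} :
    (0 < l.im → defectNumber S.Tmin l = ((Module.finrank ℂ H
      + (Module.finrank ℂ 𝓗 + Module.finrank ℂ K) : ℕ) : ℕ∞)) ∧
    (l.im < 0 → defectNumber S.Tmin l = ((Module.finrank ℂ H + Module.finrank ℂ K
      + Module.finrank ℂ Hb : ℕ) : ℕ∞)) := by
  have hT : ∀ p ∈ S.Tmin.adjoint, ∃ q ∈ S.tmax, S.quot q = p :=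
    fun p hp => hdef.exists_tmax_of_mem_adjoint_Tmin hp
  obtain ⟨r, hr⟩ := hdef.exists_representative hT
  have hq := (BoundaryOperator.hasSignature_triJ (H := H) (K := K)).prod
    (IsBoundaryMap.hasSignature (K := K) (Hb := Hb))
  refine (hΓ.isSymmetricRelation_Tmin hdef).defectNumber_eq hq
    ((S.evalA.prod (Γ.prod Γh)) ∘ₗ r) ?_ ?_ ?_
  · rintro ⟨x, v, k⟩
    obtain ⟨⟨y, ⟨⟨y', f⟩, h, rfl⟩⟩, hya, hyv, hyk⟩ := hΓ.exists_domTmax hdef x v k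
    have hm : S.quot (y', f) ∈ S.Tmin.adjoint := by
      rw [hdef.adjoint_Tmin]
      exact ⟨(y', f), h, rfl⟩
    refine ⟨⟨_, hm⟩, ?_⟩
    rw [LinearMap.comp_apply, hr y' f h hm]
    exact Prod.ext hya (Prod.ext hyv hyk)
  · rintro ⟨p, hp⟩ hpT
    obtain ⟨y, f, h, hD, rfl⟩ := mem_relationOf.1 hpT
    obtain ⟨h1, h2, h3⟩ := hΓ.mem_domTmin_iff.1 hD
    rw [LinearMap.comp_apply, hr y f h hp]
    exact Prod.ext h1 (Prod.ext h2 h3)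
  · rintro ⟨p, hp⟩
    obtain ⟨⟨y, f⟩, h, rfl⟩ := hT p hp
    rw [LinearMap.comp_apply, hr y f h hp]
    have h1 := inner_quot_sub_inner_quot h h
    change (-Complex.I * (inner ℂ (S.quot (y, f)).1 (S.quot (y, f)).2
      - inner ℂ (S.quot (y, f)).2 (S.quot (y, f)).1)).re
      = -(inner ℂ (y.toFun S.a) (triJ H K (y.toFun S.a))).im
        + ((tripletForm Hb (Γ ⟨y, S.mem_domTmax h⟩) (Γ ⟨y, S.mem_domTmax h⟩)).im
          + ‖Γh ⟨y, S.mem_domTmax h⟩‖ ^ 2)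
    rw [h1, mul_sub, Complex.sub_re, hΓ.re_boundaryForm, hJ]
    simp
    ring

end SymmetricSystem

theorem proposition3p6 {H K 𝓗 : Type*}
    [NormedAddCommGroup H] [InnerProductSpace ℂ H] [FiniteDimensional ℂ H]
    [NormedAddCommGroup K] [InnerProductSpace ℂ K] [FiniteDimensional ℂ K]
    [NormedAddCommGroup 𝓗] [InnerProductSpace ℂ 𝓗] [FiniteDimensional ℂ 𝓗]
    -- a definite symmetric system with `J` in normal form, and `n₋(Tmin) ≤ n₊(Tmin)`
    (S : SymmetricSystem (Tri H K)) (hJ : ∀ x, S.J x = triJ H K x) (hdef : S.IsDefinite)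
    (hn : defectNumber S.Tmin (-Complex.I) ≤ defectNumber S.Tmin Complex.I)
    (U : BoundaryOperator H K)
    -- the subspace `𝓗_b` of the finite-dimensional space `𝓗`, and the surjective map
    -- `Γ_b = (Γ_{0b}, Γ̂_b, Γ_{1b}) : dom tmax → 𝓗 ⊕ Ĥ ⊕ 𝓗_b` representing `[y, z]_b`
    (Hb : Submodule ℂ 𝓗)
    (Γ₀ : S.domTmax →ₗ[ℂ] 𝓗) (Γh : S.domTmax →ₗ[ℂ] K) (Γ₁ : S.domTmax →ₗ[ℂ] Hb)
    (hsurj : Function.Surjective (fun y : S.domTmax => (Γ₀ y, Γh y, Γ₁ y)))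
    (hΓ : ∀ y z : S.domTmax, S.boundaryForm y z =
      inner ℂ (Γ₁ z : 𝓗) (Γ₀ y) - inner ℂ (Γ₀ z) (Γ₁ y : 𝓗)
        + Complex.I * inner ℂ (Hbᗮ.starProjection (Γ₀ z)) (Hbᗮ.starProjection (Γ₀ y))
        + Complex.I * inner ℂ (Γh z) (Γh y))
    -- the relations `T`, `T_*` (the claimed adjoint) and `A₀` given by boundary conditions
    (T Tstar A₀ : Submodule ℂ (S.L2 × S.L2))
    (hT : T = S.relationOf (LinearMap.ker (U.gamma1A S) ⊓ LinearMap.ker (U.gammaHatA S - Γh)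
      ⊓ LinearMap.ker Γ₀ ⊓ LinearMap.ker Γ₁))
    (hTstar : Tstar = S.relationOf
      (LinearMap.ker (U.gamma1A S) ⊓ LinearMap.ker (U.gammaHatA S - Γh)))
    (hA₀ : A₀ = S.relationOf (LinearMap.ker (U.gamma1A S) ⊓ LinearMap.ker (U.gammaHatA S - Γh)
      ⊓ LinearMap.ker Γ₀)) :
    -- (1) `T` is a symmetric extension of `Tmin`, its adjoint, and its deficiency indices
    (IsSymmetricRelation T ∧ S.Tmin ≤ T ∧ T.adjoint = Tstar ∧
      S.nuBPlus ≠ ⊤ ∧ S.nuBMinus ≠ ⊤ ∧ (Module.finrank ℂ K : ℕ∞) ≤ S.nuBPlus ∧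
      (∀ l : ℂ, 0 < l.im → defectNumber T l = S.nuBPlus - Module.finrank ℂ K) ∧
      (∀ l : ℂ, l.im < 0 → defectNumber T l = S.nuBMinus)) ∧
    -- (2) the boundary triplet for `T*`; the maps are determined by their values on `tmax`
    ∃ (G₀ : T.adjoint →ₗ[ℂ] 𝓗) (G₁ : T.adjoint →ₗ[ℂ] Hb),
      (∀ (y f : S.PreL2) (hyf : (y, f) ∈ S.tmax) (hadj : S.quot (y, f) ∈ T.adjoint),
        G₀ ⟨S.quot (y, f), hadj⟩ = Γ₀ ⟨y, S.mem_domTmax hyf⟩ ∧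
        G₁ ⟨S.quot (y, f), hadj⟩ = -Γ₁ ⟨y, S.mem_domTmax hyf⟩) ∧
      IsBoundaryTriplet T Hb G₀ G₁ ∧
      (LinearMap.ker G₀).map T.adjoint.subtype = A₀ ∧
      IsMaximalSymmetricRelation A₀ ∧
      -- the case of equal deficiency indices of `Tmin`
      (defectNumber S.Tmin Complex.I = defectNumber S.Tmin (-Complex.I) →
        (∀ l : ℂ, l.im ≠ 0 → defectNumber T l = S.nuBMinus) ∧
        Hb = ⊤ ∧
        IsOrdinaryBoundaryTriplet T G₀ (Hb.subtype ∘ₗ G₁) ∧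
        A₀.adjoint = A₀) := by
  have : CompleteSpace (Tri H K) := FiniteDimensional.complete ℂ (Tri H K)
  let Γ : S.domTmax →ₗ[ℂ] 𝓗 × Hb := Γ₀.prod Γ₁
  have hB : S.IsBoundaryMap Γ Γh := by
    refine ⟨fun v k => ?_, hΓ⟩
    obtain ⟨y, hy⟩ := hsurj (v.1, k, v.2)
    simp only [Prod.mk.injEq] at hy
    exact ⟨y, Prod.ext hy.1 hy.2.2, hy.2.1⟩
  let L₀ : Submodule ℂ (𝓗 × Hb) := LinearMap.ker (LinearMap.fst ℂ 𝓗 Hb)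
  let L₁ : Submodule ℂ (𝓗 × Hb) := Hbᗮ.comap (LinearMap.fst ℂ 𝓗 Hb)
  let R : Submodule ℂ (𝓗 × Hb) → Submodule ℂ (S.L2 × S.L2) := fun L =>
    S.relationOf (SymmetricSystem.boundaryDomain U S Γ Γh L)
  have hadj : ∀ {L L' : Submodule ℂ (𝓗 × Hb)},
      (∀ w, w ∈ L' ↔ ∀ v ∈ L, tripletForm Hb v w = 0) → (R L).adjoint = R L' :=
    fun h => hB.adjoint_relationOf hJ hdef U h
  have hmono : ∀ {L L' : Submodule ℂ (𝓗 × Hb)}, L ≤ L' → R L ≤ R L' := fun h =>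
    SymmetricSystem.relationOf_mono fun y hy => by
      rw [SymmetricSystem.mem_boundaryDomain] at hy ⊢
      exact ⟨hy.1, hy.2.1, h hy.2.2⟩
  have eT : T = R ⊥ := by
    rw [hT]
    congr 1
    ext y
    simp [SymmetricSystem.boundaryDomain, Γ, and_assoc]
  have eTstar : Tstar = R ⊤ := by
    rw [hTstar]
    congr 1
    ext y
    simp [SymmetricSystem.boundaryDomain]
  have eA₀ : A₀ = R L₀ := by
    rw [hA₀]
    congr 1
  have hbot : (R ⊥).adjoint = R ⊤ := hadj fun w => by simp [tripletForm]
  have htop : (R ⊤).adjoint = R ⊥ := hadj fun w => by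
    rw [Submodule.mem_bot]
    constructor
    · rintro rfl v -
      simp [tripletForm]
    · exact fun h => eq_zero_of_tripletForm fun v => by
        rw [tripletForm_swap, h v Submodule.mem_top, map_zero, neg_zero]
  have h01 : (R L₀).adjoint = R L₁ := hadj mem_orthogonal_iff_tripletForm
  have h10 : (R L₁).adjoint = R L₀ := hadj mem_ker_fst_iff_tripletForm
  have hL01 : L₀ ≤ L₁ := fun v (hv : v.1 = 0) => by
    change v.1 ∈ Hbᗮ
    rw [hv]
    exact zero_mem _
  have hTadj : T.adjoint = R ⊤ := by rw [eT, hbot]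
  have hTsymm : IsSymmetricRelation T := by
    refine ⟨?_, ?_⟩
    · rw [eT, ← htop]
      exact Submodule.isClosed_adjoint _
    · rw [hTadj, eT]
      exact hmono bot_le
  obtain ⟨G, hG, hGsurj, hGform, hGL⟩ := hB.exists_boundaryValue hJ hdef U hTadj
  have hindices : ∀ {l : ℂ}, (0 < l.im → defectNumber T l = Module.finrank ℂ 𝓗) ∧
      (l.im < 0 → defectNumber T l = Module.finrank ℂ Hb) := by
    intro l
    refine hTsymm.defectNumber_eq hasSignature_tripletForm G hGsurj (fun p hp => ?_) fun p => ?_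
    · exact (Submodule.mem_bot ℂ).1 ((hGL ⊥ p).1 (eT ▸ hp : (p : S.L2 × S.L2) ∈ R ⊥))
    · rw [hGform]
      simp
  have hA₀symm : IsSymmetricRelation A₀ := by
    rw [eA₀]
    refine ⟨?_, ?_⟩
    · rw [← h10]
      exact Submodule.isClosed_adjoint _
    · rw [h01]
      exact hmono hL01
  refine ⟨⟨hTsymm, ?_, by rw [hTadj, eTstar], ?_, ?_, ?_, fun l hl => ?_, fun l hl => ?_⟩,
    LinearMap.fst ℂ 𝓗 Hb ∘ₗ G, -(LinearMap.snd ℂ 𝓗 Hb ∘ₗ G), fun y f hyf hm => ?_,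
    ⟨fun v => ?_, fun p q => ?_⟩, ?_, ⟨hA₀symm, fun A' hA' hle => ?_⟩, fun heq => ?_⟩
  · rw [eT]
    exact SymmetricSystem.relationOf_mono (hB.domTmin_le U ⊥)
  · rw [hB.nuBPlus_eq]
    exact ENat.natCast_ne_top _
  · rw [hB.nuBMinus_eq]
    exact ENat.natCast_ne_top _
  · rw [hB.nuBPlus_eq]
    exact_mod_cast Nat.le_add_left _ _
  · rw [hindices.1 hl, hB.nuBPlus_eq, ← ENat.natCast_sub, Nat.add_sub_cancel]
  · rw [hindices.2 hl, hB.nuBMinus_eq]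
  · have := hG y f hyf hm
    exact ⟨congrArg Prod.fst this, congrArg (fun v => -v.2) this⟩
  · obtain ⟨p, hp⟩ := hGsurj (v.1, -v.2)
    refine ⟨p, Prod.ext (congrArg (fun w => w.1) hp :) ?_⟩
    exact (congrArg (fun w => -w.2) hp).trans (neg_neg v.2)
  · rw [hGform]
    simp [tripletForm]
    ring
  · ext p
    rw [eA₀]
    constructor
    · rintro ⟨p, hp, rfl⟩
      exact (hGL L₀ p).2 hp
    · intro hp
      have hpT : p ∈ T.adjoint := by
        rw [hTadj]
        exact hmono le_top hp
      exact ⟨⟨p, hpT⟩, (hGL L₀ ⟨p, hpT⟩).1 hp, rfl⟩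
  · refine le_antisymm (fun p hp => ?_) hle
    -- `A' ⊆ A'* ⊆ A₀*`, and `[G p, G p] = 0` forces the component of `G₀ p` in `𝓗_bᗮ` to vanish
    have hp1 : p ∈ R L₁ := by
      rw [← h01, ← eA₀]
      exact Submodule.adjoint_antitone hle (hA'.2 hp)
    have hpT : p ∈ T.adjoint := by
      rw [hTadj]
      exact hmono le_top hp1
    have hv : (G ⟨p, hpT⟩).1 ∈ Hbᗮ := (hGL L₁ ⟨p, hpT⟩).1 hp1
    have h0 : tripletForm Hb (G ⟨p, hpT⟩) (G ⟨p, hpT⟩) = 0 := by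
      have := (Submodule.mem_adjoint_iff _ _).1 (hA'.2 hp) p.1 p.2 hp
      rw [← hGform, ← neg_eq_zero, neg_sub]
      exact this
    have h1 : (G ⟨p, hpT⟩).1 = 0 := by
      have e1 : inner ℂ ((G ⟨p, hpT⟩).2 : 𝓗) (G ⟨p, hpT⟩).1 = 0 :=
        (Submodule.mem_orthogonal _ _).1 hv _ (G ⟨p, hpT⟩).2.2
      have e2 : inner ℂ (G ⟨p, hpT⟩).1 ((G ⟨p, hpT⟩).2 : 𝓗) = 0 :=
        (Submodule.mem_orthogonal' _ _).1 hv _ (G ⟨p, hpT⟩).2.2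
      have e3 := Submodule.starProjection_eq_self_iff.2 hv
      simpa [tripletForm, e1, e2, e3] using h0
    rw [eA₀]
    exact (hGL L₀ ⟨p, hpT⟩).2 h1
  · have hdim : Module.finrank ℂ Hb = Module.finrank ℂ 𝓗 := by
      rw [(hB.defectNumber_Tmin hJ hdef).1 (by simp), (hB.defectNumber_Tmin hJ hdef).2 (by simp)]
        at heq
      have := ENat.natCast_inj.1 heq
      omega
    have hHb : Hb = ⊤ := Submodule.eq_top_of_finrank_eq hdim
    have hperp : Hbᗮ = ⊥ := by rw [hHb, Submodule.top_orthogonal_eq_bot]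
    refine ⟨fun l hl => ?_, hHb, ⟨fun v => ?_, fun p q => ?_⟩, ?_⟩
    · rw [hB.nuBMinus_eq]
      rcases lt_or_gt_of_ne hl with h | h
      · exact hindices.2 h
      · rw [hindices.1 h, hdim]
    · obtain ⟨p, hp⟩ := hGsurj (v.1, -⟨v.2, hHb ▸ Submodule.mem_top⟩)
      refine ⟨p, Prod.ext (congrArg (fun w => w.1) hp :) ?_⟩
      have := congrArg (fun w : 𝓗 × Hb => ((-w.2 : Hb) : 𝓗)) hp
      simpa using this
    · have h0 : ∀ x : 𝓗, Hbᗮ.starProjection x = 0 := fun x => by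
        have h : Hbᗮ.starProjection x ∈ Hbᗮ := Submodule.starProjection_apply_mem Hbᗮ x
        exact (Submodule.mem_bot ℂ).1 (hperp.le h)
      rw [hGform, tripletForm, h0, inner_zero_left]
      simp
      ring
    · have hL : L₁ = L₀ := by
        ext v
        change v.1 ∈ Hbᗮ ↔ v.1 = 0
        rw [hperp, Submodule.mem_bot]
      rw [eA₀, h01, hL]
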